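/- Let $G:\mathbb R\times(0,\infty)\to\mathbb R$ satisfy: (i) there are integers $q>1$ and $M>0$ such that $G(\cdot,1)\in C^{q+1}(\mathbb R)$ and $\sup_{x\in\mathbb R}(1+|x|)^{M+2}|\partial_x^jG(x,1)|<\infty$ for $j=0,\dots,q+1$; (ii) there is $d>0$ such that $G(x,t)=t^{-1/d}G(t^{-1/d}x,1)$ for $x\in\mathbb R$, $t>0$; (iii) $G(x,t)=\int_{\mathbb R}G(x-y,t-s)G(y,s)\,dy$ for $x\in\mathbb R$, $t>s>0$; (iv) $G\ge 0$ and $G\not\equiv 0$. Let $p>0$, let $c$ be a positive function on $(1,\infty)$, integrable on $(1,T)$ for every $T>1$, with $c(t)=t^p+o(t^p)$ as $t\to\infty$, and let $s(t)=\int_1^tc(\tau)\,d\tau$. Let $\alpha$ be an integer with $\alpha>(p+1+d)/(p+1)$, and let $\sum_{j\ge\alpha}a_ju^j$ be a real power series with radius of convergence $\rho\in(0,\infty]$. For $\lambda\in[-1,1]$ put $F(u)=\lambda\sum_{j\ge\alpha}a_ju^j$. With $\hat f(\omega)=\int_{\mathbb R} e^{-i\omega x}f(x)\,dx$, let $\mathcal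 B_q$ be the space of the integrable $f:\mathbb R\to\mathbb R$ such that $\hat f\in C^1(\mathbb R)$ and $\|f\|=\sup_{\omega\in\mathbb R}(1+|\omega|^q)\big(|\hat f(\omega)|+|\hat f'(\omega)|\big)<\infty$. Consider the integral equation $$u(x,t)=\int_{\mathbb R}G(x-y,s(t))f(y)\,dy+\int_1^t\int_{\mathbb R}G(x-y,s(t)-s(\tau))F(u(y,\tau))\,dy\,d\tau,\qquad x\in\mathbb R,\ t>1.\tag{$*$}$$ A solution is a function $u:\mathbb R\times(1,\infty)\to\mathbb R$ such that $u(\cdot,t)\in\mathcal B_q$ for all $t>1$; for every $T>1$, $\sup_{1<t\le T}\|u(\cdot,t)\|<\infty$ and $\sup_{x\in\mathbb R,\,1<t\le T}|u(x,t)|<\rho$; and, for all $x\in\mathbb R$ and $t>1$, the double integral in $(*)$ converges absolutely and $(*)$ holds. Then there is $\epsilon>0$, independent of $\lambda$ and $f$, such that for all $\lambda\in[-1,1]$ and all $f\in\mathcal B_q$ with $\|f\|<\epsilon$ the equation $(*)$ has a unique solution $u$, and there is a constant $A\in\mathbb R$ such that $$\lim_{t\to\infty}\big\|t^{(p+1)/d}\,u(t^{(p+1)/d}\,\cdot\,,t)-A\,f_p^*\big\|=0,\qquad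 f_p^*(x)=G\Big(x,\frac1{p+1}\Big).$$ -/

import Mathlib

open MeasureTheory Filter Topology Asymptotics
open scoped ENNReal NNReal

noncomputable section

namespace RGIntegral

/-- The Fourier transform `f̂(ω) = ∫ e^{-iωx} f(x) dx` of a real function on the line. -/
def fourierT (f : ℝ → ℝ) (ω : ℝ) : ℂ :=
  ∫ x : ℝ, Complex.exp (-(Complex.I * (ω : ℂ) * (x : ℂ))) * (f x : ℂ)

/-- Relation with the Fourier transform of Mathlib, whose frequency is `ω / (2π)`. -/
theorem fourierT_eq (f : ℝ → ℝ) (ω : ℝ) :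
    fourierT f ω = FourierTransform.fourier (fun x : ℝ => (f x : ℂ)) (ω / (2 * Real.pi)) := by
  rw [Real.fourier_real_eq_integral_exp_smul]
  unfold fourierT
  congr 1
  ext x
  rw [smul_eq_mul]
  congr 2
  push_cast
  have : (Real.pi : ℂ) ≠ 0 := by exact_mod_cast Real.pi_ne_zero
  field_simp

/-- `‖f‖ = sup_ω (1 + |ω|^q) (|f̂(ω)| + |f̂'(ω)|)`, with values in `[0, ∞]`. -/
def bqNorm (q : ℕ) (f : ℝ → ℝ) : ℝ≥0∞ :=
  ⨆ ω : ℝ, ENNReal.ofReal ((1 + |ω| ^ q) * (‖fourierT f ω‖ + ‖deriv (fourierT f) ω‖))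

/-- The space `B_q` (`q > 1`). Integrability makes the Fourier integral meaningful; it is no
restriction, since `f̂ ∈ C¹` with a finite norm forces `f` and `x f` into `L²`,
hence `f` into `L¹`. -/
structure MemBq (q : ℕ) (f : ℝ → ℝ) : Prop where
  integrable : Integrable f
  contDiff : ContDiff ℝ 1 (fourierT f)
  norm_lt_top : bqNorm q f < ∞

/-- The hypotheses **(G)** on the kernel `G(x, t)`, `x ∈ ℝ`, `t > 0`. -/
structure KernelG (q M : ℕ) (d : ℝ) (G : ℝ → ℝ → ℝ) : Prop where
  one_lt_q : 1 < q
  M_pos : 0 < M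
  smooth : ContDiff ℝ ((q + 1 : ℕ) : WithTop ℕ∞) (fun x => G x 1)
  decay : ∀ j ≤ q + 1, ∃ C : ℝ, ∀ x : ℝ,
    (1 + |x|) ^ (M + 2) * |iteratedDeriv j (fun y => G y 1) x| ≤ C
  d_pos : 0 < d
  scaling : ∀ x t : ℝ, 0 < t → G x t = t ^ (-(1 / d)) * G (t ^ (-(1 / d)) * x) 1
  semigroup : ∀ x s t : ℝ, 0 < s → s < t → G x t = ∫ y : ℝ, G (x - y) (t - s) * G y s
  nontrivial : ∃ x t : ℝ, 0 < t ∧ G x t ≠ 0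
  nonneg : ∀ x t : ℝ, 0 < t → 0 ≤ G x t

/-- The hypotheses on the coefficient `c`: positive, locally integrable up to the initial time
(so that `s(t)` is finite), and `c(t) = t^p + o(t^p)` as `t → ∞`, with `p > 0`. -/
structure CoeffC (p : ℝ) (c : ℝ → ℝ) : Prop where
  p_pos : 0 < p
  pos : ∀ t : ℝ, 1 < t → 0 < c t
  locInt : LocallyIntegrableOn c (Set.Ici 1)
  asymp : (fun t => c t - t ^ p) =o[atTop] (fun t => t ^ p)

/-- `s(t) = ∫₁ᵗ c(τ) dτ`. -/
def timeS (c : ℝ → ℝ) (t : ℝ) : ℝ := ∫ τ in (1 : ℝ)..t, c τ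

/-- `F(u) = lam * ∑_{j ≥ α} a_j u^j`. -/
def nonlin (lam : ℝ) (α : ℕ) (a : ℕ → ℝ) (u : ℝ) : ℝ :=
  lam * ∑' j : ℕ, a (α + j) * u ^ (α + j)

/-- The radius of convergence of `∑ a_j u^j`
(it does not depend on the coefficients with `j < α`). -/
def convRadius (a : ℕ → ℝ) : ℝ≥0∞ :=
  (FormalMultilinearSeries.ofScalars ℝ a : FormalMultilinearSeries ℝ ℝ ℝ).radius

/-- `u` is a global solution of
`u(x,t) = ∫ G(x-y, s(t)) f(y) dy + ∫₁ᵗ ∫ G(x-y, s(t)-s(τ)) F(u(y,τ)) dy dτ`, `x ∈ ℝ`, `t > 1`.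
The values `u x t` with `t ≤ 1` play no role. -/
structure IsSolution (q : ℕ) (G : ℝ → ℝ → ℝ) (c : ℝ → ℝ) (lam : ℝ) (α : ℕ) (a : ℕ → ℝ)
    (f : ℝ → ℝ) (u : ℝ → ℝ → ℝ) : Prop where
  memBq : ∀ t : ℝ, 1 < t → MemBq q (fun x => u x t)
  /-- the norm in `B_q` is bounded on bounded time intervals -/
  bounded : ∀ T : ℝ, ∃ C : ℝ≥0, ∀ t : ℝ, 1 < t → t ≤ T → bqNorm q (fun x => u x t) ≤ C
  /-- the values of `u` stay in the disc where the series `F` converges,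
  uniformly on bounded time intervals -/
  inDisc : ∀ T : ℝ, ∃ r : ℝ≥0, (r : ℝ≥0∞) < convRadius a ∧
    ∀ x t : ℝ, 1 < t → t ≤ T → |u x t| ≤ r
  /-- the double integral in the equation converges absolutely -/
  integrable : ∀ x t : ℝ, 1 < t →
    IntegrableOn
      (fun z : ℝ × ℝ => G (x - z.1) (timeS c t - timeS c z.2) * nonlin lam α a (u z.1 z.2))
      (Set.univ ×ˢ Set.Ioo 1 t)
  equation : ∀ x t : ℝ, 1 < t →
    u x t = (∫ y : ℝ, G (x - y) (timeS c t) * f y) +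
      ∫ τ in (1 : ℝ)..t, ∫ y : ℝ,
        G (x - y) (timeS c t - timeS c τ) * nonlin lam α a (u y τ)

end RGIntegral

end

namespace RGIntegral

/-! ### Differentiation under the integral sign -/

/-! Let ℓ(t) = (1 + s(t))^{1/d} be the natural length at time t. All estimates are made in Fourier
space with the moving weight 1 + (ℓ(t)|ω|)^q, and the smallness of the data makes the integral
equation a contraction globally in time. Three facts carry this. (a) The inverse weight at scale L
has mass proportional to 1/L, so every product of two functions at scale L gains 1/L (`FBound.mul`),
and F(u) gains ℓ^{-(α-1)} (`FBound.nonlin_sub`). (b) The kernel at time σ has scale σ^{1/d}. Since 1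
+ s(t) ≤ 2 max(s(t) - s(τ), 1 + s(τ)), convolution with it moves data from scale ℓ(τ) to scale ℓ(t)
at a cost independent of τ and t (`TimeData.fBound_heat`). (c) ℓ(t) behaves like a multiple of
t^{(p+1)/d}, so ℓ^{-(α-1)} is integrable in time when (α-1)(p+1)/d > 1, which is the hypothesis on α
(`CoeffC.timeData`). On a ball of small radius the Duhamel map then contracts by 1/2, and
`Adm.exists_fixedPoint` gives the solution.

Asymptotics (`TimeData.eventually_fBound_sub`): A = ∫f + ∫₁^∞∫F(u). With l = t^{(p+1)/d}, the
contribution of a source v emitted at time τ has, after rescaling by l, the transform ĝ(μω) v̂(ω/l),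
where g = G(·,1) and μ → κ = (p+1)^{-1/d}. Its limit is (∫v) ĝ(κω), the transform of (∫v) f_p^*. The
decay of ĝ and ĝ' with power q+1 in place of q makes this convergence hold in the weighted norm,
uniformly over sources emitted before a fixed time T; sources emitted after T are small by (c).

Uniqueness needs no smallness: on a bounded time interval two solutions stay in a common compact
subinterval of the disc, where F is Lipschitz, and iterating the equation bounds their difference by
the terms of an exponential series (`IsSolution.abs_sub_le`). -/

theorem contDiff_one_integral_of_bound {T : Type*} [MeasurableSpace T] {μ : Measure T}
    {h : T → ℝ → ℂ} {b : T → ℝ} (hb : Integrable b μ)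
    (hm : ∀ ω, AEStronglyMeasurable (fun τ => h τ ω) μ)
    (hC : ∀ᵐ τ ∂μ, ContDiff ℝ 1 (h τ))
    (h0 : ∀ᵐ τ ∂μ, ∀ ω, ‖h τ ω‖ ≤ b τ) (h1 : ∀ᵐ τ ∂μ, ∀ ω, ‖deriv (h τ) ω‖ ≤ b τ) :
    ContDiff ℝ 1 (fun ω => ∫ τ, h τ ω ∂μ) ∧
      ∀ ω, deriv (fun ω => ∫ τ, h τ ω ∂μ) ω = ∫ τ, deriv (h τ) ω ∂μ := by
  have hdiff : ∀ᵐ τ ∂μ, ∀ ω, HasDerivAt (h τ) (deriv (h τ) ω) ω := by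
    filter_upwards [hC] with τ hτ ω
    exact (hτ.differentiable one_ne_zero ω).hasDerivAt
  have hm' : ∀ ω, AEStronglyMeasurable (fun τ => deriv (h τ) ω) μ := by
    intro ω
    -- Measurability in τ is assumed for `h` only; the derivative inherits it as a limit of
    -- difference quotients.
    refine aestronglyMeasurable_of_tendsto_ae (u := (atTop : Filter ℕ))
      (f := fun (n : ℕ) τ => (1 / ((n : ℝ) + 1))⁻¹ • (h τ (ω + 1 / ((n : ℝ) + 1)) - h τ ω)) ?_ ?_
    · intro n
      exact ((hm _).sub (hm _)).const_smul (1 / ((n : ℝ) + 1))⁻¹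
    · filter_upwards [hdiff] with τ hτ
      have := (hasDerivAt_iff_tendsto_slope_zero.1 (hτ ω))
      refine this.comp (tendsto_nhdsWithin_iff.2 ⟨tendsto_one_div_add_atTop_nhds_zero_nat, ?_⟩)
      filter_upwards with n
      simp only [Set.mem_compl_iff, Set.mem_singleton_iff]
      positivity
  have key : ∀ ω, HasDerivAt (fun ω => ∫ τ, h τ ω ∂μ) (∫ τ, deriv (h τ) ω ∂μ) ω := by
    intro ω
    refine (hasDerivAt_integral_of_dominated_loc_of_deriv_le (F := fun ω τ => h τ ω)
      (F' := fun ω τ => deriv (h τ) ω) (bound := b)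
      (s := Set.univ) univ_mem (Eventually.of_forall hm) ?_ (hm' ω) ?_ hb ?_).2
    · exact hb.mono' (hm ω) (h0.mono fun τ hτ => hτ ω)
    · exact h1.mono fun τ hτ ω _ => hτ ω
    · exact hdiff.mono fun τ hτ ω _ => hτ ω
  have hd : ∀ ω, deriv (fun ω => ∫ τ, h τ ω ∂μ) ω = ∫ τ, deriv (h τ) ω ∂μ :=
    fun ω => (key ω).deriv
  refine ⟨contDiff_one_iff_deriv.2 ⟨fun ω => (key ω).differentiableAt, ?_⟩, hd⟩
  rw [funext hd]
  refine continuous_of_dominated hm' (fun ω => h1.mono fun τ hτ => hτ ω) hb ?_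
  filter_upwards [hC] with τ hτ
  exact hτ.continuous_deriv le_rfl

/-! ### The Fourier transform -/

theorem norm_fourier_kernel (ω x : ℝ) : ‖Complex.exp (-(Complex.I * (ω : ℂ) * (x : ℂ)))‖ = 1 := by
  rw [Complex.norm_exp]; simp

theorem integrable_fourier_integrand {f : ℝ → ℝ} (hf : Integrable f) (ω : ℝ) :
    Integrable (fun x : ℝ => Complex.exp (-(Complex.I * (ω : ℂ) * (x : ℂ))) * (f x : ℂ)) := by
  refine hf.ofReal.bdd_mul (c := 1) (Continuous.aestronglyMeasurable (by fun_prop)) ?_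
  filter_upwards with x
  rw [norm_fourier_kernel]

theorem fourierT_zero_right (f : ℝ → ℝ) : fourierT f 0 = ((∫ x, f x : ℝ) : ℂ) := by
  simp [fourierT, integral_complex_ofReal]

theorem fourierT_sub {f g : ℝ → ℝ} (hf : Integrable f) (hg : Integrable g) (ω : ℝ) :
    fourierT (fun x => f x - g x) ω = fourierT f ω - fourierT g ω := by
  unfold fourierT
  rw [← integral_sub (integrable_fourier_integrand hf ω) (integrable_fourier_integrand hg ω)]
  congr 1; ext x; push_cast; ring

theorem fourierT_add {f g : ℝ → ℝ} (hf : Integrable f) (hg : Integrable g) (ω : ℝ) :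
    fourierT (fun x => f x + g x) ω = fourierT f ω + fourierT g ω := by
  unfold fourierT
  rw [← integral_add (integrable_fourier_integrand hf ω) (integrable_fourier_integrand hg ω)]
  congr 1; ext x; push_cast; ring

theorem fourierT_const_mul (r : ℝ) (f : ℝ → ℝ) (ω : ℝ) :
    fourierT (fun x => r * f x) ω = r * fourierT f ω := by
  unfold fourierT
  rw [← integral_const_mul]
  congr 1; ext x; push_cast; ring

theorem fourierT_dilate {l : ℝ} (hl : 0 < l) (f : ℝ → ℝ) (ω : ℝ) :
    fourierT (fun x => l * f (l * x)) ω = fourierT f (ω / l) := by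
  unfold fourierT
  have := Measure.integral_comp_mul_left
    (fun x : ℝ => (l : ℂ) * (Complex.exp (-(Complex.I * ((ω / l : ℝ) : ℂ) * (x : ℂ))) * (f x : ℂ))) l
  have hl' : (l : ℂ) ≠ 0 := by exact_mod_cast hl.ne'
  rw [integral_const_mul (l : ℂ) (fun x : ℝ => Complex.exp (-(Complex.I * ((ω / l : ℝ) : ℂ) *
    (x : ℂ))) * (f x : ℂ)), abs_of_pos (inv_pos.2 hl), Complex.real_smul, Complex.ofReal_inv,
    ← mul_assoc, inv_mul_cancel₀ hl', one_mul] at this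
  rw [← this]
  congr 1; ext x
  push_cast
  rw [show Complex.I * (↑ω / ↑l) * (↑l * ↑x) = Complex.I * (ω : ℂ) * x by field_simp]
  ring

theorem fourierT_integral {T : Type*} [MeasurableSpace T] {μ : Measure T} [SFinite μ]
    {w : T → ℝ → ℝ} (hw : Integrable (Function.uncurry w) (μ.prod volume)) (ω : ℝ) :
    fourierT (fun x => ∫ τ, w τ x ∂μ) ω = ∫ τ, fourierT (w τ) ω ∂μ := by
  unfold fourierT
  rw [integral_integral_swap]
  · congr 1; ext x
    rw [integral_const_mul, integral_complex_ofReal]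
  · refine hw.ofReal.bdd_mul (c := 1) (Measurable.aestronglyMeasurable
      (f := fun z : T × ℝ => Complex.exp (-(Complex.I * (ω : ℂ) * (z.2 : ℂ)))) (by fun_prop)) ?_
    · filter_upwards with x
      rw [norm_fourier_kernel]

theorem fourierT_inversion {f : ℝ → ℝ} (hc : Continuous f) (hf : Integrable f)
    (hF : Integrable (fourierT f)) (x : ℝ) :
    (f x : ℂ) = (2 * Real.pi : ℝ)⁻¹ * ∫ ω : ℝ, Complex.exp (Complex.I * ω * x) * fourierT f ω := by
  have hpi : (0:ℝ) < 2 * Real.pi := by positivity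
  have e : FourierTransform.fourier (fun x : ℝ => (f x : ℂ)) =
      fun ω => fourierT f (ω * (2 * Real.pi)) := by
    ext ω
    rw [fourierT_eq]; field_simp
  have hi : Integrable (FourierTransform.fourier (fun x : ℝ => (f x : ℂ))) := by
    rw [e]
    exact hF.comp_mul_right' hpi.ne'
  have := congrFun (Continuous.fourierInv_fourier_eq (f := fun x : ℝ => (f x : ℂ))
    (Complex.continuous_ofReal.comp hc) hf.ofReal hi) x
  rw [← this, Real.fourierInv_eq', e]
  have h2 := Measure.integral_comp_mul_right
    (fun ω : ℝ => Complex.exp (Complex.I * ω * x) * fourierT f ω) (2 * Real.pi)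
  rw [abs_of_pos (inv_pos.2 hpi), Complex.real_smul] at h2
  rw [← h2]
  congr 1; ext ω
  simp only [smul_eq_mul, RCLike.inner_apply, conj_trivial]
  congr 2
  push_cast; ring

/-! ### Weights -/

/-- The weight `1 + (L|ω|)^q`. -/
def wt (q : ℕ) (L ω : ℝ) : ℝ := 1 + (L * |ω|) ^ q

theorem one_le_wt (q : ℕ) {L : ℝ} (hL : 0 ≤ L) (ω : ℝ) : 1 ≤ wt q L ω := by
  unfold wt
  have : 0 ≤ (L * |ω|) ^ q := by positivity
  linarith

theorem wt_pos (q : ℕ) {L : ℝ} (hL : 0 ≤ L) (ω : ℝ) : 0 < wt q L ω :=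
  one_pos.trans_le (one_le_wt q hL ω)

theorem continuous_wt (q : ℕ) (L : ℝ) : Continuous (wt q L) := by
  unfold wt; fun_prop

theorem wt_eq_one_mul (q : ℕ) {L : ℝ} (hL : 0 ≤ L) (ω : ℝ) : wt q L ω = wt q 1 (L * ω) := by
  unfold wt; rw [abs_mul, abs_of_nonneg hL, one_mul]

theorem wt_mono (q : ℕ) {L L' : ℝ} (hL : 0 ≤ L) (h : L ≤ L') (ω : ℝ) : wt q L ω ≤ wt q L' ω := by
  unfold wt; gcongr

theorem integrable_inv_wt_one {q : ℕ} (hq : 1 < q) : Integrable (fun ω => (wt q 1 ω)⁻¹) := by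
  have h := integrable_one_add_norm (E := ℝ) (μ := volume) (r := q) (by simpa using hq)
  refine (h.const_mul (2 ^ (q - 1))).mono'
    ((continuous_wt q 1).inv₀ fun ω => (wt_pos q zero_le_one ω).ne').aestronglyMeasurable ?_
  filter_upwards with ω
  have h1 := wt_pos q zero_le_one ω
  rw [Real.norm_of_nonneg (inv_nonneg.2 h1.le), Real.rpow_neg (by positivity), Real.rpow_natCast,
    inv_le_iff_one_le_mul₀ h1, mul_comm _ (wt q 1 ω), ← mul_assoc, ← div_eq_mul_inv,
    one_le_div (by positivity)]
  have := add_pow_le zero_le_one (abs_nonneg ω) q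
  unfold wt
  rw [one_pow] at this
  rw [one_mul, Real.norm_eq_abs]
  linarith

theorem integrable_inv_wt {q : ℕ} (hq : 1 < q) {L : ℝ} (hL : 0 < L) :
    Integrable (fun ω => (wt q L ω)⁻¹) := by
  have := (integrable_inv_wt_one hq).comp_mul_left' hL.ne'
  refine this.congr (Eventually.of_forall fun ω => ?_)
  simp only [wt_eq_one_mul q hL.le ω]

/-- The mass of `1 / (1 + |ω|^q)`. -/
noncomputable def wtMass (q : ℕ) : ℝ := ∫ ω, (wt q 1 ω)⁻¹

theorem wtMass_nonneg (q : ℕ) : 0 ≤ wtMass q :=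
  integral_nonneg fun ω => inv_nonneg.2 (wt_pos q zero_le_one ω).le

theorem integral_inv_wt (q : ℕ) {L : ℝ} (hL : 0 < L) :
    ∫ ω, (wt q L ω)⁻¹ = wtMass q / L := by
  have := Measure.integral_comp_mul_left (fun ω => (wt q 1 ω)⁻¹) L
  simp only [← wt_eq_one_mul q hL.le] at this
  rw [this, abs_of_pos (inv_pos.2 hL), smul_eq_mul, wtMass]
  ring

theorem wt_le_add (q : ℕ) {L : ℝ} (hL : 0 ≤ L) (ω η : ℝ) :
    wt q L ω ≤ 2 ^ q * (wt q L (ω - η) + wt q L η) := by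
  have h1 : (L * |ω|) ^ q ≤ (L * |ω - η| + L * |η|) ^ q := by
    gcongr
    rw [← mul_add]
    gcongr
    simpa using abs_add_le (ω - η) η
  have h2 := add_pow_le (a := L * |ω - η|) (b := L * |η|) (by positivity) (by positivity) q
  have h3 : (2:ℝ) ^ (q - 1) ≤ 2 ^ q := by gcongr <;> simp
  have h4 : (1:ℝ) ≤ 2 ^ q := one_le_pow₀ one_le_two
  have h5 : (2:ℝ) ^ (q - 1) * ((L * |ω - η|) ^ q + (L * |η|) ^ q) ≤
    2 ^ q * ((L * |ω - η|) ^ q + (L * |η|) ^ q) := by gcongr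
  unfold wt
  nlinarith

/-- The constant of the embedding into `L^∞` and of the product estimate. -/
noncomputable def algK (q : ℕ) : ℝ := 2 ^ (q + 1) * wtMass q

theorem algK_nonneg (q : ℕ) : 0 ≤ algK q := mul_nonneg (by positivity) (wtMass_nonneg q)

theorem integrable_inv_wt_sub {q : ℕ} (hq : 1 < q) {L : ℝ} (hL : 0 < L) (ω : ℝ) :
    Integrable (fun η => (wt q L (ω - η))⁻¹) :=
  (integrable_inv_wt hq hL).comp_sub_left ω

theorem wt_mul_inv_wt_mul_le (q : ℕ) {L : ℝ} (hL : 0 < L) (ω η : ℝ) :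
    wt q L ω * ((wt q L (ω - η))⁻¹ * (wt q L η)⁻¹) ≤
      2 ^ q * ((wt q L (ω - η))⁻¹ + (wt q L η)⁻¹) := by
  have h1 := wt_pos q hL.le (ω - η)
  have h2 := wt_pos q hL.le η
  have h3 := wt_le_add q hL.le ω η
  calc _ ≤ (2 ^ q * (wt q L (ω - η) + wt q L η)) * ((wt q L (ω - η))⁻¹ * (wt q L η)⁻¹) := by
        gcongr
    _ = _ := by field_simp; ring

/-- By `wt_mul_inv_wt_mul_le` the weighted product of two inverse weights is at most 2^q times their
sum, and each of the two has integral `wtMass q / L`. This is the origin of both `algK` and the gain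
1/L. -/
theorem norm_convolution_le {q : ℕ} (hq : 1 < q) {L : ℝ} (hL : 0 < L) {h k : ℝ → ℂ} {B B' : ℝ}
    (hB : 0 ≤ B)
    (hh : ∀ ω, wt q L ω * ‖h ω‖ ≤ B) (hk : ∀ ω, wt q L ω * ‖k ω‖ ≤ B') (ω : ℝ) :
    wt q L ω * ‖∫ η, h (ω - η) * k η‖ ≤ algK q / L * B * B' := by
  have hi : Integrable fun η => B * B' * (2 ^ q * ((wt q L (ω - η))⁻¹ + (wt q L η)⁻¹)) :=
    (((integrable_inv_wt_sub hq hL ω).add (integrable_inv_wt hq hL)).const_mul _).const_mul _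
  have e : ∫ η, B * B' * (2 ^ q * ((wt q L (ω - η))⁻¹ + (wt q L η)⁻¹)) =
      algK q / L * B * B' := by
    rw [integral_const_mul, integral_const_mul, integral_add (integrable_inv_wt_sub hq hL ω)
      (integrable_inv_wt hq hL), integral_sub_left_eq_self (fun η => (wt q L η)⁻¹) volume ω,
      integral_inv_wt q hL, algK]
    ring
  rw [← e]
  have hw := wt_pos q hL.le ω
  have : wt q L ω * ‖∫ η, h (ω - η) * k η‖ = ‖∫ η, (wt q L ω : ℂ) * (h (ω - η) * k η)‖ := by
    rw [integral_const_mul, norm_mul, Complex.norm_real, Real.norm_of_nonneg hw.le]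
  rw [this]
  refine norm_integral_le_of_norm_le hi (Eventually.of_forall fun η => ?_)
  rw [norm_mul, norm_mul, Complex.norm_real, Real.norm_of_nonneg hw.le]
  have h1 := wt_pos q hL.le (ω - η)
  have h2 := wt_pos q hL.le η
  have a1 : ‖h (ω - η)‖ ≤ B * (wt q L (ω - η))⁻¹ := by
    rw [← div_eq_mul_inv, le_div_iff₀ h1, mul_comm]; exact hh _
  have a2 : ‖k η‖ ≤ B' * (wt q L η)⁻¹ := by
    rw [← div_eq_mul_inv, le_div_iff₀ h2, mul_comm]; exact hk _
  have hB' : 0 ≤ B' := (mul_nonneg h2.le (norm_nonneg _)).trans (hk η)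
  calc _ ≤ wt q L ω * ((B * (wt q L (ω - η))⁻¹) * (B' * (wt q L η)⁻¹)) := by gcongr
    _ = B * B' * (wt q L ω * ((wt q L (ω - η))⁻¹ * (wt q L η)⁻¹)) := by ring
    _ ≤ _ := by gcongr B * B' * ?_; exact wt_mul_inv_wt_mul_le q hL ω η

/-! ### Functions with weighted Fourier bounds -/

/-- `u` is integrable with `‖u‖₁ ≤ N`, and `û ∈ C¹` with
`(1 + (L|ω|)^q) |û(ω)| ≤ B`, `(1 + (L|ω|)^q) |û'(ω)| ≤ L B`. -/
structure FBound (q : ℕ) (L B N : ℝ) (u : ℝ → ℝ) : Prop where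
  integrable : Integrable u
  l1 : ∫ x, |u x| ≤ N
  contDiff : ContDiff ℝ 1 (fourierT u)
  bd : ∀ ω, wt q L ω * ‖fourierT u ω‖ ≤ B
  bd_deriv : ∀ ω, wt q L ω * ‖deriv (fourierT u) ω‖ ≤ L * B

namespace FBound

variable {q : ℕ} {L B N B' N' : ℝ} {u v : ℝ → ℝ}

theorem nonneg_B (h : FBound q L B N u) (hL : 0 ≤ L) : 0 ≤ B :=
  (mul_nonneg (wt_pos q hL 0).le (norm_nonneg _)).trans (h.bd 0)

theorem nonneg_N (h : FBound q L B N u) : 0 ≤ N :=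
  (integral_nonneg fun _ => abs_nonneg _).trans h.l1

theorem mono (h : FBound q L B N u) (hL : 0 ≤ L) (hB : B ≤ B') (hN : N ≤ N') :
    FBound q L B' N' u :=
  ⟨h.integrable, h.l1.trans hN, h.contDiff, fun ω => (h.bd ω).trans hB,
    fun ω => (h.bd_deriv ω).trans (by gcongr)⟩

theorem norm_le (h : FBound q L B N u) (hL : 0 ≤ L) (ω : ℝ) : ‖fourierT u ω‖ ≤ B :=
  (le_mul_of_one_le_left (norm_nonneg _) (one_le_wt q hL ω)).trans (h.bd ω)

theorem norm_deriv_le (h : FBound q L B N u) (hL : 0 ≤ L) (ω : ℝ) :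
    ‖deriv (fourierT u) ω‖ ≤ L * B :=
  (le_mul_of_one_le_left (norm_nonneg _) (one_le_wt q hL ω)).trans (h.bd_deriv ω)

theorem hasDerivAt (h : FBound q L B N u) (ω : ℝ) :
    HasDerivAt (fourierT u) (deriv (fourierT u) ω) ω :=
  (h.contDiff.differentiable one_ne_zero ω).hasDerivAt

theorem zero (q : ℕ) (L : ℝ) : FBound q L 0 0 (fun _ => 0) := by
  have e : fourierT (fun _ => 0) = fun _ => 0 := by ext ω; simp [fourierT]
  refine ⟨integrable_zero _ _ _, by simp, ?_, fun ω => ?_, fun ω => ?_⟩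
  · rw [e]; exact contDiff_const
  · simp [e]
  · simp [e]

theorem add (hu : FBound q L B N u) (hv : FBound q L B' N' v) (hL : 0 ≤ L) :
    FBound q L (B + B') (N + N') (fun x => u x + v x) := by
  have e : fourierT (fun x => u x + v x) = fun ω => fourierT u ω + fourierT v ω :=
    funext (fourierT_add hu.integrable hv.integrable)
  refine ⟨hu.integrable.add hv.integrable, ?_, ?_, fun ω => ?_, fun ω => ?_⟩
  · refine le_trans ?_ (add_le_add hu.l1 hv.l1)
    rw [← integral_add hu.integrable.abs hv.integrable.abs]
    exact integral_mono (hu.integrable.add hv.integrable).abs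
      (hu.integrable.abs.add hv.integrable.abs) fun x => abs_add_le _ _
  · rw [e]; exact hu.contDiff.add hv.contDiff
  · rw [e]
    have := mul_le_mul_of_nonneg_left (norm_add_le (fourierT u ω) (fourierT v ω))
      (wt_pos q hL ω).le
    linarith [hu.bd ω, hv.bd ω]
  · rw [e, ((hu.hasDerivAt ω).fun_add (hv.hasDerivAt ω)).deriv]
    have := mul_le_mul_of_nonneg_left
      (norm_add_le (deriv (fourierT u) ω) (deriv (fourierT v) ω)) (wt_pos q hL ω).le
    linarith [hu.bd_deriv ω, hv.bd_deriv ω]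

theorem const_mul (hu : FBound q L B N u) (r : ℝ) :
    FBound q L (|r| * B) (|r| * N) (fun x => r * u x) := by
  have e : fourierT (fun x => r * u x) = fun ω => (r : ℂ) * fourierT u ω :=
    funext (fourierT_const_mul r u)
  refine ⟨hu.integrable.const_mul r, ?_, ?_, fun ω => ?_, fun ω => ?_⟩
  · simp only [abs_mul]
    rw [integral_const_mul]
    exact mul_le_mul_of_nonneg_left hu.l1 (abs_nonneg r)
  · rw [e]; exact contDiff_const.mul hu.contDiff
  · rw [e]
    simp only [norm_mul, Complex.norm_real, Real.norm_eq_abs]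
    have := mul_le_mul_of_nonneg_left (hu.bd ω) (abs_nonneg r)
    linarith
  · rw [e, ((hu.hasDerivAt ω).const_mul (r : ℂ)).deriv]
    simp only [norm_mul, Complex.norm_real, Real.norm_eq_abs]
    have := mul_le_mul_of_nonneg_left (hu.bd_deriv ω) (abs_nonneg r)
    linarith

theorem neg (hu : FBound q L B N u) : FBound q L B N (fun x => -u x) := by
  simpa using hu.const_mul (-1)

theorem sub (hu : FBound q L B N u) (hv : FBound q L B' N' v) (hL : 0 ≤ L) :
    FBound q L (B + B') (N + N') (fun x => u x - v x) := by
  simpa [sub_eq_add_neg] using hu.add hv.neg hL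

theorem congr (hu : FBound q L B N u) (h : ∀ x, v x = u x) : FBound q L B N v := by
  rwa [funext h]

/-- The dilation preserves mass and turns û(ω) into û(ω/l), so neither `B` nor `N` changes. The
factor L in the bound on the derivative is what makes the definition covariant. -/
theorem dilate (hu : FBound q L B N u) {l : ℝ} (hl : 0 < l) :
    FBound q (L / l) B N (fun x => l * u (l * x)) := by
  have e : fourierT (fun x => l * u (l * x)) = fun ω => fourierT u (ω / l) :=
    funext (fourierT_dilate hl u)
  have ew : ∀ ω, wt q (L / l) ω = wt q L (ω / l) := by
    intro ω; unfold wt; rw [abs_div, abs_of_pos hl]; ring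
  refine ⟨(hu.integrable.comp_mul_left' hl.ne').const_mul l, ?_, ?_, fun ω => ?_, fun ω => ?_⟩
  · simp only [abs_mul, abs_of_pos hl]
    rw [integral_const_mul, Measure.integral_comp_mul_left (fun x => |u x|) l,
      abs_of_pos (inv_pos.2 hl), smul_eq_mul, ← mul_assoc, mul_inv_cancel₀ hl.ne', one_mul]
    exact hu.l1
  · rw [e]; exact hu.contDiff.comp (contDiff_id.div_const l)
  · rw [e, ew]; exact hu.bd _
  · have : HasDerivAt (fun ω => fourierT u (ω / l)) (deriv (fourierT u) (ω / l) * (1 / l : ℝ)) ω := by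
      have h2 : HasDerivAt (fun ω => fourierT u (ω / l))
          ((1 / l : ℝ) • deriv (fourierT u) (ω / l)) ω :=
        HasDerivAt.scomp (g₁ := fourierT u) (h := fun ω : ℝ => ω / l) ω (hu.hasDerivAt (ω / l))
          ((hasDerivAt_id ω).div_const l)
      rwa [Complex.real_smul, mul_comm] at h2
    rw [e, this.deriv, ew, norm_mul, Complex.norm_real, Real.norm_of_nonneg (by positivity)]
    have := mul_le_mul_of_nonneg_right (hu.bd_deriv (ω / l)) (by positivity : 0 ≤ 1 / l)
    calc _ = wt q L (ω / l) * ‖deriv (fourierT u) (ω / l)‖ * (1 / l) := by ring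
      _ ≤ _ := this
      _ = _ := by ring

theorem integrable_fourierT (hu : FBound q L B N u) (hq : 1 < q) (hL : 0 < L) :
    Integrable (fourierT u) := by
  refine ((integrable_inv_wt hq hL).const_mul B).mono'
    hu.contDiff.continuous.aestronglyMeasurable (Eventually.of_forall fun ω => ?_)
  rw [← div_eq_mul_inv, le_div_iff₀ (wt_pos q hL.le ω), mul_comm]
  exact hu.bd ω

/-- Fourier inversion bounds |u| by the mass of B/weight. The constant is enlarged to `algK` so that
it agrees with the one for products. -/
theorem abs_le (hu : FBound q L B N u) (hc : Continuous u) (hq : 1 < q) (hL : 0 < L) (x : ℝ) :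
    |u x| ≤ algK q / L * B := by
  have h1 := fourierT_inversion hc hu.integrable (hu.integrable_fourierT hq hL) x
  have hB := hu.nonneg_B hL.le
  have hW := wtMass_nonneg q
  have h2 : ‖∫ ω : ℝ, Complex.exp (Complex.I * ω * x) * fourierT u ω‖ ≤
      ∫ ω, B * (wt q L ω)⁻¹ := by
    refine norm_integral_le_of_norm_le ((integrable_inv_wt hq hL).const_mul B)
      (Eventually.of_forall fun ω => ?_)
    rw [norm_mul, Complex.norm_exp]
    simp only [Complex.mul_re, Complex.I_re, Complex.ofReal_re, zero_mul, Complex.I_im,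
      Complex.ofReal_im, mul_zero, sub_self, Complex.mul_im, Real.exp_zero,
      one_mul]
    rw [← div_eq_mul_inv, le_div_iff₀ (wt_pos q hL.le ω), mul_comm]
    exact hu.bd ω
  rw [integral_const_mul, integral_inv_wt q hL] at h2
  rw [← Real.norm_eq_abs, ← Complex.norm_real, h1, norm_mul, Complex.norm_real,
    Real.norm_of_nonneg (by positivity)]
  have h3 : (2 * Real.pi)⁻¹ ≤ 1 := inv_le_one_of_one_le₀ (by linarith [Real.pi_gt_three])
  calc _ ≤ 1 * (B * (wtMass q / L)) := by gcongr
    _ ≤ 2 ^ (q + 1) * (B * (wtMass q / L)) := by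
        gcongr; exact one_le_pow₀ one_le_two
    _ = _ := by rw [algK]; ring

/-- The inversion formula is inserted for v alone, so that Fubini needs nothing of u beyond
integrability. -/
theorem fourierT_mul (hu : Integrable u) (hc : Continuous v) (hv : Integrable v)
    (hV : Integrable (fourierT v)) (ω : ℝ) :
    fourierT (fun x => u x * v x) ω =
      (2 * Real.pi : ℝ)⁻¹ * ∫ η, fourierT u (ω - η) * fourierT v η := by
  have hi : Integrable (Function.uncurry fun (x η : ℝ) =>
      Complex.exp (-(Complex.I * ((ω - η : ℝ) : ℂ) * (x : ℂ))) * ((u x : ℂ) * fourierT v η))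
      (volume.prod volume) := by
    refine Integrable.bdd_mul (c := 1) (hu.ofReal.mul_prod hV) (Continuous.aestronglyMeasurable
      (by fun_prop)) ?_
    filter_upwards with x
    rw [norm_fourier_kernel]
  have h1 : ∀ η, fourierT u (ω - η) * fourierT v η = ∫ x : ℝ,
      Complex.exp (-(Complex.I * ((ω - η : ℝ) : ℂ) * (x : ℂ))) * ((u x : ℂ) * fourierT v η) := by
    intro η
    rw [fourierT, ← integral_mul_const]
    congr 1; ext x; ring
  simp_rw [h1]
  rw [← integral_integral_swap hi, ← integral_const_mul, fourierT]
  congr 1; ext x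
  rw [Complex.ofReal_mul, fourierT_inversion hc hv hV x, ← integral_const_mul, ← integral_const_mul,
    ← integral_const_mul, ← integral_const_mul]
  congr 1; ext η
  rw [show -(Complex.I * ((ω - η : ℝ) : ℂ) * (x : ℂ)) =
    -(Complex.I * (ω : ℂ) * (x : ℂ)) + Complex.I * η * x by push_cast; ring, Complex.exp_add]
  ring

/-- The transform of the product is a convolution, and its derivative may be put on û alone; so the
derivative bound loses only the factor L already present for u. The L¹ bound is the sup of |u| times
the L¹ norm of v. -/
theorem mul (hu : FBound q L B N u) (hcu : Continuous u) (hv : FBound q L B' N' v)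
    (hcv : Continuous v) (hq : 1 < q) (hL : 0 < L) :
    FBound q L (algK q / L * B * B') (algK q / L * B * N') (fun x => u x * v x) := by
  have hB := hu.nonneg_B hL.le
  have hB' := hv.nonneg_B hL.le
  have e : fourierT (fun x => u x * v x) = fun ω =>
      ((2 * Real.pi : ℝ)⁻¹ : ℂ) * ∫ η, fourierT u (ω - η) * fourierT v η := by
    ext ω
    rw [fourierT_mul hu.integrable hcv hv.integrable (hv.integrable_fourierT hq hL)]
    push_cast; rfl
  have hd : ∀ η ω, deriv (fun ω => fourierT u (ω - η) * fourierT v η) ω =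
      deriv (fourierT u) (ω - η) * fourierT v η := by
    intro η ω
    exact (((hu.hasDerivAt (ω - η)).comp_sub_const ω η).mul_const _).deriv
  obtain ⟨hC, hD⟩ := contDiff_one_integral_of_bound (μ := volume)
    (h := fun η ω => fourierT u (ω - η) * fourierT v η)
    (b := fun η => (B + L * B) * (B' * (wt q L η)⁻¹))
    (((integrable_inv_wt hq hL).const_mul _).const_mul _)
    (fun ω => ((hu.contDiff.continuous.comp (continuous_const.sub continuous_id)).mul
      hv.contDiff.continuous).aestronglyMeasurable)
    (Eventually.of_forall fun η => (hu.contDiff.comp (contDiff_id.sub contDiff_const)).mul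
      contDiff_const)
    (Eventually.of_forall fun η ω => by
      rw [norm_mul]
      gcongr
      · exact (hu.norm_le hL.le _).trans (le_add_of_nonneg_right (by positivity))
      · rw [← div_eq_mul_inv, le_div_iff₀ (wt_pos q hL.le η), mul_comm]
        exact hv.bd η)
    (Eventually.of_forall fun η ω => by
      rw [hd, norm_mul]
      gcongr
      · exact (hu.norm_deriv_le hL.le _).trans (le_add_of_nonneg_left (by positivity))
      · rw [← div_eq_mul_inv, le_div_iff₀ (wt_pos q hL.le η), mul_comm]
        exact hv.bd η)
  have h3 : (2 * Real.pi)⁻¹ ≤ 1 := inv_le_one_of_one_le₀ (by linarith [Real.pi_gt_three])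
  have h3' : ‖((2 * Real.pi : ℝ)⁻¹ : ℂ)‖ ≤ 1 := by
    rw [← Complex.ofReal_inv, Complex.norm_real, Real.norm_of_nonneg (by positivity)]; exact h3
  have hi : Integrable fun x => u x * v x :=
    hv.integrable.bdd_mul hcu.aestronglyMeasurable
      (Eventually.of_forall fun x => hu.abs_le hcu hq hL x)
  refine ⟨hi, ?_, ?_, fun ω => ?_, fun ω => ?_⟩
  · calc _ ≤ ∫ x, algK q / L * B * |v x| := by
          refine integral_mono hi.abs (hv.integrable.abs.const_mul _) fun x => ?_
          simp only [abs_mul]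
          gcongr
          exact hu.abs_le hcu hq hL x
      _ ≤ _ := by
          rw [integral_const_mul]
          have := algK_nonneg q
          gcongr
          exact hv.l1
  · rw [e]; exact contDiff_const.mul hC
  · rw [e]
    simp only [norm_mul]
    calc _ = ‖((2 * Real.pi : ℝ)⁻¹ : ℂ)‖ *
          (wt q L ω * ‖∫ η, fourierT u (ω - η) * fourierT v η‖) := by ring
      _ ≤ 1 * (wt q L ω * ‖∫ η, fourierT u (ω - η) * fourierT v η‖) := by
          have := wt_pos q hL.le ω
          gcongr
      _ ≤ _ := by rw [one_mul]; exact norm_convolution_le hq hL hB hu.bd hv.bd ω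
  · rw [e, deriv_const_mul _ ((hC.differentiable one_ne_zero) ω), hD]
    simp only [norm_mul, hd]
    calc _ = ‖((2 * Real.pi : ℝ)⁻¹ : ℂ)‖ *
          (wt q L ω * ‖∫ η, deriv (fourierT u) (ω - η) * fourierT v η‖) := by ring
      _ ≤ 1 * (wt q L ω * ‖∫ η, deriv (fourierT u) (ω - η) * fourierT v η‖) := by
          have := wt_pos q hL.le ω
          gcongr
      _ ≤ algK q / L * (L * B) * B' := by
          rw [one_mul]
          exact norm_convolution_le hq hL (by positivity) hu.bd_deriv hv.bd ω
      _ = _ := by ring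

/-- Minkowski's inequality for each of the three bounds. The L¹ bound `n` supplies the joint
integrability required by Fubini; this is why `FBound` carries `N`. -/
theorem integral {T : Type*} [MeasurableSpace T] {μ : Measure T} [SFinite μ] {w : T → ℝ → ℝ}
    {b n : T → ℝ} (hm : Measurable (Function.uncurry w)) (hb : Integrable b μ)
    (hn : Integrable n μ) (hL : 0 ≤ L) (hw : ∀ᵐ τ ∂μ, FBound q L (b τ) (n τ) (w τ)) :
    Integrable (Function.uncurry w) (μ.prod volume) ∧
      FBound q L (∫ τ, b τ ∂μ) (∫ τ, n τ ∂μ) (fun x => ∫ τ, w τ x ∂μ) := by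
  have hi : Integrable (Function.uncurry w) (μ.prod volume) := by
    rw [integrable_prod_iff hm.aestronglyMeasurable]
    refine ⟨hw.mono fun τ hτ => hτ.integrable, hn.mono' ?_ (hw.mono fun τ hτ => ?_)⟩
    · exact hm.norm.stronglyMeasurable.integral_prod_right.aestronglyMeasurable
    · rw [Real.norm_of_nonneg (integral_nonneg fun x => norm_nonneg _)]
      exact hτ.l1
  have e : fourierT (fun x => ∫ τ, w τ x ∂μ) = fun ω => ∫ τ, fourierT (w τ) ω ∂μ :=
    funext (fourierT_integral hi)
  obtain ⟨hC, hD⟩ := contDiff_one_integral_of_bound (μ := μ)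
    (h := fun τ ω => fourierT (w τ) ω) (b := fun τ => (1 + L) * b τ) (hb.const_mul _)
    (fun ω => by
      have : Measurable fun z : T × ℝ =>
          Complex.exp (-(Complex.I * (ω : ℂ) * (z.2 : ℂ))) * (w z.1 z.2 : ℂ) := by
        have : Measurable fun z : T × ℝ => w z.1 z.2 := hm
        fun_prop
      exact this.stronglyMeasurable.integral_prod_right.aestronglyMeasurable)
    (hw.mono fun τ hτ => hτ.contDiff)
    (hw.mono fun τ hτ ω => (hτ.norm_le hL ω).trans
      (le_mul_of_one_le_left (hτ.nonneg_B hL) (by linarith)))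
    (hw.mono fun τ hτ ω => (hτ.norm_deriv_le hL ω).trans
      (by have := hτ.nonneg_B hL; gcongr; linarith))
  refine ⟨hi, hi.integral_prod_right, ?_, ?_, fun ω => ?_, fun ω => ?_⟩
  · calc _ ≤ ∫ x, ∫ τ, |w τ x| ∂μ :=
          integral_mono hi.integral_prod_right.abs hi.abs.integral_prod_right
            fun x => abs_integral_le_integral_abs
      _ = ∫ τ, (∫ x, |w τ x|) ∂μ := (integral_integral_swap (f := fun τ x => |w τ x|) hi.abs).symm
      _ ≤ _ := integral_mono_ae hi.abs.integral_prod_left hn (hw.mono fun τ hτ => hτ.l1)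
  · rw [e]; exact hC
  · have hw0 := wt_pos q hL ω
    have : wt q L ω * ‖∫ τ, fourierT (w τ) ω ∂μ‖ =
        ‖∫ τ, (wt q L ω : ℂ) * fourierT (w τ) ω ∂μ‖ := by
      rw [integral_const_mul, norm_mul, Complex.norm_real, Real.norm_of_nonneg hw0.le]
    rw [e, this]
    refine norm_integral_le_of_norm_le hb (hw.mono fun τ hτ => ?_)
    rw [norm_mul, Complex.norm_real, Real.norm_of_nonneg hw0.le]
    exact hτ.bd ω
  · have hw0 := wt_pos q hL ω
    have : wt q L ω * ‖∫ τ, deriv (fourierT (w τ)) ω ∂μ‖ =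
        ‖∫ τ, (wt q L ω : ℂ) * deriv (fourierT (w τ)) ω ∂μ‖ := by
      rw [integral_const_mul, norm_mul, Complex.norm_real, Real.norm_of_nonneg hw0.le]
    rw [e, hD, this, ← integral_const_mul]
    refine norm_integral_le_of_norm_le (hb.const_mul L) (hw.mono fun τ hτ => ?_)
    rw [norm_mul, Complex.norm_real, Real.norm_of_nonneg hw0.le]
    exact hτ.bd_deriv ω

theorem continuous_integral {T : Type*} [MeasurableSpace T] {μ : Measure T} {w : T → ℝ → ℝ}
    {b n : T → ℝ} (hm : Measurable (Function.uncurry w)) (hb : Integrable b μ)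
    (hq : 1 < q) (hL : 0 < L)
    (hw : ∀ᵐ τ ∂μ, FBound q L (b τ) (n τ) (w τ)) (hc : ∀ᵐ τ ∂μ, Continuous (w τ)) :
    Continuous (fun x => ∫ τ, w τ x ∂μ) := by
  refine continuous_of_dominated (bound := fun τ => algK q / L * b τ)
    (fun x => (hm.comp (measurable_id.prodMk measurable_const)).aestronglyMeasurable) (fun x => ?_)
    (hb.const_mul _) hc
  filter_upwards [hw, hc] with τ h1 h2
  exact h1.abs_le h2 hq hL x

theorem tsum {w : ℕ → ℝ → ℝ} {b n : ℕ → ℝ} (hb : Summable b) (hn : Summable n)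
    (hq : 1 < q) (hL : 0 < L) (hw : ∀ k, FBound q L (b k) (n k) (w k))
    (hc : ∀ k, Continuous (w k)) :
    (∀ x, Summable fun k => w k x) ∧ Continuous (fun x => ∑' k, w k x) ∧
      FBound q L (∑' k, b k) (∑' k, n k) (fun x => ∑' k, w k x) := by
  have hs : ∀ x, Summable fun k => w k x := fun x =>
    Summable.of_norm_bounded (hb.mul_left (algK q / L)) fun k => (hw k).abs_le (hc k) hq hL x
  -- A series is an integral against the counting measure, so the preceding results on integrals
  -- apply.
  have key : ∀ f : ℕ → ℝ, Summable f → ∑' k, f k = ∫ k, f k ∂Measure.count := by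
    intro f hf
    rw [integral_countable (integrable_count_iff.2 hf.norm)]
    simp
  have hm : Measurable (Function.uncurry w) :=
    measurable_from_prod_countable_right fun k => (hc k).measurable
  have hb' : Integrable b Measure.count := integrable_count_iff.2 hb.norm
  have hn' : Integrable n Measure.count := integrable_count_iff.2 hn.norm
  simp only [fun x => key _ (hs x), key _ hb, key _ hn]
  exact ⟨hs, continuous_integral hm hb' hq hL (Eventually.of_forall hw) (Eventually.of_forall hc),
    (integral hm hb' hn' hL.le (Eventually.of_forall hw)).2⟩

end FBound

/-! ### The nonlinearity -/

/-- The Lipschitz constant of `F` on `[-r, r]`. -/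
noncomputable def lipC (α : ℕ) (a : ℕ → ℝ) (r : ℝ) : ℝ :=
  ∑' j : ℕ, |a (α + j)| * (α + j : ℕ) * r ^ (α + j - 1)

/-- The room between r and a larger r' inside the disc gives a geometric ratio r/r' that absorbs the
factor n. -/
theorem summable_abs_mul_pow_pred {a : ℕ → ℝ} {r : ℝ≥0} (hr : (r : ℝ≥0∞) < convRadius a) :
    Summable fun n : ℕ => |a n| * n * (r : ℝ) ^ (n - 1) := by
  obtain ⟨r', h1, h2⟩ := ENNReal.lt_iff_exists_nnreal_btwn.1 hr
  have h1' : r < r' := by exact_mod_cast h1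
  obtain ⟨C, hC, hb⟩ := FormalMultilinearSeries.norm_mul_pow_le_of_lt_radius _ h2
  simp only [FormalMultilinearSeries.ofScalars_norm, Real.norm_eq_abs] at hb
  have hr' : (0 : ℝ) < r' := lt_of_le_of_lt r.2 (by exact_mod_cast h1')
  have hx : (r : ℝ) / r' < 1 := (div_lt_one hr').2 (by exact_mod_cast h1')
  have hx0 : 0 ≤ (r : ℝ) / r' := by positivity
  have hx1 : ‖(r : ℝ) / r'‖ < 1 := by rwa [Real.norm_of_nonneg hx0]
  rw [← summable_nat_add_iff 1]
  have hs : Summable fun n : ℕ => C / r' * (((n : ℝ) ^ 1 * ((r : ℝ) / r') ^ n) +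
      ((r : ℝ) / r') ^ n) :=
    ((summable_pow_mul_geometric_of_norm_lt_one 1 hx1).add
      (summable_geometric_of_norm_lt_one hx1)).mul_left _
  refine hs.of_nonneg_of_le (fun n => by positivity) fun n => ?_
  have := hb (n + 1)
  rw [← le_div_iff₀ (by positivity)] at this
  calc _ ≤ C / r' ^ (n + 1) * (n + 1 : ℕ) * (r : ℝ) ^ (n + 1 - 1) := by gcongr
    _ = _ := by
      rw [Nat.add_sub_cancel, div_pow]
      push_cast
      field_simp
      ring

theorem summable_lipC (α : ℕ) {a : ℕ → ℝ} {r : ℝ≥0} (hr : (r : ℝ≥0∞) < convRadius a) :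
    Summable fun j : ℕ => |a (α + j)| * (α + j : ℕ) * (r : ℝ) ^ (α + j - 1) := by
  have := (summable_nat_add_iff α).2 (summable_abs_mul_pow_pred hr)
  simpa only [add_comm] using this

theorem lipC_nonneg (α : ℕ) (a : ℕ → ℝ) (r : ℝ≥0) : 0 ≤ lipC α a r :=
  tsum_nonneg fun _ => by positivity

/-- As α > 1, every exponent α + j - 1 is at least 1, so shrinking the radius by θ gains at least
one factor θ. Smallness of the Lipschitz constant comes from here. -/
theorem lipC_mul_le {α : ℕ} (hα : 1 < α) {a : ℕ → ℝ} {r θ : ℝ≥0} (hθ : θ ≤ 1)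
    (hr : (r : ℝ≥0∞) < convRadius a) : lipC α a (θ * r : ℝ≥0) ≤ θ * lipC α a r := by
  unfold lipC
  rw [← tsum_mul_left]
  have hr' : ((θ * r : ℝ≥0) : ℝ≥0∞) < convRadius a := by
    refine lt_of_le_of_lt ?_ hr
    exact_mod_cast mul_le_of_le_one_left (zero_le (a := r)) hθ
  refine (summable_lipC α hr').tsum_le_tsum (fun j => ?_) ((summable_lipC α hr).mul_left _)
  have h1 : (θ : ℝ) ^ (α + j - 1) ≤ θ := by
    refine pow_le_of_le_one θ.2 (by exact_mod_cast hθ) (by omega)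
  push_cast
  rw [mul_pow]
  calc _ = (θ : ℝ) ^ (α + j - 1) * (|a (α + j)| * (α + j) * (r : ℝ) ^ (α + j - 1)) := by ring
    _ ≤ _ := by gcongr

theorem abs_pow_sub_pow_le {x y r : ℝ} (hx : |x| ≤ r) (hy : |y| ≤ r) (n : ℕ) :
    |x ^ n - y ^ n| ≤ n * r ^ (n - 1) * |x - y| := by
  have h := (convex_Icc (-r) r).norm_image_sub_le_of_norm_deriv_le (f := fun x : ℝ => x ^ n)
    (C := n * r ^ (n - 1)) (fun x _ => by fun_prop) (fun z hz => ?_)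
    (abs_le.1 hy) (abs_le.1 hx)
  · simpa using h
  · have hz' : |z| ≤ r := abs_le.2 hz
    simp only [deriv_pow_field, norm_mul, norm_pow, Real.norm_eq_abs, Nat.abs_cast]
    gcongr

theorem summable_nonlin (α : ℕ) {a : ℕ → ℝ} {r : ℝ≥0} (hr : (r : ℝ≥0∞) < convRadius a) {x : ℝ}
    (hx : |x| ≤ r) : Summable fun j : ℕ => a (α + j) * x ^ (α + j) := by
  have h := FormalMultilinearSeries.summable_norm_mul_pow _ hr
  simp only [FormalMultilinearSeries.ofScalars_norm, Real.norm_eq_abs] at h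
  have h2 := (summable_nat_add_iff α).2 h
  simp only [add_comm _ α] at h2
  refine Summable.of_norm_bounded h2 fun j => ?_
  rw [norm_mul, norm_pow, Real.norm_eq_abs, Real.norm_eq_abs]
  gcongr

theorem nonlin_sub_eq (lam : ℝ) (α : ℕ) {a : ℕ → ℝ} {r : ℝ≥0} (hr : (r : ℝ≥0∞) < convRadius a)
    {x y : ℝ} (hx : |x| ≤ r) (hy : |y| ≤ r) :
    nonlin lam α a x - nonlin lam α a y =
      lam * ∑' j : ℕ, a (α + j) * (x ^ (α + j) - y ^ (α + j)) := by
  unfold nonlin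
  rw [← mul_sub, ← (summable_nonlin α hr hx).tsum_sub (summable_nonlin α hr hy)]
  simp only [mul_sub]

theorem abs_nonlin_sub_le {lam : ℝ} (hlam : |lam| ≤ 1) (α : ℕ) {a : ℕ → ℝ} {r : ℝ≥0}
    (hr : (r : ℝ≥0∞) < convRadius a) {x y : ℝ} (hx : |x| ≤ r) (hy : |y| ≤ r) :
    |nonlin lam α a x - nonlin lam α a y| ≤ lipC α a r * |x - y| := by
  rw [nonlin_sub_eq lam α hr hx hy, abs_mul, lipC, ← tsum_mul_right]
  have hs := (summable_lipC α hr).mul_right |x - y|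
  refine (mul_le_of_le_one_left (abs_nonneg _) hlam).trans ?_
  rw [← Real.norm_eq_abs]
  refine tsum_of_norm_bounded hs.hasSum fun j => ?_
  rw [norm_mul, Real.norm_eq_abs, Real.norm_eq_abs, mul_assoc, mul_assoc, ← mul_assoc (_ : ℝ) _ |x - y|]
  gcongr
  exact abs_pow_sub_pow_le hx hy _

theorem nonlin_zero (lam : ℝ) {α : ℕ} (hα : 1 < α) (a : ℕ → ℝ) : nonlin lam α a 0 = 0 := by
  unfold nonlin
  have : ∀ j, a (α + j) * (0:ℝ) ^ (α + j) = 0 := fun j => by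
    rw [zero_pow (by omega), mul_zero]
  simp [this]

/-- `F` composed with the truncation to `[-r, r]`. -/
noncomputable def nonlinTrunc (lam : ℝ) (α : ℕ) (a : ℕ → ℝ) (r x : ℝ) : ℝ :=
  nonlin lam α a (max (-r) (min r x))

theorem nonlinTrunc_eq (lam : ℝ) (α : ℕ) (a : ℕ → ℝ) {r x : ℝ} (hx : |x| ≤ r) :
    nonlinTrunc lam α a r x = nonlin lam α a x := by
  unfold nonlinTrunc
  rw [min_eq_right (abs_le.1 hx).2, max_eq_right (abs_le.1 hx).1]

/-- Outside the disc of convergence `nonlin` has no controlled values. The truncated function is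
continuous on the whole line, so composing it with any measurable function stays measurable, and it
agrees with F on the range that occurs. -/
theorem continuous_nonlinTrunc {lam : ℝ} (hlam : |lam| ≤ 1) (α : ℕ) {a : ℕ → ℝ} {r : ℝ≥0}
    (hr : (r : ℝ≥0∞) < convRadius a) : Continuous (nonlinTrunc lam α a r) := by
  have h : LipschitzOnWith (lipC α a r).toNNReal (nonlin lam α a) (Set.Icc (-r) r) := by
    refine LipschitzOnWith.of_dist_le_mul fun x hx y hy => ?_
    rw [Real.dist_eq, Real.dist_eq, Real.coe_toNNReal _ (lipC_nonneg α a r)]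
    exact abs_nonlin_sub_le hlam α hr (abs_le.2 hx) (abs_le.2 hy)
  refine h.continuousOn.comp_continuous (by fun_prop) fun x => ⟨le_max_left _ _, ?_⟩
  exact max_le (by linarith [r.2]) (min_le_left _ _)

theorem FBound.pow {q : ℕ} (hq : 1 < q) {L R N : ℝ} (hL : 0 < L) {u : ℝ → ℝ}
    (hu : FBound q L R N u) (hcu : Continuous u) (j : ℕ) :
    FBound q L ((algK q / L * R) ^ j * R) ((algK q / L * R) ^ j * N) (fun x => u x ^ (j + 1)) := by
  induction j with
  | zero => simpa using hu
  | succ j ih =>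
    have := hu.mul hcu ih (by fun_prop) hq hL
    refine ((this.congr (v := fun x => u x ^ (j + 1 + 1)) fun x => by ring).mono hL.le ?_ ?_) <;>
    exact le_of_eq (by ring)

/-- Induction on u^{j+2} - v^{j+2} = u (u^{j+1} - v^{j+1}) + v^{j+1} (u - v). -/
theorem FBound.pow_sub_pow {q : ℕ} (hq : 1 < q) {L R N D N' : ℝ} (hL : 0 < L) {u v : ℝ → ℝ}
    (hu : FBound q L R N u) (hcu : Continuous u) (hv : FBound q L R N v) (hcv : Continuous v)
    (hd : FBound q L D N' (fun x => u x - v x)) (j : ℕ) :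
    FBound q L ((j + 1) * (algK q / L * R) ^ j * D) ((j + 1) * (algK q / L * R) ^ j * N')
      (fun x => u x ^ (j + 1) - v x ^ (j + 1)) := by
  induction j with
  | zero => simpa using hd
  | succ j ih =>
    have h1 := hu.mul hcu ih (by fun_prop) hq hL
    have h2 := (hv.pow hq hL hcv j).mul (by fun_prop) hd (by fun_prop) hq hL
    refine (((h1.add h2 hL.le).congr
      (v := fun x => u x ^ (j + 1 + 1) - v x ^ (j + 1 + 1)) fun x => by ring).mono hL.le ?_ ?_) <;>
    exact le_of_eq (by push_cast; ring)

theorem FBound.nonlin_sub {q : ℕ} (hq : 1 < q) {L R N D N' : ℝ} (hL : 1 ≤ L) {u v : ℝ → ℝ}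
    (hu : FBound q L R N u) (hcu : Continuous u) (hv : FBound q L R N v) (hcv : Continuous v)
    (hd : FBound q L D N' (fun x => u x - v x)) {lam : ℝ} (hlam : |lam| ≤ 1) {α : ℕ}
    (hα : 1 < α) {a : ℕ → ℝ} {r : ℝ≥0} (hr : (r : ℝ≥0∞) < convRadius a) (hR : algK q * R ≤ r) :
    Continuous (fun x => nonlin lam α a (u x) - nonlin lam α a (v x)) ∧
    FBound q L ((L ^ (α - 1))⁻¹ * lipC α a r * D) ((L ^ (α - 1))⁻¹ * lipC α a r * N')
      (fun x => nonlin lam α a (u x) - nonlin lam α a (v x)) := by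
  have hL0 : 0 < L := one_pos.trans_le hL
  have hD := hd.nonneg_B hL0.le
  have hN' := hd.nonneg_N
  have hR0 := hu.nonneg_B hL0.le
  have hK := algK_nonneg q
  have hle : algK q / L * R ≤ r := by
    refine le_trans ?_ hR
    gcongr
    exact div_le_self hK hL
  have hux : ∀ x, |u x| ≤ r := fun x => (hu.abs_le hcu hq hL0 x).trans hle
  have hvx : ∀ x, |v x| ≤ r := fun x => (hv.abs_le hcv hq hL0 x).trans hle
  have e : (fun x => nonlin lam α a (u x) - nonlin lam α a (v x)) =
      fun x => lam * ∑' j : ℕ, a (α + j) * (u x ^ (α + j) - v x ^ (α + j)) :=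
    funext fun x => nonlin_sub_eq lam α hr (hux x) (hvx x)
  have hs := (summable_lipC α hr).mul_left (L ^ (α - 1))⁻¹
  have hterm : ∀ j : ℕ, FBound q L
      ((L ^ (α - 1))⁻¹ * (|a (α + j)| * (α + j : ℕ) * (r : ℝ) ^ (α + j - 1)) * D)
      ((L ^ (α - 1))⁻¹ * (|a (α + j)| * (α + j : ℕ) * (r : ℝ) ^ (α + j - 1)) * N')
      (fun x => a (α + j) * (u x ^ (α + j) - v x ^ (α + j))) := by
    intro j
    have h1 := (hu.pow_sub_pow hq hL0 hcu hv hcv hd (α + j - 1)).const_mul (a (α + j))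
    have e1 : α + j - 1 + 1 = α + j := by omega
    have e2 : ((α + j - 1 : ℕ) : ℝ) + 1 = (α + j : ℕ) := by exact_mod_cast e1
    rw [e1, e2] at h1
    -- Each of the α + j - 1 multiplications gains 1/L. As L ≥ 1, keeping α - 1 of these factors
    -- gives a bound uniform in j.
    have h2 : (algK q / L * R) ^ (α + j - 1) ≤ (L ^ (α - 1))⁻¹ * (r : ℝ) ^ (α + j - 1) := by
      calc (algK q / L * R) ^ (α + j - 1)
          = (L ^ (α + j - 1))⁻¹ * (algK q * R) ^ (α + j - 1) := by
            rw [← inv_pow, ← mul_pow]; congr 1; ring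
        _ ≤ _ := by
            gcongr
            omega
    refine h1.mono hL0.le ?_ ?_
    · calc _ ≤ |a (α + j)| * ((α + j : ℕ) * ((L ^ (α - 1))⁻¹ * (r : ℝ) ^ (α + j - 1)) * D) := by
            gcongr
        _ = _ := by ring
    · calc _ ≤ |a (α + j)| * ((α + j : ℕ) * ((L ^ (α - 1))⁻¹ * (r : ℝ) ^ (α + j - 1)) * N') := by
            gcongr
        _ = _ := by ring
  obtain ⟨-, hc, hF⟩ := FBound.tsum (hs.mul_right D) (hs.mul_right N') hq hL0 hterm
    (fun j => by fun_prop)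
  have h0 := lipC_nonneg α a r
  rw [e]
  refine ⟨continuous_const.mul hc, (hF.const_mul lam).mono hL0.le ?_ ?_⟩
  · rw [tsum_mul_right, tsum_mul_left, ← lipC]
    exact mul_le_of_le_one_left (by positivity) hlam
  · rw [tsum_mul_right, tsum_mul_left, ← lipC]
    exact mul_le_of_le_one_left (by positivity) hlam

theorem FBound.nonlin {q : ℕ} (hq : 1 < q) {L R N : ℝ} (hL : 1 ≤ L) {u : ℝ → ℝ}
    (hu : FBound q L R N u) (hcu : Continuous u) {lam : ℝ} (hlam : |lam| ≤ 1) {α : ℕ}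
    (hα : 1 < α) {a : ℕ → ℝ} {r : ℝ≥0} (hr : (r : ℝ≥0∞) < convRadius a) (hR : algK q * R ≤ r) :
    Continuous (fun x => nonlin lam α a (u x)) ∧
    FBound q L ((L ^ (α - 1))⁻¹ * lipC α a r * R) ((L ^ (α - 1))⁻¹ * lipC α a r * N)
      (fun x => nonlin lam α a (u x)) := by
  have hL0 : 0 ≤ L := zero_le_one.trans hL
  have h := hu.nonlin_sub hq hL hcu
    ((FBound.zero q L).mono hL0 (hu.nonneg_B hL0) hu.nonneg_N) continuous_const
    (by simpa using hu) hlam hα hr hR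
  simpa [nonlin_zero lam hα] using h

/-! ### The kernel -/

/-- The q + 1 derivatives of g give decay of order q + 1 for ĝ, and one moment gives the same for
ĝ'. Since M ≥ 1, decay of order M + 2 leaves an integrable (1+|x|)^{-2} after multiplication by |x|.
-/
theorem KernelG.fBound {q M : ℕ} {d : ℝ} {G : ℝ → ℝ → ℝ} (hG : KernelG q M d G) :
    ∃ C, FBound (q + 1) 1 C C (fun x => G x 1) := by
  set g : ℝ → ℝ := fun x => G x 1 with hg
  have hgs : ContDiff ℝ ((q + 1 : ℕ) : WithTop ℕ∞) g := hG.smooth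
  set f : ℝ → ℂ := fun x => (g x : ℂ) with hf
  have hfs : ContDiff ℝ (((q + 1 : ℕ) : ℕ∞) : WithTop ℕ∞) f := by
    have : ContDiff ℝ ((q + 1 : ℕ) : WithTop ℕ∞) f := Complex.ofRealCLM.contDiff.comp hgs
    exact_mod_cast this
  have hnorm : ∀ n ≤ q + 1, ∀ x, ‖iteratedFDeriv ℝ n f x‖ = |iteratedDeriv n g x| := by
    intro n hn x
    have h1 := Complex.ofRealLI.norm_iteratedFDeriv_comp_left (f := g) (x := x) (i := n)
      (n := ((q + 1 : ℕ) : WithTop ℕ∞)) hgs.contDiffAt (by exact_mod_cast hn)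
    rw [← Real.norm_eq_abs, ← norm_iteratedFDeriv_eq_norm_iteratedDeriv, ← h1]
    rfl
  have hint : ∀ k n : ℕ, (k : ℕ∞) ≤ (1 : ℕ∞) → (n : ℕ∞) ≤ ((q + 1 : ℕ) : ℕ∞) →
      Integrable (fun v : ℝ => ‖v‖ ^ k * ‖iteratedFDeriv ℝ n f v‖) := by
    intro k n hk hn
    have hk' : k ≤ 1 := by exact_mod_cast hk
    have hn' : n ≤ q + 1 := by exact_mod_cast hn
    obtain ⟨C, hC⟩ := hG.decay n hn'
    have hI := (integrable_one_add_norm (E := ℝ) (μ := volume) (r := 2) (by simp)).const_mul C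
    refine hI.mono' (Continuous.aestronglyMeasurable ?_) (Eventually.of_forall fun x => ?_)
    · exact (continuous_norm.pow k).mul
        (hfs.continuous_iteratedFDeriv (by exact_mod_cast hn)).norm
    · have h3 : 0 < (1 + |x|) := by positivity
      have h1 : 1 ≤ 1 + |x| := by linarith [abs_nonneg x]
      rw [hnorm n hn' x, Real.norm_of_nonneg (by positivity), Real.norm_eq_abs,
        Real.rpow_neg h3.le, ← div_eq_mul_inv, le_div_iff₀ (by positivity)]
      refine le_trans ?_ (hC x)
      have h2 : (|x|) ^ k * (1 + |x|) ^ (2:ℝ) ≤ (1 + |x|) ^ (M + 2) := by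
        rw [Real.rpow_two]
        calc _ ≤ (1 + |x|) ^ k * (1 + |x|) ^ 2 := by gcongr; linarith
          _ = (1 + |x|) ^ (k + 2) := by rw [pow_add]
          _ ≤ _ := pow_le_pow_right₀ h1 (by have := hG.M_pos; omega)
      calc _ = (|x|) ^ k * (1 + |x|) ^ (2:ℝ) * |iteratedDeriv n g x| := by ring
        _ ≤ _ := by gcongr
  have hgi : Integrable g := by
    have h1 := hint 0 0 (by simp) (by simp)
    simp only [pow_zero, one_mul, norm_iteratedFDeriv_zero] at h1
    refine (integrable_norm_iff hgs.continuous.aestronglyMeasurable).1 (h1.congr ?_)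
    exact Eventually.of_forall fun x => by simp [hf]
  have e : fourierT g = fun ω => FourierTransform.fourier f (ω / (2 * Real.pi)) :=
    funext fun ω => fourierT_eq g ω
  have hFC : ContDiff ℝ 1 (FourierTransform.fourier f) := by
    have := Real.contDiff_fourier (f := f) (N := 1) (fun n hn => by
      have h1 := hint n 0 hn (by simp)
      simpa only [norm_iteratedFDeriv_zero] using h1)
    exact_mod_cast this
  have hpi : (0:ℝ) < 2 * Real.pi := by positivity
  have hder : ∀ ω, HasDerivAt (fourierT g) ((1 / (2 * Real.pi) : ℝ) •
      deriv (FourierTransform.fourier f) (ω / (2 * Real.pi))) ω := by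
    intro ω
    rw [e]
    exact HasDerivAt.scomp (g₁ := FourierTransform.fourier f) (h := fun ω : ℝ => ω / (2 * Real.pi))
      ω (hFC.differentiable one_ne_zero _).hasDerivAt ((hasDerivAt_id ω).div_const _)
  have hb : ∀ k ≤ 1, ∃ C, ∀ ω, wt (q + 1) 1 ω *
      ‖iteratedFDeriv ℝ k (FourierTransform.fourier f) (ω / (2 * Real.pi))‖ ≤ C := by
    intro k hk
    obtain ⟨A₀, h0⟩ : ∃ A₀, ∀ w : ℝ,
        ‖w‖ ^ 0 * ‖iteratedFDeriv ℝ k (FourierTransform.fourier f) w‖ ≤ A₀ :=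
      ⟨_, Real.pow_mul_norm_iteratedFDeriv_fourier_le hfs hint (by exact_mod_cast hk) (by simp)⟩
    obtain ⟨A₁, h1⟩ : ∃ A₁, ∀ w : ℝ,
        ‖w‖ ^ (q + 1) * ‖iteratedFDeriv ℝ k (FourierTransform.fourier f) w‖ ≤ A₁ :=
      ⟨_, Real.pow_mul_norm_iteratedFDeriv_fourier_le hfs hint (by exact_mod_cast hk) le_rfl⟩
    refine ⟨A₀ + (2 * Real.pi) ^ (q + 1) * A₁, fun ω => ?_⟩
    have h2 := mul_le_mul_of_nonneg_left (h1 (ω / (2 * Real.pi)))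
      (by positivity : 0 ≤ (2 * Real.pi) ^ (q + 1))
    have h3 := add_le_add (h0 (ω / (2 * Real.pi))) h2
    refine le_trans (le_of_eq ?_) h3
    rw [pow_zero, one_mul, ← mul_assoc, ← mul_pow, Real.norm_eq_abs, abs_div, abs_of_pos hpi,
      mul_div_cancel₀ _ hpi.ne', wt]
    ring
  obtain ⟨C0, hC0⟩ := hb 0 zero_le_one
  obtain ⟨C1, hC1⟩ := hb 1 le_rfl
  refine ⟨max (∫ x, |g x|) (max C0 C1), hgi, le_max_left _ _, ?_, fun ω => ?_, fun ω => ?_⟩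
  · rw [e]; exact hFC.comp (contDiff_id.div_const _)
  · refine le_trans ?_ ((le_max_left _ _).trans (le_max_right _ _))
    have := hC0 ω
    rw [norm_iteratedFDeriv_zero] at this
    rw [e]; exact this
  · rw [one_mul]
    refine le_trans ?_ ((le_max_right _ _).trans (le_max_right _ _))
    have := hC1 ω
    rw [norm_iteratedFDeriv_eq_norm_iteratedDeriv, iteratedDeriv_one] at this
    refine le_trans ?_ this
    rw [(hder ω).deriv, norm_smul, Real.norm_of_nonneg (by positivity)]
    have hw := wt_pos (q + 1) zero_le_one ω
    gcongr
    refine mul_le_of_le_one_left (norm_nonneg _) ?_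
    rw [div_le_one hpi]; linarith [Real.pi_gt_three]

/-- The kernel `G(x, σ) = σ^{-1/d} g(σ^{-1/d} x)`. -/
noncomputable def gk (d : ℝ) (g : ℝ → ℝ) (σ x : ℝ) : ℝ :=
  σ ^ (-(1 / d)) * g (σ ^ (-(1 / d)) * x)

/-- The convolution of the kernel at time `σ` with `v`. -/
noncomputable def heat (d : ℝ) (g : ℝ → ℝ) (σ : ℝ) (v : ℝ → ℝ) (x : ℝ) : ℝ :=
  ∫ y, gk d g σ (x - y) * v y

theorem FBound.gk {q : ℕ} {B N d σ : ℝ} {g : ℝ → ℝ} (hg : FBound q 1 B N g) (hσ : 0 < σ) :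
    FBound q (σ ^ (1 / d)) B N (gk d g σ) := by
  have h := hg.dilate (l := σ ^ (-(1 / d))) (by positivity)
  rwa [one_div (σ ^ (-(1 / d))), ← Real.rpow_neg hσ.le, neg_neg] at h

theorem fourierT_gk (d : ℝ) (g : ℝ → ℝ) {σ : ℝ} (hσ : 0 < σ) (ω : ℝ) :
    fourierT (gk d g σ) ω = fourierT g (σ ^ (1 / d) * ω) := by
  have h := fourierT_dilate (l := σ ^ (-(1 / d))) (by positivity) g ω
  rwa [div_eq_mul_inv ω, ← Real.rpow_neg hσ.le, neg_neg, mul_comm ω] at h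

theorem continuous_gk (d : ℝ) {g : ℝ → ℝ} (hg : Continuous g) (σ : ℝ) : Continuous (gk d g σ) := by
  unfold gk; fun_prop

theorem integrable_heat_integrand {k v : ℝ → ℝ} (hk : Integrable k) (hv : Integrable v) :
    Integrable (Function.uncurry fun y x => k (x - y) * v y) (volume.prod volume) := by
  have := (hv.convolution_integrand (ContinuousLinearMap.mul ℝ ℝ) hk).swap
  refine this.congr (Eventually.of_forall fun z => ?_)
  simp [Function.uncurry, mul_comm]

theorem integral_abs_convolution_le {k v : ℝ → ℝ} (hk : Integrable k) (hv : Integrable v) :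
    ∫ x, |∫ y, k (x - y) * v y| ≤ (∫ x, |k x|) * ∫ y, |v y| := by
  have hi := integrable_heat_integrand hk hv
  calc _ ≤ ∫ x, ∫ y, |k (x - y) * v y| :=
        integral_mono hi.integral_prod_right.abs hi.abs.integral_prod_right
          fun x => abs_integral_le_integral_abs
    _ = ∫ y, ∫ x, |k (x - y) * v y| :=
        (integral_integral_swap (f := fun y x => |k (x - y) * v y|) hi.abs).symm
    _ = _ := by
        rw [← integral_const_mul]
        congr 1; ext y
        simp only [abs_mul]
        rw [integral_mul_const, integral_sub_right_eq_self (fun x => |k x|)]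

theorem fourierT_convolution {k v : ℝ → ℝ} (hk : Integrable k) (hv : Integrable v) (ω : ℝ) :
    fourierT (fun x => ∫ y, k (x - y) * v y) ω = fourierT k ω * fourierT v ω := by
  rw [fourierT_integral (w := fun y x => k (x - y) * v y) (integrable_heat_integrand hk hv),
    mul_comm, fourierT.eq_1 v, ← integral_mul_const]
  congr 1; ext y
  rw [fourierT, fourierT, ← integral_const_mul]
  rw [← integral_add_right_eq_self _ y]
  congr 1; ext x
  rw [add_sub_cancel_right]
  push_cast
  rw [show -(Complex.I * ω * (x + y)) = -(Complex.I * ω * y) + -(Complex.I * (ω : ℂ) * x) by ring,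
    Complex.exp_add]
  ring

theorem wt_le_mul_wt (q : ℕ) {m L₀ L₁ K : ℝ} (hm : 0 ≤ m) (hL₀ : 0 ≤ L₀) (hL₁ : 0 ≤ L₁)
    (hK : 1 ≤ K) (h : L₁ ≤ K * max m L₀) (ω : ℝ) :
    wt q L₁ ω ≤ K ^ q * (wt q m ω * wt q L₀ ω) := by
  have h1 : (L₁ * |ω|) ^ q ≤ K ^ q * ((m * |ω|) ^ q + (L₀ * |ω|) ^ q) := by
    have h2 : (max m L₀ * |ω|) ^ q ≤ (m * |ω|) ^ q + (L₀ * |ω|) ^ q := by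
      rcases max_cases m L₀ with ⟨e, -⟩ | ⟨e, -⟩ <;> rw [e]
      · have : 0 ≤ (L₀ * |ω|) ^ q := by positivity
        linarith
      · have : 0 ≤ (m * |ω|) ^ q := by positivity
        linarith
    calc _ ≤ (K * max m L₀ * |ω|) ^ q := by gcongr
      _ = K ^ q * (max m L₀ * |ω|) ^ q := by rw [← mul_pow]; ring
      _ ≤ _ := by gcongr
  have h3 : 1 ≤ K ^ q := one_le_pow₀ hK
  have h4 : 0 ≤ (m * |ω|) ^ q * (L₀ * |ω|) ^ q := by positivity
  unfold wt
  nlinarith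

/-- The transform is a product, and the product of the weights at scales σ^{1/d} and L₀ dominates
the weight at the larger of them, hence the one at L₁ up to K^q. The factor 2 counts the two terms
of the product rule, where both scales are at most L₁. -/
theorem FBound.heat {q : ℕ} {d σ Cg B N L₀ L₁ K : ℝ} {g v : ℝ → ℝ} (hg : FBound q 1 Cg Cg g)
    (hσ : 0 < σ) (hv : FBound q L₀ B N v) (hL₀ : 0 < L₀) (h1 : σ ^ (1 / d) ≤ L₁) (h2 : L₀ ≤ L₁)
    (hK : 1 ≤ K) (h3 : L₁ ≤ K * max (σ ^ (1 / d)) L₀) :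
    FBound q L₁ (2 * K ^ q * Cg * B) (Cg * N) (heat d g σ v) := by
  have hk := hg.gk (d := d) hσ
  set m := σ ^ (1 / d) with hm
  have hm0 : 0 < m := by positivity
  have hL₁ : 0 < L₁ := hL₀.trans_le h2
  have hCg := hg.nonneg_N
  have hB := hv.nonneg_B hL₀.le
  have hi := integrable_heat_integrand hk.integrable hv.integrable
  have e : fourierT (RGIntegral.heat d g σ v) = fun ω =>
      fourierT (RGIntegral.gk d g σ) ω * fourierT v ω :=
    funext fun ω => fourierT_convolution hk.integrable hv.integrable ω
  have hwt := wt_le_mul_wt q hm0.le hL₀.le hL₁.le hK h3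
  have prodb : ∀ (ω : ℝ) (z w : ℂ) (a b : ℝ), wt q m ω * ‖z‖ ≤ a → wt q L₀ ω * ‖w‖ ≤ b →
      wt q L₁ ω * ‖z * w‖ ≤ K ^ q * (a * b) := by
    intro ω z w a b ha hb
    have w1 := wt_pos q hm0.le ω
    have w2 := wt_pos q hL₀.le ω
    have ha0 : 0 ≤ a := le_trans (by positivity) ha
    calc wt q L₁ ω * ‖z * w‖ ≤ K ^ q * (wt q m ω * wt q L₀ ω) * (‖z‖ * ‖w‖) := by
          rw [norm_mul]; gcongr; exact hwt ω
      _ = K ^ q * ((wt q m ω * ‖z‖) * (wt q L₀ ω * ‖w‖)) := by ring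
      _ ≤ _ := by gcongr
  refine ⟨hi.integral_prod_right, ?_, ?_, fun ω => ?_, fun ω => ?_⟩
  · refine (integral_abs_convolution_le hk.integrable hv.integrable).trans ?_
    gcongr
    · exact hk.l1
    · exact hv.l1
  · rw [e]; exact hk.contDiff.mul hv.contDiff
  · rw [e]
    refine (prodb ω _ _ _ _ (hk.bd ω) (hv.bd ω)).trans ?_
    have : 0 ≤ K ^ q * (Cg * B) := by positivity
    linarith
  · rw [e, ((hk.hasDerivAt ω).fun_mul (hv.hasDerivAt ω)).deriv]
    have a1 := prodb ω _ _ _ _ (hk.bd_deriv ω) (hv.bd ω)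
    have a2 := prodb ω _ _ _ _ (hk.bd ω) (hv.bd_deriv ω)
    have a3 := mul_le_mul_of_nonneg_left (norm_add_le
      (deriv (fourierT (RGIntegral.gk d g σ)) ω * fourierT v ω)
      (fourierT (RGIntegral.gk d g σ) ω * deriv (fourierT v) ω)) (wt_pos q hL₁.le ω).le
    have a4 : K ^ q * (m * Cg * B) ≤ K ^ q * (L₁ * Cg * B) := by gcongr
    have a5 : K ^ q * (Cg * (L₀ * B)) ≤ K ^ q * (Cg * (L₁ * B)) := by gcongr
    linarith

theorem continuous_heat {q : ℕ} (hq : 1 < q) {d σ Cg : ℝ} {g v : ℝ → ℝ} (hg : FBound q 1 Cg Cg g)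
    (hgc : Continuous g) (hσ : 0 < σ) (hv : Integrable v) : Continuous (heat d g σ v) := by
  have hc := continuous_gk d hgc σ
  refine continuous_of_dominated
    (bound := fun y => algK q / σ ^ (1 / d) * Cg * |v y|) (fun x => ?_) (fun x => ?_)
    (hv.abs.const_mul _) ?_
  · exact (Continuous.aestronglyMeasurable (by fun_prop)).mul hv.aestronglyMeasurable
  · refine Eventually.of_forall fun y => ?_
    rw [norm_mul, Real.norm_eq_abs, Real.norm_eq_abs]
    gcongr
    exact (hg.gk hσ).abs_le hc hq (by positivity) _
  · exact Eventually.of_forall fun y => by fun_prop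

/-! ### Self-similar asymptotics of the convolution -/

/-- Decay of order q + 1 pays for the weight of order q and for one more factor 1 + |ω|, uniformly
in dilations bounded below. That spare factor gives smallness at high frequency and absorbs the
growth of v̂(ω/l) - v̂(0). -/
theorem wt_mul_one_add_mul_norm_le {q : ℕ} {k : ℝ → ℂ} {C c μ : ℝ}
    (hk : ∀ ω, wt (q + 1) 1 ω * ‖k ω‖ ≤ C) (hc : 0 < c) (hμ : c ≤ μ) (ω : ℝ) :
    wt q 1 ω * (1 + |ω|) * ‖k (μ * ω)‖ ≤ 4 * (1 + (c ^ (q + 1))⁻¹) * C := by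
  have hμ0 : 0 < μ := hc.trans_le hμ
  have h0 := hk (μ * ω)
  rw [← wt_eq_one_mul (q + 1) hμ0.le] at h0
  have hp : ∀ n ≤ q + 1, |ω| ^ n ≤ 1 + |ω| ^ (q + 1) := by
    intro n hn
    rcases le_total |ω| 1 with h | h
    · have : 0 ≤ |ω| ^ (q + 1) := by positivity
      linarith [pow_le_one₀ (n := n) (abs_nonneg ω) h]
    · linarith [pow_le_pow_right₀ h hn]
  have h1 : wt q 1 ω * (1 + |ω|) ≤ 4 * (1 + |ω| ^ (q + 1)) := by
    have a1 := hp q (by omega)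
    have a2 := hp 1 (by omega)
    have a3 : |ω| ^ q * |ω| = |ω| ^ (q + 1) := (pow_succ _ _).symm
    have a4 : 0 ≤ |ω| ^ (q + 1) := by positivity
    unfold wt
    rw [one_mul]
    nlinarith
  have h2 : 1 + |ω| ^ (q + 1) ≤ (1 + (c ^ (q + 1))⁻¹) * wt (q + 1) μ ω := by
    have a1 : c ^ (q + 1) * |ω| ^ (q + 1) ≤ (μ * |ω|) ^ (q + 1) := by
      rw [← mul_pow]; gcongr
    have a2 : |ω| ^ (q + 1) ≤ (c ^ (q + 1))⁻¹ * (μ * |ω|) ^ (q + 1) := by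
      rw [inv_mul_eq_div, le_div_iff₀ (by positivity)]; linarith
    have a3 : 0 ≤ (c ^ (q + 1))⁻¹ := by positivity
    have a4 : 0 ≤ (μ * |ω|) ^ (q + 1) := by positivity
    unfold wt
    nlinarith
  calc _ ≤ 4 * ((1 + (c ^ (q + 1))⁻¹) * wt (q + 1) μ ω) * ‖k (μ * ω)‖ := by
        gcongr ?_ * _; exact h1.trans (by gcongr)
    _ = 4 * (1 + (c ^ (q + 1))⁻¹) * (wt (q + 1) μ ω * ‖k (μ * ω)‖) := by ring
    _ ≤ _ := by gcongr

/-- For |ω| ≥ Ω both terms are small by the spare power of decay; for |ω| ≤ Ω uniform continuity of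
k on a compact interval suffices. -/
theorem exists_dilation_close {q : ℕ} {k : ℝ → ℂ} (hkc : Continuous k) {C κ η : ℝ}
    (hk : ∀ ω, wt (q + 1) 1 ω * ‖k ω‖ ≤ C) (hκ : 0 < κ) (hη : 0 < η) :
    ∃ δ > 0, ∀ μ, |μ - κ| < δ → ∀ ω, wt q 1 ω * ‖k (μ * ω) - k (κ * ω)‖ ≤ η := by
  set C' := 4 * (1 + ((κ / 2) ^ (q + 1))⁻¹) * C with hC'
  have hC0 : 0 ≤ C := (mul_nonneg (wt_pos (q + 1) zero_le_one 0).le (norm_nonneg _)).trans (hk 0)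
  have hC'0 : 0 ≤ C' := by positivity
  set Ω := 2 * C' / η with hΩ
  have hΩ0 : 0 ≤ Ω := by positivity
  have hu := (isCompact_Icc (a := -(2 * κ * Ω)) (b := 2 * κ * Ω)).uniformContinuousOn_of_continuous
    hkc.continuousOn
  have hw := wt_pos q zero_le_one Ω
  obtain ⟨δ', hδ', hcl⟩ := Metric.uniformContinuousOn_iff.1 hu (η / wt q 1 Ω) (by positivity)
  refine ⟨min (κ / 2) (δ' / (Ω + 1)), by positivity, fun μ hμ ω => ?_⟩
  have hμ1 := abs_lt.1 (hμ.trans_le (min_le_left _ _))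
  have hμ2 := hμ.trans_le (min_le_right _ _)
  rw [lt_div_iff₀ (by positivity)] at hμ2
  have hwω := wt_pos q zero_le_one ω
  rcases le_total |ω| Ω with h | h
  · have mem : ∀ ν, 0 ≤ ν → ν ≤ 2 * κ → ν * ω ∈ Set.Icc (-(2 * κ * Ω)) (2 * κ * Ω) := by
      intro ν h1 h2
      rw [Set.mem_Icc, ← abs_le, abs_mul, abs_of_nonneg h1]
      gcongr
    have h1 := hcl _ (mem μ (by linarith) (by linarith)) _ (mem κ hκ.le (by linarith)) (by
      rw [Real.dist_eq, ← sub_mul, abs_mul]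
      refine lt_of_le_of_lt ?_ hμ2
      gcongr; linarith)
    rw [dist_eq_norm, lt_div_iff₀ hw] at h1
    have h2 : wt q 1 ω ≤ wt q 1 Ω := by
      unfold wt; rw [abs_of_nonneg hΩ0]; gcongr
    calc _ ≤ wt q 1 Ω * ‖k (μ * ω) - k (κ * ω)‖ := by gcongr
      _ ≤ η := by linarith
  · have a1 := wt_mul_one_add_mul_norm_le hk (half_pos hκ) (μ := μ) (by linarith) ω
    have a2 := wt_mul_one_add_mul_norm_le hk (half_pos hκ) (μ := κ) (by linarith) ω
    rw [← hC'] at a1 a2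
    have a3 := mul_le_mul_of_nonneg_left (norm_sub_le (k (μ * ω)) (k (κ * ω))) hwω.le
    have a4 : 2 * C' ≤ η * (1 + |ω|) := by
      rw [hΩ, div_le_iff₀ hη] at h
      nlinarith
    have a5 : 0 < 1 + |ω| := by positivity
    have a6 : wt q 1 ω * ‖k (μ * ω) - k (κ * ω)‖ * (1 + |ω|) ≤ 2 * C' := by nlinarith
    exact le_of_mul_le_mul_right (a6.trans a4) a5

/-- In Fourier variables the difference is ĝ(μω) v̂(ω/l) - v̂(0) ĝ(κω). It is small because μ is
near κ and because the bound on v̂' gives |v̂(ω/l) - v̂(0)| ≤ B|ω|/l. The threshold δ depends on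
neither v nor its bounds. -/
theorem exists_selfsimilar_close {q : ℕ} {d Cg σ₀ η : ℝ} {g : ℝ → ℝ}
    (hg : FBound (q + 1) 1 Cg Cg g) (hσ₀ : 0 < σ₀) (hη : 0 < η) :
    ∃ δ > 0, ∀ σ l : ℝ, 0 < σ → δ⁻¹ < l → |σ ^ (1 / d) / l - σ₀ ^ (1 / d)| < δ →
      ∀ (B N : ℝ) (v : ℝ → ℝ), FBound q 1 B N v →
        FBound q 1 (η * B) (2 * Cg * N)
          (fun x => l * heat d g σ v (l * x) - (∫ y, v y) * gk d g σ₀ x) := by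
  set κ := σ₀ ^ (1 / d) with hκ
  have hκ0 : 0 < κ := by positivity
  have hCg := hg.nonneg_N
  set C' := 4 * (1 + ((κ / 2) ^ (q + 1))⁻¹) * Cg with hC'
  have hC'0 : 0 ≤ C' := by positivity
  have hgd : ∀ ω, wt (q + 1) 1 ω * ‖deriv (fourierT g) ω‖ ≤ Cg := fun ω => by
    simpa using hg.bd_deriv ω
  obtain ⟨δ₁, hδ₁, h₁⟩ := exists_dilation_close hg.contDiff.continuous hg.bd hκ0
    (show 0 < η / (4 * (κ + 1)) by positivity)
  obtain ⟨δ₂, hδ₂, h₂⟩ := exists_dilation_close (hg.contDiff.continuous_deriv le_rfl) hgd hκ0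
    (show 0 < η / (4 * (κ + 1)) by positivity)
  -- Chosen so that C' δ₃ (κ + 1) ≤ η/4: the derivative below splits into four terms, each allowed
  -- η/4 · B.
  set δ₃ := η / (4 * (C' + 1) * (κ + 1)) with hδ₃
  have hδ₃0 : 0 < δ₃ := by positivity
  refine ⟨min (min δ₁ δ₂) (min (min 1 (κ / 2)) δ₃), by positivity,
    fun σ l hσ hl hμ B N v hv => ?_⟩
  set δ := min (min δ₁ δ₂) (min (min 1 (κ / 2)) δ₃) with hδ
  have hδ0 : 0 < δ := by positivity
  have hl0 : 0 < l := (inv_pos.2 hδ0).trans hl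
  set μ := σ ^ (1 / d) / l with hμdef
  have d1 : δ ≤ δ₁ := (min_le_left _ _).trans (min_le_left _ _)
  have d2 : δ ≤ δ₂ := (min_le_left _ _).trans (min_le_right _ _)
  have d3 : δ ≤ 1 := (min_le_right _ _).trans ((min_le_left _ _).trans (min_le_left _ _))
  have d4 : δ ≤ κ / 2 := (min_le_right _ _).trans ((min_le_left _ _).trans (min_le_right _ _))
  have d5 : δ ≤ δ₃ := (min_le_right _ _).trans (min_le_right _ _)
  have hμ' := abs_lt.1 hμ
  have hli : 1 / l ≤ δ₃ := by
    rw [one_div]; exact ((inv_lt_comm₀ hδ0 hl0).1 hl).le.trans d5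
  have hB := hv.nonneg_B zero_le_one
  have hN := hv.nonneg_N
  have hk := hg.gk (d := d) hσ
  have hk₀ := hg.gk (d := d) hσ₀
  have hi := integrable_heat_integrand hk.integrable hv.integrable
  have hheat : Integrable (heat d g σ v) := hi.integral_prod_right
  have hheat1 : ∫ x, |heat d g σ v x| ≤ Cg * N := by
    refine (integral_abs_convolution_le hk.integrable hv.integrable).trans ?_
    gcongr
    · exact hk.l1
    · exact hv.l1
  have hi1 : Integrable fun x => l * heat d g σ v (l * x) :=
    (hheat.comp_mul_left' hl0.ne').const_mul l
  have hi2 : Integrable fun x => (∫ y, v y) * gk d g σ₀ x := hk₀.integrable.const_mul _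
  have e : fourierT (fun x => l * heat d g σ v (l * x) - (∫ y, v y) * gk d g σ₀ x) = fun ω =>
      fourierT g (μ * ω) * fourierT v (ω / l) - fourierT v 0 * fourierT g (κ * ω) := by
    ext ω
    rw [fourierT_sub hi1 hi2, fourierT_dilate hl0, fourierT_const_mul, fourierT_gk d g hσ₀,
      fourierT_zero_right]
    unfold heat
    rw [fourierT_convolution hk.integrable hv.integrable, fourierT_gk d g hσ]
    congr 3
    rw [hμdef]; ring
  have hVlip : ∀ ω, ‖fourierT v (ω / l) - fourierT v 0‖ ≤ B * (|ω| * δ₃) := by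
    intro ω
    have h := convex_univ.norm_image_sub_le_of_norm_deriv_le (𝕜 := ℝ) (f := fourierT v) (C := B)
      (x := 0) (y := ω / l)
      (fun x _ => hv.contDiff.differentiable one_ne_zero x)
      (fun x _ => by simpa using hv.norm_deriv_le zero_le_one x) trivial trivial
    refine h.trans ?_
    rw [sub_zero, Real.norm_eq_abs, abs_div, abs_of_pos hl0, div_eq_mul_one_div]
    gcongr
  have b1 : ∀ ω, wt q 1 ω * (1 + |ω|) * ‖fourierT g (κ * ω)‖ ≤ C' :=
    wt_mul_one_add_mul_norm_le hg.bd (half_pos hκ0) (by linarith)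
  have b2 : ∀ ω, wt q 1 ω * (1 + |ω|) * ‖deriv (fourierT g) (κ * ω)‖ ≤ C' :=
    wt_mul_one_add_mul_norm_le hgd (half_pos hκ0) (by linarith)
  have b3 : ∀ ω, wt q 1 ω * (1 + |ω|) * ‖fourierT g (μ * ω)‖ ≤ C' :=
    wt_mul_one_add_mul_norm_le hg.bd (half_pos hκ0) (by linarith)
  have hC3 : C' * δ₃ * (κ + 1) ≤ η / 4 := by
    rw [hδ₃]
    have : C' * (η / (4 * (C' + 1) * (κ + 1))) * (κ + 1) = η / 4 * (C' / (C' + 1)) := by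
      field_simp
    rw [this]
    refine mul_le_of_le_one_right (by positivity) ?_
    rw [div_le_one (by positivity)]; linarith
  have hC3' : C' * δ₃ ≤ η / 4 := by
    refine le_trans ?_ hC3
    exact le_mul_of_one_le_right (by positivity) (by linarith)
  have hκη : (κ + 1) * (η / (4 * (κ + 1))) = η / 4 := by field_simp
  refine ⟨hi1.sub hi2, ?_, ?_, fun ω => ?_, fun ω => ?_⟩
  · have c1 : ∫ x, |l * heat d g σ v (l * x)| ≤ Cg * N := by
      simp only [abs_mul, abs_of_pos hl0]
      rw [integral_const_mul, Measure.integral_comp_mul_left (fun x => |heat d g σ v x|) l,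
        abs_of_pos (inv_pos.2 hl0), smul_eq_mul, ← mul_assoc, mul_inv_cancel₀ hl0.ne', one_mul]
      exact hheat1
    have c2 : ∫ x, |(∫ y, v y) * gk d g σ₀ x| ≤ Cg * N := by
      simp only [abs_mul]
      rw [integral_const_mul, mul_comm]
      gcongr
      · exact hk₀.l1
      · exact abs_integral_le_integral_abs.trans hv.l1
    calc _ ≤ ∫ x, (|l * heat d g σ v (l * x)| + |(∫ y, v y) * gk d g σ₀ x|) :=
          integral_mono (hi1.sub hi2).abs (hi1.abs.add hi2.abs) fun x => abs_sub _ _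
      _ ≤ _ := by
          rw [integral_add hi1.abs hi2.abs]; linarith
  · rw [e]
    exact ((hg.contDiff.comp (contDiff_const.mul contDiff_id)).mul
      (hv.contDiff.comp (contDiff_id.div_const l))).sub
      (contDiff_const.mul (hg.contDiff.comp (contDiff_const.mul contDiff_id)))
  · rw [e]
    have hw := wt_pos q zero_le_one ω
    have s : fourierT g (μ * ω) * fourierT v (ω / l) - fourierT v 0 * fourierT g (κ * ω) =
      (fourierT g (μ * ω) - fourierT g (κ * ω)) * fourierT v (ω / l) +
        fourierT g (κ * ω) * (fourierT v (ω / l) - fourierT v 0) := by ring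
    have t1 : wt q 1 ω * ‖(fourierT g (μ * ω) - fourierT g (κ * ω)) * fourierT v (ω / l)‖ ≤
        η / (4 * (κ + 1)) * B := by
      rw [norm_mul, ← mul_assoc]
      gcongr
      · exact h₁ μ (hμ.trans_le d1) ω
      · exact hv.norm_le zero_le_one _
    have t2 : wt q 1 ω * ‖fourierT g (κ * ω) * (fourierT v (ω / l) - fourierT v 0)‖ ≤
        C' * δ₃ * B := by
      rw [norm_mul]
      calc _ ≤ wt q 1 ω * (‖fourierT g (κ * ω)‖ * (B * ((1 + |ω|) * δ₃))) := by
            gcongr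
            refine (hVlip ω).trans ?_
            gcongr; linarith
        _ = wt q 1 ω * (1 + |ω|) * ‖fourierT g (κ * ω)‖ * (δ₃ * B) := by ring
        _ ≤ C' * (δ₃ * B) := by gcongr; exact b1 ω
        _ = _ := by ring
    have t3 := mul_le_mul_of_nonneg_left (norm_add_le
      ((fourierT g (μ * ω) - fourierT g (κ * ω)) * fourierT v (ω / l))
      (fourierT g (κ * ω) * (fourierT v (ω / l) - fourierT v 0))) hw.le
    have t4 : η / (4 * (κ + 1)) ≤ η / 4 := by
      rw [← hκη]; exact le_mul_of_one_le_left (by positivity) (by linarith)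
    simp only [s]
    have t6 := mul_le_mul_of_nonneg_right t4 hB
    have t7 := mul_le_mul_of_nonneg_right hC3' hB
    have t8 := mul_nonneg hη.le hB
    rw [mul_add] at t3
    linarith
  · have hw := wt_pos q zero_le_one ω
    have hd1 : ∀ ν : ℝ, HasDerivAt (fun ω : ℝ => fourierT g (ν * ω))
        (ν * deriv (fourierT g) (ν * ω)) ω := by
      intro ν
      have := HasDerivAt.scomp (g₁ := fourierT g) (h := fun ω : ℝ => ν * ω) ω
        (hg.hasDerivAt (ν * ω)) ((hasDerivAt_id ω).const_mul ν)
      rwa [mul_one, Complex.real_smul] at this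
    have hd2 : HasDerivAt (fun ω : ℝ => fourierT v (ω / l))
        ((1 / l : ℝ) * deriv (fourierT v) (ω / l)) ω := by
      have := HasDerivAt.scomp (g₁ := fourierT v) (h := fun ω : ℝ => ω / l) ω
        (hv.hasDerivAt (ω / l)) ((hasDerivAt_id ω).div_const l)
      rwa [Complex.real_smul] at this
    rw [e, (((hd1 μ).fun_mul hd2).fun_sub ((hd1 κ).const_mul (fourierT v 0))).deriv]
    set k' := deriv (fourierT g) with hk'
    -- The four terms measure, in order, the dilation error in ĝ', the error in the prefactor μ, the
    -- error v̂(ω/l) - v̂(0), and the derivative falling on v̂, which carries 1/l.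
    have s : (μ : ℂ) * k' (μ * ω) * fourierT v (ω / l) +
          fourierT g (μ * ω) * ((1 / l : ℝ) * deriv (fourierT v) (ω / l)) -
          fourierT v 0 * (κ * k' (κ * ω)) =
        μ * ((k' (μ * ω) - k' (κ * ω)) * fourierT v (ω / l)) +
        (μ - κ : ℝ) * (k' (κ * ω) * fourierT v (ω / l)) +
        κ * (k' (κ * ω) * (fourierT v (ω / l) - fourierT v 0)) +
        (1 / l : ℝ) * (fourierT g (μ * ω) * deriv (fourierT v) (ω / l)) := by
      push_cast; ring
    have t1 : wt q 1 ω * ‖(μ : ℂ) * ((k' (μ * ω) - k' (κ * ω)) * fourierT v (ω / l))‖ ≤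
        (κ + 1) * (η / (4 * (κ + 1)) * B) := by
      rw [norm_mul, norm_mul, Complex.norm_real, Real.norm_of_nonneg (by linarith)]
      calc _ = μ * ((wt q 1 ω * ‖k' (μ * ω) - k' (κ * ω)‖) * ‖fourierT v (ω / l)‖) := by ring
        _ ≤ _ := by
          gcongr
          · linarith
          · exact h₂ μ (hμ.trans_le d2) ω
          · exact hv.norm_le zero_le_one _
    have t2 : wt q 1 ω * ‖((μ - κ : ℝ) : ℂ) * (k' (κ * ω) * fourierT v (ω / l))‖ ≤
        δ₃ * (C' * B) := by
      rw [norm_mul, norm_mul, Complex.norm_real, Real.norm_eq_abs]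
      calc _ = |μ - κ| * ((wt q 1 ω * 1 * ‖k' (κ * ω)‖) * ‖fourierT v (ω / l)‖) := by ring
        _ ≤ |μ - κ| * ((wt q 1 ω * (1 + |ω|) * ‖k' (κ * ω)‖) * ‖fourierT v (ω / l)‖) := by
          gcongr; linarith [abs_nonneg ω]
        _ ≤ _ := by
          gcongr
          · exact (hμ.trans_le d5).le
          · exact b2 ω
          · exact hv.norm_le zero_le_one _
    have t3 : wt q 1 ω * ‖(κ : ℂ) * (k' (κ * ω) * (fourierT v (ω / l) - fourierT v 0))‖ ≤
        κ * (C' * δ₃ * B) := by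
      rw [norm_mul, norm_mul, Complex.norm_real, Real.norm_of_nonneg hκ0.le]
      calc _ ≤ wt q 1 ω * (κ * (‖k' (κ * ω)‖ * (B * ((1 + |ω|) * δ₃)))) := by
            gcongr
            refine (hVlip ω).trans ?_
            gcongr; linarith
        _ = κ * (wt q 1 ω * (1 + |ω|) * ‖k' (κ * ω)‖ * (δ₃ * B)) := by ring
        _ ≤ κ * (C' * (δ₃ * B)) := by gcongr; exact b2 ω
        _ = _ := by ring
    have t4 : wt q 1 ω * ‖((1 / l : ℝ) : ℂ) * (fourierT g (μ * ω) * deriv (fourierT v) (ω / l))‖ ≤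
        δ₃ * (C' * B) := by
      rw [norm_mul, norm_mul, Complex.norm_real, Real.norm_of_nonneg (by positivity)]
      calc _ = (1 / l) * ((wt q 1 ω * 1 * ‖fourierT g (μ * ω)‖) *
              ‖deriv (fourierT v) (ω / l)‖) := by ring
        _ ≤ (1 / l) * ((wt q 1 ω * (1 + |ω|) * ‖fourierT g (μ * ω)‖) *
              ‖deriv (fourierT v) (ω / l)‖) := by
          gcongr; linarith [abs_nonneg ω]
        _ ≤ _ := by
          gcongr
          · exact b3 ω
          · simpa using hv.norm_deriv_le zero_le_one (ω / l)
    rw [s, one_mul]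
    refine (mul_le_mul_of_nonneg_left norm_add₄_le hw.le).trans ?_
    have t5 : (κ + 1) * (η / (4 * (κ + 1)) * B) = η / 4 * B := by rw [← mul_assoc, hκη]
    have t6 := mul_le_mul_of_nonneg_right hC3 hB
    have t7 := mul_le_mul_of_nonneg_right hC3' hB
    have t8 := mul_nonneg hη.le hB
    rw [mul_add, mul_add, mul_add]
    linarith

/-! ### The time change -/

section Time

variable {p : ℝ} {c : ℝ → ℝ}

theorem CoeffC.intervalIntegrable (hc : CoeffC p c) {x y : ℝ} (hx : 1 ≤ x) (hy : 1 ≤ y) :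
    IntervalIntegrable c volume x y := by
  refine IntegrableOn.intervalIntegrable
    (hc.locInt.integrableOn_compact_subset ?_ isCompact_uIcc)
  intro z hz
  rcases Set.mem_uIcc.1 hz with h | h
  · exact hx.trans h.1
  · exact hy.trans h.1

theorem CoeffC.timeS_sub (hc : CoeffC p c) {x y : ℝ} (hx : 1 ≤ x) (hy : 1 ≤ y) :
    timeS c y - timeS c x = ∫ τ in x..y, c τ :=
  intervalIntegral.integral_interval_sub_left (hc.intervalIntegrable le_rfl hy)
    (hc.intervalIntegrable le_rfl hx)

theorem CoeffC.timeS_lt (hc : CoeffC p c) {x y : ℝ} (hx : 1 ≤ x) (hxy : x < y) :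
    timeS c x < timeS c y := by
  rw [← sub_pos, hc.timeS_sub hx (hx.trans hxy.le)]
  exact intervalIntegral.intervalIntegral_pos_of_pos_on
    (hc.intervalIntegrable hx (hx.trans hxy.le)) (fun z hz => hc.pos z (hx.trans_lt hz.1)) hxy

theorem CoeffC.continuous_timeS (hc : CoeffC p c) : Continuous fun t => timeS c (max t 1) := by
  have h : ContinuousOn (timeS c) (Set.Ici 1) := by
    intro t ht
    have h1 : ContinuousOn (timeS c) (Set.uIcc 1 (t + 1)) :=
      intervalIntegral.continuousOn_primitive_interval
        ((hc.locInt.integrableOn_compact_subset (fun z hz => by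
          rw [Set.uIcc_of_le (by linarith [Set.mem_Ici.1 ht])] at hz; exact hz.1) isCompact_uIcc))
    rw [Set.uIcc_of_le (by linarith [Set.mem_Ici.1 ht])] at h1
    refine (h1 t ⟨ht, by linarith⟩).mono_of_mem_nhdsWithin ?_
    rw [← Set.Ici_inter_Iic]
    exact inter_mem self_mem_nhdsWithin (mem_nhdsWithin_of_mem_nhds (Iic_mem_nhds (by linarith)))
  exact h.comp_continuous (by fun_prop) fun t => Set.mem_Ici.2 (le_max_right _ _)

/-- The o(t^p) error integrates to o(t^{p+1}): beyond some T the integrand is at most (ε/2) τ^p, and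
the error E accumulated up to T is eventually at most (ε/2) t^{p+1}. -/
theorem CoeffC.tendsto_timeS_div (hc : CoeffC p c) :
    Tendsto (fun t => timeS c t / t ^ (p + 1)) atTop (𝓝 (1 / (p + 1))) := by
  have hp := hc.p_pos
  have hp1 : 0 < p + 1 := by linarith
  have htop : Tendsto (fun t : ℝ => t ^ (p + 1)) atTop atTop := tendsto_rpow_atTop hp1
  have hpi : ∀ x y : ℝ, IntervalIntegrable (fun τ : ℝ => τ ^ p) volume x y :=
    fun x y => intervalIntegral.intervalIntegrable_rpow' (by linarith)
  have hint : ∀ x y : ℝ, ∫ τ in x..y, τ ^ p = (y ^ (p + 1) - x ^ (p + 1)) / (p + 1) :=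
    fun x y => integral_rpow (Or.inl (by linarith))
  have hD : (fun t => timeS c t - ∫ τ in (1:ℝ)..t, τ ^ p) =o[atTop] fun t : ℝ => t ^ (p + 1) := by
    rw [isLittleO_iff]
    intro ε hε
    have h1 := isLittleO_iff.1 hc.asymp (show 0 < ε / 2 by positivity)
    obtain ⟨T, hT⟩ := eventually_atTop.1 (h1.and (eventually_ge_atTop 1))
    have hT1 : 1 ≤ T := (hT T le_rfl).2
    set E := |timeS c T - ∫ τ in (1:ℝ)..T, τ ^ p| with hE
    filter_upwards [htop.eventually_ge_atTop (E / (ε / 2)), eventually_ge_atTop T] with t ht htT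
    have ht1 : 1 ≤ t := hT1.trans htT
    have e : timeS c t - ∫ τ in (1:ℝ)..t, τ ^ p =
        (timeS c T - ∫ τ in (1:ℝ)..T, τ ^ p) + ∫ τ in T..t, (c τ - τ ^ p) := by
      rw [intervalIntegral.integral_sub (hc.intervalIntegrable hT1 ht1) (hpi _ _),
        ← hc.timeS_sub hT1 ht1, ← intervalIntegral.integral_add_adjacent_intervals (hpi 1 T)
        (hpi T t)]
      ring
    have h2 : |∫ τ in T..t, (c τ - τ ^ p)| ≤ ∫ τ in T..t, ε / 2 * τ ^ p := by
      rw [← Real.norm_eq_abs]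
      refine intervalIntegral.norm_integral_le_of_norm_le htT ?_ ((hpi _ _).const_mul _)
      refine Eventually.of_forall fun τ hτ => ?_
      refine (hT τ hτ.1.le).1.trans (le_of_eq ?_)
      rw [Real.norm_of_nonneg (Real.rpow_nonneg (by linarith [hτ.1]) _)]
    rw [intervalIntegral.integral_const_mul, hint] at h2
    have h3 : (t ^ (p + 1) - T ^ (p + 1)) / (p + 1) ≤ t ^ (p + 1) := by
      have : 0 ≤ T ^ (p + 1) := by positivity
      have : 0 ≤ t ^ (p + 1) := by positivity
      rw [div_le_iff₀ hp1]; nlinarith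
    have h4 : E ≤ ε / 2 * t ^ (p + 1) := by
      rw [div_le_iff₀ (by positivity)] at ht; linarith
    rw [e, Real.norm_eq_abs, Real.norm_of_nonneg (by positivity : 0 ≤ t ^ (p + 1))]
    refine (abs_add_le _ _).trans ?_
    have h5 := mul_le_mul_of_nonneg_left h3 (by positivity : 0 ≤ ε / 2)
    linarith
  have hlim := hD.tendsto_div_nhds_zero
  have hinv : Tendsto (fun t : ℝ => (t ^ (p + 1))⁻¹) atTop (𝓝 0) := tendsto_inv_atTop_zero.comp htop
  have := (hlim.add ((tendsto_const_nhds (x := (1:ℝ))).sub hinv |>.mul_const (1 / (p + 1))))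
  rw [sub_zero, one_mul, zero_add] at this
  refine this.congr' ?_
  filter_upwards [eventually_gt_atTop 0] with t ht
  have : 0 < t ^ (p + 1) := by positivity
  rw [hint, Real.one_rpow]
  field_simp
  ring

end Time

/-- The length scale `(1 + S(t))^{1/d}`. -/
noncomputable def lenS (d : ℝ) (S : ℝ → ℝ) (t : ℝ) : ℝ := (1 + S t) ^ (1 / d)

/-- A strictly increasing time change for which the `-k`-th power of the length scale
is integrable. -/
structure TimeData (d : ℝ) (k : ℕ) (S : ℝ → ℝ) : Prop where
  d_pos : 0 < d
  cont : Continuous S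
  start : S 1 = 0
  lt : ∀ τ t, 1 ≤ τ → τ < t → S τ < S t
  nonneg : ∀ t, 0 ≤ S t
  integrable : IntegrableOn (fun t => (lenS d S t ^ k)⁻¹) (Set.Ioi 1)

theorem CoeffC.timeS_nonneg {p : ℝ} {c : ℝ → ℝ} (hc : CoeffC p c) {t : ℝ} (ht : 1 ≤ t) :
    0 ≤ timeS c t := by
  rcases ht.eq_or_lt with rfl | h
  · simp [timeS]
  · have := hc.timeS_lt le_rfl h
    simp only [timeS, intervalIntegral.integral_same] at this ⊢
    exact this.le

theorem CoeffC.tendsto_lenS_div {p : ℝ} (d : ℝ) {c : ℝ → ℝ} (hc : CoeffC p c) :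
    Tendsto (fun t => lenS d (fun t => timeS c (max t 1)) t / t ^ ((p + 1) / d)) atTop
      (𝓝 ((1 / (p + 1)) ^ (1 / d))) := by
  have hp1 : 0 < p + 1 := by linarith [hc.p_pos]
  have hinv : Tendsto (fun t : ℝ => (t ^ (p + 1))⁻¹) atTop (𝓝 0) :=
    tendsto_inv_atTop_zero.comp (tendsto_rpow_atTop hp1)
  have h := (hinv.add hc.tendsto_timeS_div).rpow_const (p := 1 / d)
    (Or.inl (by rw [zero_add]; positivity))
  rw [zero_add] at h
  refine h.congr' ?_
  filter_upwards [eventually_ge_atTop 1] with t ht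
  have h0 := hc.timeS_nonneg ht
  have ht0 : 0 < t := by linarith
  rw [lenS, max_eq_left ht, div_eq_mul_one_div (p + 1) d, Real.rpow_mul ht0.le,
    ← Real.div_rpow (by positivity) (by positivity)]
  congr 1
  ring

/-- Replacing t by max(t, 1) extends s continuously by 0 to t ≤ 1, so continuity and nonnegativity
hold on the whole line. -/
theorem CoeffC.timeData {p d : ℝ} (hd : 0 < d) {c : ℝ → ℝ} (hc : CoeffC p c) {α : ℕ}
    (hα : (p + 1 + d) / (p + 1) < (α : ℝ)) :
    TimeData d (α - 1) (fun t => timeS c (max t 1)) := by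
  have hp1 : 0 < p + 1 := by linarith [hc.p_pos]
  have hnn : ∀ t, 0 ≤ timeS c (max t 1) := fun t => hc.timeS_nonneg (le_max_right _ _)
  refine ⟨hd, hc.continuous_timeS, by simp [timeS], fun τ t h1 h2 => ?_, hnn, ?_⟩
  · rw [max_eq_left h1, max_eq_left (h1.trans h2.le)]
    exact hc.timeS_lt h1 h2
  set L := lenS d fun t => timeS c (max t 1) with hL
  have hLpos : ∀ t, 0 < L t := fun t => by
    have := hnn t
    rw [hL, lenS]; positivity
  have hcont : Continuous fun t => (L t ^ (α - 1))⁻¹ := by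
    refine Continuous.inv₀ (Continuous.pow ?_ _) fun t => (pow_pos (hLpos t) _).ne'
    exact (continuous_const.add hc.continuous_timeS).rpow_const fun t => by
      exact Or.inl (add_pos_of_pos_of_nonneg one_pos (hnn t)).ne'
  have hα' : 1 < (α : ℝ) := by
    refine lt_of_le_of_lt ?_ hα
    rw [le_div_iff₀ hp1]; linarith
  have hα1 : ((α - 1 : ℕ) : ℝ) = α - 1 := by
    rw [Nat.cast_sub (by exact_mod_cast hα'.le)]; simp
  -- The hypothesis α > (p+1+d)/(p+1), rewritten as (α - 1)(p + 1) > d.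
  have he : -((p + 1) / d * (α - 1 : ℕ)) < -1 := by
    rw [neg_lt_neg_iff, hα1, div_mul_eq_mul_div, lt_div_iff₀ hd]
    rw [div_lt_iff₀ hp1] at hα
    linarith
  have hκ : 0 < (1 / (p + 1)) ^ (1 / d) := by positivity
  have h2 : Tendsto (fun t => (L t ^ (α - 1))⁻¹ / t ^ (-((p + 1) / d * (α - 1 : ℕ)))) atTop
      (𝓝 ((((1 / (p + 1)) ^ (1 / d)) ^ (α - 1))⁻¹)) := by
    refine (((hc.tendsto_lenS_div d).pow (α - 1)).inv₀ (by positivity)).congr' ?_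
    filter_upwards [eventually_gt_atTop 0] with t ht
    rw [div_pow, Real.rpow_neg ht.le, Real.rpow_mul ht.le, Real.rpow_natCast, inv_div, div_inv_eq_mul,
      div_eq_inv_mul]
  have hO : (fun t => (L t ^ (α - 1))⁻¹) =O[atTop] fun t => t ^ (-((p + 1) / d * (α - 1 : ℕ))) :=
    isBigO_of_div_tendsto_nhds (by
      filter_upwards [eventually_gt_atTop 0] with t ht h0
      exact absurd h0 (by positivity)) _ h2
  have h3 : IntegrableAtFilter (fun t : ℝ => t ^ (-((p + 1) / d * (α - 1 : ℕ)))) atTop :=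
    (integrableAtFilter_rpow_atTop_iff).2 he
  have h4 : IntegrableOn (fun t => (L t ^ (α - 1))⁻¹) (Set.Ici 1) :=
    LocallyIntegrableOn.integrableOn_of_isBigO_atTop
      (hcont.locallyIntegrable.locallyIntegrableOn _) hO h3
  exact h4.mono_set Set.Ioi_subset_Ici_self

/-! ### The Duhamel operator -/

/-- The space-time function `u` is jointly measurable, and for `t > 1` the slice `u t` is
continuous and satisfies the weighted Fourier bounds at length scale `ℓ t`. -/
structure Adm (q : ℕ) (ℓ b n : ℝ → ℝ) (u : ℝ → ℝ → ℝ) : Prop where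
  measurable : Measurable (Function.uncurry u)
  cont : ∀ t, 1 < t → Continuous (u t)
  fb : ∀ t, 1 < t → FBound q (ℓ t) (b t) (n t) (u t)

/-- `∫₁ᵗ G(·, S(t) - S(τ)) * W(τ) dτ`. -/
noncomputable def duh (d : ℝ) (g : ℝ → ℝ) (S : ℝ → ℝ) (W : ℝ → ℝ → ℝ) (t x : ℝ) : ℝ :=
  ∫ τ in Set.Ioo 1 t, heat d g (S t - S τ) (W τ) x

/-- The constant in the bound for the convolution with the kernel. -/
noncomputable def heatC (q : ℕ) (d Cg : ℝ) : ℝ := 2 * ((2 : ℝ) ^ (1 / d)) ^ q * Cg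

/-- `∫₁^∞ ℓ(τ)^{-k} dτ`. -/
noncomputable def lenMass (d : ℝ) (k : ℕ) (S : ℝ → ℝ) : ℝ :=
  ∫ τ in Set.Ioi 1, (lenS d S τ ^ k)⁻¹

section

variable {q : ℕ} {d Cg : ℝ} {g : ℝ → ℝ} {k : ℕ} {S : ℝ → ℝ}

theorem TimeData.one_le_len (hT : TimeData d k S) (t : ℝ) : 1 ≤ lenS d S t :=
  Real.one_le_rpow (by linarith [hT.nonneg t]) (by have := hT.d_pos; positivity)

theorem TimeData.len_pos (hT : TimeData d k S) (t : ℝ) : 0 < lenS d S t :=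
  one_pos.trans_le (hT.one_le_len t)

theorem TimeData.len_one (hT : TimeData d k S) : lenS d S 1 = 1 := by
  simp [lenS, hT.start]

theorem TimeData.len_le (hT : TimeData d k S) {τ t : ℝ} (h1 : 1 ≤ τ) (h2 : τ ≤ t) :
    lenS d S τ ≤ lenS d S t := by
  have hd := hT.d_pos
  rcases h2.eq_or_lt with rfl | h2
  · rfl
  · exact Real.rpow_le_rpow (by linarith [hT.nonneg τ]) (by linarith [hT.lt τ t h1 h2])
      (by positivity)

theorem heatC_nonneg (hCg : 0 ≤ Cg) : 0 ≤ heatC q d Cg := by unfold heatC; positivity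

theorem le_heatC (hd : 0 < d) (hCg : 0 ≤ Cg) : Cg ≤ heatC q d Cg := by
  have : 1 ≤ ((2 : ℝ) ^ (1 / d)) ^ q :=
    one_le_pow₀ (Real.one_le_rpow one_le_two (by positivity))
  unfold heatC
  nlinarith

theorem TimeData.fBound_heat (hT : TimeData d k S) (hg : FBound q 1 Cg Cg g) {τ t B N : ℝ}
    {v : ℝ → ℝ} (h1 : 1 ≤ τ) (h2 : τ < t) (hv : FBound q (lenS d S τ) B N v) :
    FBound q (lenS d S t) (heatC q d Cg * B) (heatC q d Cg * N) (heat d g (S t - S τ) v) := by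
  have hd := hT.d_pos
  have hd' : 0 ≤ 1 / d := by positivity
  have hσ : 0 < S t - S τ := sub_pos.2 (hT.lt τ t h1 h2)
  have hτ0 := hT.nonneg τ
  have hN := hv.nonneg_N
  refine (hg.heat hσ hv (hT.len_pos τ) (K := 2 ^ (1 / d)) ?_ (hT.len_le h1 h2.le) ?_ ?_).mono
    (hT.len_pos t).le le_rfl ?_
  · exact Real.rpow_le_rpow hσ.le (by linarith) hd'
  · exact Real.one_le_rpow one_le_two hd'
  · have h3 : 1 + S t ≤ 2 * max (S t - S τ) (1 + S τ) := by
      have := le_max_left (S t - S τ) (1 + S τ)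
      have := le_max_right (S t - S τ) (1 + S τ)
      linarith
    have hm : 0 ≤ max (S t - S τ) (1 + S τ) := le_max_of_le_left hσ.le
    refine (Real.rpow_le_rpow (by linarith [hT.nonneg t]) h3 hd').trans ?_
    rw [Real.mul_rpow zero_le_two hm]
    gcongr
    rcases max_cases (S t - S τ) (1 + S τ) with ⟨e, -⟩ | ⟨e, -⟩ <;> rw [e]
    · exact le_max_left _ _
    · exact le_max_right _ _
  · gcongr
    exact le_heatC hd hg.nonneg_N

theorem measurable_heat (hS : Continuous S) (hgc : Continuous g) {W : ℝ → ℝ → ℝ}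
    (hW : Measurable (Function.uncurry W)) :
    Measurable fun z : (ℝ × ℝ) × ℝ => heat d g (S z.1.1 - S z.2) (W z.2) z.1.2 := by
  have hWm : Measurable fun z : ((ℝ × ℝ) × ℝ) × ℝ => W z.1.2 z.2 :=
    hW.comp (by fun_prop : Measurable fun z : ((ℝ × ℝ) × ℝ) × ℝ => (z.1.2, z.2))
  have hSm := hS.measurable
  have hgm := hgc.measurable
  have : Measurable fun z : ((ℝ × ℝ) × ℝ) × ℝ =>
      gk d g (S z.1.1.1 - S z.1.2) (z.1.1.2 - z.2) * W z.1.2 z.2 := by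
    unfold gk
    fun_prop
  exact this.stronglyMeasurable.integral_prod_right'.measurable

theorem measurable_heat_init (hS : Continuous S) (hgc : Continuous g) {f : ℝ → ℝ}
    (hf : Integrable f) : Measurable (Function.uncurry fun t x => heat d g (S t) f x) := by
  -- An integrable f is only a.e. measurable; a measurable representative has the same convolutions.
  set f' := hf.1.mk f with hf'
  have hfm : Measurable f' := hf.1.stronglyMeasurable_mk.measurable
  have e : (fun t x => heat d g (S t) f x) = fun t x => heat d g (S t) f' x := by
    ext t x
    refine integral_congr_ae ?_
    filter_upwards [hf.1.ae_eq_mk] with y hy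
    rw [hy]
  have hSm := hS.measurable
  have hgm := hgc.measurable
  have : Measurable fun z : (ℝ × ℝ) × ℝ => gk d g (S z.1.1) (z.1.2 - z.2) * f' z.2 := by
    unfold gk
    fun_prop
  rw [e]
  exact this.stronglyMeasurable.integral_prod_right'.measurable

theorem measurable_duh (hS : Continuous S) (hgc : Continuous g) {W : ℝ → ℝ → ℝ}
    (hW : Measurable (Function.uncurry W)) : Measurable (Function.uncurry (duh d g S W)) := by
  have hm := measurable_heat (d := d) hS hgc hW
  have hset : MeasurableSet {z : (ℝ × ℝ) × ℝ | 1 < z.2 ∧ z.2 < z.1.1} :=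
    (measurableSet_lt measurable_const measurable_snd).inter
      (measurableSet_lt measurable_snd measurable_fst.fst)
  have e : Function.uncurry (duh d g S W) = fun z : ℝ × ℝ => ∫ τ,
      Set.indicator {z : (ℝ × ℝ) × ℝ | 1 < z.2 ∧ z.2 < z.1.1}
        (fun z => heat d g (S z.1.1 - S z.2) (W z.2) z.1.2) (z, τ) := by
    ext z
    rw [Function.uncurry, duh, ← integral_indicator measurableSet_Ioo]
    rfl
  rw [e]
  exact (hm.indicator hset).stronglyMeasurable.integral_prod_right'.measurable

theorem TimeData.fBound_slices (hT : TimeData d k S) (hg : FBound q 1 Cg Cg g)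
    {W : ℝ → ℝ → ℝ} {D N : ℝ}
    (hW : Adm q (lenS d S) (fun τ => (lenS d S τ ^ k)⁻¹ * D) (fun τ => (lenS d S τ ^ k)⁻¹ * N) W)
    (t : ℝ) : ∀ᵐ τ ∂(volume.restrict (Set.Ioo 1 t)), FBound q (lenS d S t)
      (heatC q d Cg * ((lenS d S τ ^ k)⁻¹ * D)) (heatC q d Cg * ((lenS d S τ ^ k)⁻¹ * N))
      (heat d g (S t - S τ) (W τ)) := by
  filter_upwards [ae_restrict_mem measurableSet_Ioo] with τ hτ
  exact hT.fBound_heat hg hτ.1.le hτ.2 (hW.fb τ hτ.1)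

theorem TimeData.continuous_slices (hT : TimeData d k S) (hq : 1 < q) (hg : FBound q 1 Cg Cg g)
    (hgc : Continuous g) {W : ℝ → ℝ → ℝ} {b n : ℝ → ℝ} (hW : Adm q (lenS d S) b n W)
    (t : ℝ) : ∀ᵐ τ ∂(volume.restrict (Set.Ioo 1 t)), Continuous (heat d g (S t - S τ) (W τ)) := by
  filter_upwards [ae_restrict_mem measurableSet_Ioo] with τ hτ
  exact continuous_heat hq hg hgc (sub_pos.2 (hT.lt τ t hτ.1.le hτ.2)) (hW.fb τ hτ.1).integrable

theorem TimeData.integrable_weight (hT : TimeData d k S) (t C D : ℝ) :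
    Integrable (fun τ => C * ((lenS d S τ ^ k)⁻¹ * D)) (volume.restrict (Set.Ioo 1 t)) :=
  ((hT.integrable.mono_set Set.Ioo_subset_Ioi_self).mul_const D).const_mul C

theorem TimeData.integral_weight_le (hT : TimeData d k S) (t : ℝ) {C D : ℝ} (hC : 0 ≤ C)
    (hD : 0 ≤ D) :
    ∫ τ in Set.Ioo 1 t, C * ((lenS d S τ ^ k)⁻¹ * D) ≤ C * lenMass d k S * D := by
  rw [integral_const_mul, integral_mul_const, mul_assoc, lenMass]
  refine mul_le_mul_of_nonneg_left (mul_le_mul_of_nonneg_right ?_ hD) hC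
  exact setIntegral_mono_set hT.integrable
    (Eventually.of_forall fun τ => inv_nonneg.2 (pow_nonneg (hT.len_pos τ).le _))
    Set.Ioo_subset_Ioi_self.eventuallyLE

theorem measurable_slices (hS : Continuous S) (hgc : Continuous g) {W : ℝ → ℝ → ℝ}
    (hW : Measurable (Function.uncurry W)) (t : ℝ) :
    Measurable (Function.uncurry fun τ x => heat d g (S t - S τ) (W τ) x) :=
  (measurable_heat (d := d) hS hgc hW).comp
    (by fun_prop : Measurable fun z : ℝ × ℝ => ((t, z.2), z.1))

/-- The heat estimate costs a constant uniform in τ and t, and the weight ℓ^{-k} of the source is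
integrable on (1, ∞), so the bound does not grow with t. -/
theorem Adm.duh (hT : TimeData d k S) (hq : 1 < q) (hg : FBound q 1 Cg Cg g)
    (hgc : Continuous g) {W : ℝ → ℝ → ℝ} {D N : ℝ} (hD : 0 ≤ D) (hN : 0 ≤ N)
    (hW : Adm q (lenS d S) (fun τ => (lenS d S τ ^ k)⁻¹ * D) (fun τ => (lenS d S τ ^ k)⁻¹ * N) W) :
    Adm q (lenS d S) (fun _ => heatC q d Cg * lenMass d k S * D)
      (fun _ => heatC q d Cg * lenMass d k S * N) (RGIntegral.duh d g S W) := by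
  have hCg := hg.nonneg_N
  refine ⟨measurable_duh hT.cont hgc hW.measurable, fun t _ => ?_, fun t _ => ?_⟩
  · exact FBound.continuous_integral (measurable_slices hT.cont hgc hW.measurable t)
      (hT.integrable_weight t _ _) hq (hT.len_pos t) (hT.fBound_slices hg hW t)
      (hT.continuous_slices hq hg hgc hW t)
  · refine (FBound.integral (measurable_slices hT.cont hgc hW.measurable t)
      (hT.integrable_weight t _ _) (hT.integrable_weight t _ _)
      (hT.len_pos t).le (hT.fBound_slices hg hW t)).2.mono (hT.len_pos t).le ?_ ?_
    · exact hT.integral_weight_le t (heatC_nonneg hCg) hD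
    · exact hT.integral_weight_le t (heatC_nonneg hCg) hN

theorem TimeData.integrable_heat_time (hT : TimeData d k S) (hq : 1 < q) (hg : FBound q 1 Cg Cg g)
    (hgc : Continuous g) {W : ℝ → ℝ → ℝ} {D N : ℝ}
    (hW : Adm q (lenS d S) (fun τ => (lenS d S τ ^ k)⁻¹ * D) (fun τ => (lenS d S τ ^ k)⁻¹ * N) W)
    (t x : ℝ) : IntegrableOn (fun τ => heat d g (S t - S τ) (W τ) x) (Set.Ioo 1 t) := by
  refine Integrable.mono' ((hT.integrable_weight t (heatC q d Cg) D).const_mul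
    (algK q / lenS d S t)) ((measurable_slices hT.cont hgc hW.measurable t).comp
      (measurable_id.prodMk measurable_const)).aestronglyMeasurable ?_
  filter_upwards [hT.fBound_slices hg hW t, hT.continuous_slices hq hg hgc hW t] with τ h1 h2
  exact h1.abs_le h2 hq (hT.len_pos t) x

theorem integrable_gk_mul (hq : 1 < q) (hg : FBound q 1 Cg Cg g) (hgc : Continuous g) {σ : ℝ}
    (hσ : 0 < σ) {v : ℝ → ℝ} (hv : Integrable v) (x : ℝ) :
    Integrable fun y => gk d g σ (x - y) * v y :=
  hv.bdd_mul ((continuous_gk d hgc σ).comp (by fun_prop)).aestronglyMeasurable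
    (Eventually.of_forall fun y => (hg.gk (d := d) hσ).abs_le (continuous_gk d hgc σ) hq
      (by positivity) (x - y))

theorem TimeData.duh_sub (hT : TimeData d k S) (hq : 1 < q) (hg : FBound q 1 Cg Cg g)
    (hgc : Continuous g) {W V : ℝ → ℝ → ℝ} {D N D' N' : ℝ}
    (hW : Adm q (lenS d S) (fun τ => (lenS d S τ ^ k)⁻¹ * D) (fun τ => (lenS d S τ ^ k)⁻¹ * N) W)
    (hV : Adm q (lenS d S) (fun τ => (lenS d S τ ^ k)⁻¹ * D') (fun τ => (lenS d S τ ^ k)⁻¹ * N') V)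
    (t x : ℝ) :
    duh d g S W t x - duh d g S V t x = duh d g S (fun τ y => W τ y - V τ y) t x := by
  unfold duh
  rw [← integral_sub (hT.integrable_heat_time hq hg hgc hW t x)
    (hT.integrable_heat_time hq hg hgc hV t x)]
  refine setIntegral_congr_fun measurableSet_Ioo fun τ hτ => ?_
  have hσ := sub_pos.2 (hT.lt τ t hτ.1.le hτ.2)
  simp only [heat]
  rw [← integral_sub (integrable_gk_mul hq hg hgc hσ (hW.fb τ hτ.1).integrable x)
    (integrable_gk_mul hq hg hgc hσ (hV.fb τ hτ.1).integrable x)]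
  simp only [mul_sub]

/-- The kernel has L¹ norm at most `Cg` at every positive time, so there is no singularity at τ = t;
the sup norm of W(τ) is integrable in time. -/
theorem TimeData.integrable_heat_space_time (hT : TimeData d k S) (hq : 1 < q)
    (hg : FBound q 1 Cg Cg g)
    (hgc : Continuous g) {W : ℝ → ℝ → ℝ} {D N : ℝ} (hD : 0 ≤ D)
    (hW : Adm q (lenS d S) (fun τ => (lenS d S τ ^ k)⁻¹ * D) (fun τ => (lenS d S τ ^ k)⁻¹ * N) W)
    (t x : ℝ) : IntegrableOn (fun z : ℝ × ℝ => gk d g (S t - S z.2) (x - z.1) * W z.2 z.1)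
      (Set.univ ×ˢ Set.Ioo 1 t) := by
  have hSm := hT.cont.measurable
  have hgm := hgc.measurable
  have hWm : Measurable fun z : ℝ × ℝ => W z.2 z.1 :=
    hW.measurable.comp (by fun_prop : Measurable fun z : ℝ × ℝ => (z.2, z.1))
  have hm : Measurable fun z : ℝ × ℝ => gk d g (S t - S z.2) (x - z.1) * W z.2 z.1 := by
    refine Measurable.mul ?_ hWm
    unfold gk; fun_prop
  have hK := algK_nonneg q
  have hCg := hg.nonneg_N
  rw [IntegrableOn, Measure.volume_eq_prod, ← Measure.prod_restrict, Measure.restrict_univ,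
    integrable_prod_iff' hm.aestronglyMeasurable]
  have hmem := ae_restrict_mem (μ := (volume : Measure ℝ)) (measurableSet_Ioo (a := 1) (b := t))
  refine ⟨?_, (hT.integrable_weight t (Cg * algK q) D).mono'
    hm.norm.stronglyMeasurable.integral_prod_left'.aestronglyMeasurable ?_⟩
  · filter_upwards [hmem] with τ hτ
    exact integrable_gk_mul hq hg hgc (sub_pos.2 (hT.lt τ t hτ.1.le hτ.2))
      (hW.fb τ hτ.1).integrable x
  · filter_upwards [hmem] with τ hτ
    have hσ := sub_pos.2 (hT.lt τ t hτ.1.le hτ.2)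
    have hk := hg.gk (d := d) hσ
    have hl := hT.one_le_len τ
    have hl0 := hT.len_pos τ
    rw [Real.norm_of_nonneg (integral_nonneg fun _ => norm_nonneg _)]
    have hb : ∀ y, |W τ y| ≤ algK q * ((lenS d S τ ^ k)⁻¹ * D) := fun y => by
      refine ((hW.fb τ hτ.1).abs_le (hW.cont τ hτ.1) hq hl0 y).trans ?_
      gcongr
      exact div_le_self hK hl
    calc ∫ y, ‖gk d g (S t - S τ) (x - y) * W τ y‖
        ≤ ∫ y, |gk d g (S t - S τ) (x - y)| * (algK q * ((lenS d S τ ^ k)⁻¹ * D)) := by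
          refine integral_mono (integrable_gk_mul hq hg hgc hσ (hW.fb τ hτ.1).integrable x).norm
            ((hk.integrable.comp_sub_left x).abs.mul_const _) fun y => ?_
          simp only [norm_mul, Real.norm_eq_abs]
          gcongr
          exact hb y
      _ = (∫ y, |gk d g (S t - S τ) y|) * (algK q * ((lenS d S τ ^ k)⁻¹ * D)) := by
          rw [integral_mul_const,
            integral_sub_left_eq_self (fun y => |gk d g (S t - S τ) y|) volume x]
      _ ≤ Cg * (algK q * ((lenS d S τ ^ k)⁻¹ * D)) := by
          gcongr
          exact hk.l1
      _ = _ := by ring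

end

/-! ### The fixed point -/

section FixedPoint

variable {q : ℕ} {ℓ : ℝ → ℝ} {b n b' n' : ℝ → ℝ} {u v : ℝ → ℝ → ℝ}

theorem Adm.mono (h : Adm q ℓ b n u) (hℓ : ∀ t, 1 < t → 0 ≤ ℓ t) (hb : ∀ t, 1 < t → b t ≤ b' t)
    (hn : ∀ t, 1 < t → n t ≤ n' t) : Adm q ℓ b' n' u :=
  ⟨h.measurable, h.cont, fun t ht => (h.fb t ht).mono (hℓ t ht) (hb t ht) (hn t ht)⟩

theorem Adm.add (h : Adm q ℓ b n u) (h' : Adm q ℓ b' n' v) (hℓ : ∀ t, 1 < t → 0 ≤ ℓ t) :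
    Adm q ℓ (fun t => b t + b' t) (fun t => n t + n' t) (fun t x => u t x + v t x) :=
  ⟨h.measurable.add h'.measurable, fun t ht => (h.cont t ht).add (h'.cont t ht),
    fun t ht => (h.fb t ht).add (h'.fb t ht) (hℓ t ht)⟩

/-- Picard iteration from 0, carried out by hand in the class `Adm`. Increments halve at each step,
so the n-th iterate is bounded by R(1 - 2^{-n}) and never leaves the ball; the limit is the
telescoping series. The L¹ size `N` may be arbitrarily large, since the contraction acts on B and N
separately. -/
theorem Adm.exists_fixedPoint (hq : 1 < q) (hℓ : ∀ t, 1 < t → 0 < ℓ t)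
    {Φ : (ℝ → ℝ → ℝ) → ℝ → ℝ → ℝ} {R N : ℝ} (hR : 0 ≤ R) (hN : 0 ≤ N)
    (h0 : Adm q ℓ (fun _ => R / 2) (fun _ => N / 2) (Φ fun _ _ => 0))
    (hΦ : ∀ u v D N', Adm q ℓ (fun _ => R) (fun _ => N) u → Adm q ℓ (fun _ => R) (fun _ => N) v →
      Adm q ℓ (fun _ => D) (fun _ => N') (fun t x => u t x - v t x) →
      Adm q ℓ (fun _ => D / 2) (fun _ => N' / 2) (fun t x => Φ u t x - Φ v t x)) :
    ∃ u, Adm q ℓ (fun _ => R) (fun _ => N) u ∧ ∀ t, 1 < t → ∀ x, u t x = Φ u t x := by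
  have hℓ' : ∀ t, 1 < t → 0 ≤ ℓ t := fun t ht => (hℓ t ht).le
  set U : ℕ → ℝ → ℝ → ℝ := fun n => Φ^[n] (fun _ _ => 0) with hU
  have hUs : ∀ n, U (n + 1) = Φ (U n) := fun n => Function.iterate_succ_apply' Φ n _
  have hpow : ∀ n : ℕ, (0:ℝ) < 1 / 2 ^ n ∧ (1:ℝ) / 2 ^ n ≤ 1 := fun n =>
    ⟨by positivity, by rw [div_le_one (by positivity)]; exact one_le_pow₀ one_le_two⟩
  have hind : ∀ n : ℕ, Adm q ℓ (fun _ => R * (1 - 1 / 2 ^ n)) (fun _ => N * (1 - 1 / 2 ^ n)) (U n) ∧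
      Adm q ℓ (fun _ => R / 2 ^ (n + 1)) (fun _ => N / 2 ^ (n + 1))
        (fun t x => U (n + 1) t x - U n t x) := by
    intro n
    induction n with
    | zero =>
      refine ⟨⟨measurable_const, fun t _ => continuous_const, fun t _ => ?_⟩, ?_⟩
      · rw [show U 0 t = fun _ => 0 from rfl]
        simpa using FBound.zero q (ℓ t)
      · simpa [hU] using h0
    | succ n ih =>
      obtain ⟨h1, h2⟩ := ih
      have h3 : Adm q ℓ (fun _ => R * (1 - 1 / 2 ^ (n + 1))) (fun _ => N * (1 - 1 / 2 ^ (n + 1)))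
          (U (n + 1)) := by
        have h4 := h1.add h2 hℓ'
        simp only [add_sub_cancel] at h4
        refine h4.mono hℓ' (fun t _ => le_of_eq ?_) (fun t _ => le_of_eq ?_) <;>
        · rw [pow_succ]; field_simp; ring
      refine ⟨h3, ?_⟩
      have hle : ∀ (m : ℕ) (X : ℝ), 0 ≤ X → X * (1 - 1 / 2 ^ m) ≤ X := fun m X hX =>
        mul_le_of_le_one_right hX (by linarith [(hpow m).1])
      have h5 := hΦ _ _ _ _ (h3.mono hℓ' (fun _ _ => hle _ _ hR) fun _ _ => hle _ _ hN)
        (h1.mono hℓ' (fun _ _ => hle _ _ hR) fun _ _ => hle _ _ hN) h2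
      rw [← hUs, ← hUs] at h5
      refine h5.mono hℓ' (fun t _ => le_of_eq ?_) (fun t _ => le_of_eq ?_) <;>
      · rw [pow_succ _ (n + 1)]; field_simp
  set w : ℕ → ℝ → ℝ → ℝ := fun n t x => U (n + 1) t x - U n t x with hw
  have hgeo : ∀ (m : ℕ) (X : ℝ), HasSum (fun j : ℕ => X / 2 ^ (j + m + 1)) (X / 2 ^ m) := by
    intro m X
    have := (hasSum_geometric_two.mul_left (X / 2 ^ (m + 1)))
    have e1 : (fun j : ℕ => X / 2 ^ (m + 1) * (1 / 2) ^ j) = fun j : ℕ => X / 2 ^ (j + m + 1) := by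
      ext j
      rw [one_div_pow, show j + m + 1 = m + 1 + j by ring, pow_add _ (m + 1)]
      field_simp
    have e2 : X / 2 ^ (m + 1) * 2 = X / 2 ^ m := by rw [pow_succ]; field_simp
    rwa [e1, e2] at this
  have htail : ∀ (m : ℕ) (t : ℝ), 1 < t → (∀ x, Summable fun j => w (j + m) t x) ∧
      Continuous (fun x => ∑' j, w (j + m) t x) ∧
      FBound q (ℓ t) (R / 2 ^ m) (N / 2 ^ m) (fun x => ∑' j, w (j + m) t x) := by
    intro m t ht
    have := FBound.tsum (hgeo m R).summable (hgeo m N).summable hq (hℓ t ht)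
      (fun j => (hind (j + m)).2.fb t ht) (fun j => (hind (j + m)).2.cont t ht)
    rwa [(hgeo m R).tsum_eq, (hgeo m N).tsum_eq] at this
  have htele : ∀ (m : ℕ) (t x : ℝ), 1 < t →
      ∑' j, w (j + m) t x = ∑' j, w j t x - U m t x := by
    intro m t x ht
    have hs : Summable fun j => w j t x := by simpa using (htail 0 t ht).1 x
    have h1 := hs.sum_add_tsum_nat_add m
    have h2 : ∑ j ∈ Finset.range m, w j t x = U m t x := by
      rw [hw, Finset.sum_range_sub (fun j => U j t x)]
      simp [hU]
    rw [h2] at h1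
    linarith
  -- Convergence is known only for t > 1. The value 0 elsewhere makes u an everywhere limit of
  -- measurable functions.
  set u : ℝ → ℝ → ℝ := fun t x => if 1 < t then ∑' j, w j t x else 0 with hu
  have hut : ∀ t, 1 < t → u t = fun x => ∑' j, w j t x := fun t ht => by
    ext x; simp only [hu, if_pos ht]
  have hum : Measurable (Function.uncurry u) := by
    have hset : MeasurableSet {z : ℝ × ℝ | 1 < z.1} := measurableSet_lt measurable_const measurable_fst
    refine measurable_of_tendsto_metrizable (f := fun (n : ℕ) (z : ℝ × ℝ) =>
      Set.indicator {z : ℝ × ℝ | 1 < z.1} (Function.uncurry (U n)) z)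
      (fun n => (hind n).1.measurable.indicator hset) ?_
    rw [tendsto_pi_nhds]
    rintro ⟨t, x⟩
    by_cases ht : 1 < t
    · simp only [Set.indicator, Set.mem_ofPred_eq, ht, if_true, Function.uncurry, hut t ht]
      have hs : Summable fun j => w j t x := by simpa using (htail 0 t ht).1 x
      refine hs.hasSum.tendsto_sum_nat.congr fun m => ?_
      rw [hw, Finset.sum_range_sub (fun j => U j t x)]
      simp [hU]
    · simp [Set.indicator, ht, hu, Function.uncurry]
  have huA : Adm q ℓ (fun _ => R) (fun _ => N) u := by
    refine ⟨hum, fun t ht => ?_, fun t ht => ?_⟩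
    · rw [hut t ht]; simpa using (htail 0 t ht).2.1
    · rw [hut t ht]; simpa using (htail 0 t ht).2.2
  have hdiff : ∀ m : ℕ, Adm q ℓ (fun _ => R / 2 ^ m) (fun _ => N / 2 ^ m)
      (fun t x => u t x - U m t x) := by
    intro m
    have e : ∀ t, 1 < t → (fun x => u t x - U m t x) = fun x => ∑' j, w (j + m) t x := by
      intro t ht; ext x; rw [htele m t x ht, hut t ht]
    refine ⟨hum.sub (hind m).1.measurable, fun t ht => ?_, fun t ht => ?_⟩
    · rw [e t ht]; exact (htail m t ht).2.1
    · rw [e t ht]; exact (htail m t ht).2.2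
  refine ⟨u, huA, fun t ht x => ?_⟩
  have hbound : ∀ m : ℕ, |u t x - Φ u t x| ≤ algK q / ℓ t * R * (1 / 2) ^ m := by
    intro m
    have hle : ∀ X : ℝ, 0 ≤ X → X * (1 - 1 / 2 ^ m) ≤ X := fun X hX =>
      mul_le_of_le_one_right hX (by linarith [(hpow m).1])
    have h1 := hΦ _ _ _ _ huA
      ((hind m).1.mono hℓ' (fun _ _ => hle _ hR) fun _ _ => hle _ hN) (hdiff m)
    rw [← hUs] at h1
    have h2 := (h1.fb t ht).abs_le (h1.cont t ht) hq (hℓ t ht) x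
    have h3 := ((hdiff (m + 1)).fb t ht).abs_le ((hdiff (m + 1)).cont t ht) hq (hℓ t ht) x
    have h4 : u t x - Φ u t x = (u t x - U (m + 1) t x) - (Φ u t x - U (m + 1) t x) := by ring
    rw [h4]
    refine (abs_sub _ _).trans ((add_le_add h3 h2).trans (le_of_eq ?_))
    rw [pow_succ, one_div, inv_pow]
    field_simp
    ring
  have hlim : Tendsto (fun m : ℕ => algK q / ℓ t * R * (1 / 2 : ℝ) ^ m) atTop (𝓝 0) := by
    simpa using (tendsto_pow_atTop_nhds_zero_of_lt_one (r := (1 / 2 : ℝ)) (by norm_num)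
      (by norm_num)).const_mul (algK q / ℓ t * R)
  have := ge_of_tendsto' hlim hbound
  exact sub_eq_zero.1 (abs_eq_zero.1 (le_antisymm this (abs_nonneg _)))

end FixedPoint

/-! ### Existence for small data -/

section Existence

variable {q : ℕ} {d Cg : ℝ} {g : ℝ → ℝ} {S : ℝ → ℝ} {α : ℕ} {a : ℕ → ℝ}

theorem lenMass_nonneg {k : ℕ} (hT : TimeData d k S) : 0 ≤ lenMass d k S :=
  integral_nonneg fun τ => inv_nonneg.2 (pow_nonneg (hT.len_pos τ).le _)

theorem exists_small_radius (q : ℕ) (hα : 1 < α) (ha : 0 < convRadius a) {H : ℝ} (hH : 0 ≤ H) :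
    ∃ (r : ℝ≥0) (R : ℝ), 0 < R ∧ (r : ℝ≥0∞) < convRadius a ∧ algK q * R ≤ r ∧
      H * lipC α a r ≤ 1 / 2 := by
  obtain ⟨r₀, h1, h2⟩ := ENNReal.lt_iff_exists_nnreal_btwn.1 ha
  have hr₀ : 0 < r₀ := by exact_mod_cast h1
  have hl := lipC_nonneg α a r₀
  have hK := algK_nonneg q
  -- With this θ, H θ `lipC α a r₀` ≤ 1/2; the added 1 keeps the denominator positive.
  set θ : ℝ≥0 := (Real.toNNReal (1 / (2 * (H * lipC α a r₀ + 1)))) with hθ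
  have hθ0 : (0 : ℝ) < 1 / (2 * (H * lipC α a r₀ + 1)) := by positivity
  have hθc : (θ : ℝ) = 1 / (2 * (H * lipC α a r₀ + 1)) := Real.coe_toNNReal _ hθ0.le
  have hθ1 : θ ≤ 1 := by
    rw [← NNReal.coe_le_coe, hθc, NNReal.coe_one, div_le_one (by positivity)]
    have : 0 ≤ H * lipC α a r₀ := by positivity
    linarith
  have hr : ((θ * r₀ : ℝ≥0) : ℝ) = θ * r₀ := NNReal.coe_mul _ _
  have hr0 : (0 : ℝ) < (θ * r₀ : ℝ≥0) := by
    rw [hr, hθc]; exact mul_pos hθ0 (by exact_mod_cast hr₀)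
  -- R is r/(`algK` + 1) so that the sup bound `algK q * R` stays within r.
  refine ⟨θ * r₀, (θ * r₀ : ℝ≥0) / (algK q + 1), by positivity, ?_, ?_, ?_⟩
  · refine lt_of_le_of_lt ?_ h2
    exact_mod_cast mul_le_of_le_one_left (zero_le (a := r₀)) hθ1
  · rw [← mul_div_assoc, div_le_iff₀ (by positivity)]
    nlinarith
  · calc H * lipC α a (θ * r₀ : ℝ≥0) ≤ H * (θ * lipC α a r₀) := by
          gcongr; exact lipC_mul_le hα hθ1 h2
      _ = 1 / 2 * ((H * lipC α a r₀) / (H * lipC α a r₀ + 1)) := by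
          rw [hθc]; field_simp
      _ ≤ 1 / 2 := by
          refine mul_le_of_le_one_right (by norm_num) ?_
          rw [div_le_one (by positivity)]; linarith

theorem Adm.abs_le (hT : TimeData d (α - 1) S) (hq : 1 < q) {r : ℝ≥0} {R N : ℝ}
    (hR : algK q * R ≤ r) {u : ℝ → ℝ → ℝ}
    (hu : Adm q (lenS d S) (fun _ => R) (fun _ => N) u) {t : ℝ} (ht : 1 < t) (x : ℝ) :
    |u t x| ≤ r := by
  refine ((hu.fb t ht).abs_le (hu.cont t ht) hq (hT.len_pos t) x).trans (le_trans ?_ hR)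
  have hR0 := (hu.fb t ht).nonneg_B (hT.len_pos t).le
  gcongr
  exact div_le_self (algK_nonneg q) (hT.one_le_len t)

theorem Adm.nonlinTrunc (hT : TimeData d (α - 1) S) (hq : 1 < q) (hα : 1 < α) {lam : ℝ}
    (hlam : |lam| ≤ 1) {r : ℝ≥0} (hr : (r : ℝ≥0∞) < convRadius a) {R N : ℝ}
    (hR : algK q * R ≤ r) {u : ℝ → ℝ → ℝ}
    (hu : Adm q (lenS d S) (fun _ => R) (fun _ => N) u) :
    Adm q (lenS d S) (fun τ => (lenS d S τ ^ (α - 1))⁻¹ * (lipC α a r * R))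
      (fun τ => (lenS d S τ ^ (α - 1))⁻¹ * (lipC α a r * N))
      (fun τ y => nonlinTrunc lam α a r (u τ y)) := by
  have e : ∀ τ, 1 < τ → (fun y => RGIntegral.nonlinTrunc lam α a r (u τ y)) =
      fun y => RGIntegral.nonlin lam α a (u τ y) := fun τ hτ =>
    funext fun y => nonlinTrunc_eq lam α a (hu.abs_le hT hq hR hτ y)
  refine ⟨(continuous_nonlinTrunc hlam α hr).measurable.comp hu.measurable, fun τ hτ => ?_,
    fun τ hτ => ?_⟩ <;> rw [e τ hτ]
  · exact ((hu.fb τ hτ).nonlin hq (hT.one_le_len τ) (hu.cont τ hτ) hlam hα hr hR).1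
  · simp only [← mul_assoc]
    exact ((hu.fb τ hτ).nonlin hq (hT.one_le_len τ) (hu.cont τ hτ) hlam hα hr hR).2

theorem Adm.nonlinTrunc_sub (hT : TimeData d (α - 1) S) (hq : 1 < q) (hα : 1 < α) {lam : ℝ}
    (hlam : |lam| ≤ 1) {r : ℝ≥0} (hr : (r : ℝ≥0∞) < convRadius a) {R N D N' : ℝ}
    (hR : algK q * R ≤ r) {u v : ℝ → ℝ → ℝ}
    (hu : Adm q (lenS d S) (fun _ => R) (fun _ => N) u)
    (hv : Adm q (lenS d S) (fun _ => R) (fun _ => N) v)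
    (hd : Adm q (lenS d S) (fun _ => D) (fun _ => N') (fun t x => u t x - v t x)) :
    Adm q (lenS d S) (fun τ => (lenS d S τ ^ (α - 1))⁻¹ * (lipC α a r * D))
      (fun τ => (lenS d S τ ^ (α - 1))⁻¹ * (lipC α a r * N'))
      (fun τ y => RGIntegral.nonlinTrunc lam α a r (u τ y) -
        RGIntegral.nonlinTrunc lam α a r (v τ y)) := by
  have e : ∀ τ, 1 < τ → (fun y => RGIntegral.nonlinTrunc lam α a r (u τ y) -
      RGIntegral.nonlinTrunc lam α a r (v τ y)) =
      fun y => RGIntegral.nonlin lam α a (u τ y) - RGIntegral.nonlin lam α a (v τ y) :=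
    fun τ hτ => funext fun y => by
      rw [nonlinTrunc_eq lam α a (hu.abs_le hT hq hR hτ y),
        nonlinTrunc_eq lam α a (hv.abs_le hT hq hR hτ y)]
  have hm := (continuous_nonlinTrunc hlam α hr).measurable
  have key : ∀ τ : ℝ, 1 < τ → _ := fun τ hτ => (hu.fb τ hτ).nonlin_sub hq (hT.one_le_len τ)
    (hu.cont τ hτ) (hv.fb τ hτ) (hv.cont τ hτ) (hd.fb τ hτ) hlam hα hr hR
  refine ⟨(hm.comp hu.measurable).sub (hm.comp hv.measurable), fun τ hτ => ?_,
    fun τ hτ => ?_⟩ <;> rw [e τ hτ]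
  · exact (key τ hτ).1
  · simp only [← mul_assoc]
    exact (key τ hτ).2

/-- The linear part uses half of R and of the L¹ budget, and the Duhamel part contracts by 1/2. Only
the weighted bound on f has to be small; its L¹ norm N is free. -/
theorem exists_mild_solution (hT : TimeData d (α - 1) S) (hq : 1 < q) (hα : 1 < α)
    (hg : FBound q 1 Cg Cg g) (hgc : Continuous g) {lam : ℝ} (hlam : |lam| ≤ 1) {r : ℝ≥0}
    (hr : (r : ℝ≥0∞) < convRadius a) {R N : ℝ} (hR : algK q * R ≤ r)
    (hsmall : heatC q d Cg * lenMass d (α - 1) S * lipC α a r ≤ 1 / 2) {f : ℝ → ℝ}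
    (hf : FBound q 1 (R / (2 * (heatC q d Cg + 1))) N f) :
    ∃ u, Adm q (lenS d S) (fun _ => R) (fun _ => 2 * (heatC q d Cg + 1) * N) u ∧
      ∀ t, 1 < t → ∀ x, u t x = heat d g (S t) f x +
        duh d g S (fun τ y => nonlinTrunc lam α a r (u τ y)) t x := by
  have hH := heatC_nonneg (q := q) (d := d) hg.nonneg_N
  have hN := hf.nonneg_N
  have hR0 : 0 ≤ R := by
    have := hf.nonneg_B zero_le_one
    rwa [le_div_iff₀ (by positivity), zero_mul] at this
  have hlip := lipC_nonneg α a r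
  refine Adm.exists_fixedPoint (Φ := fun u t x => heat d g (S t) f x +
    duh d g S (fun τ y => nonlinTrunc lam α a r (u τ y)) t x) hq (fun t _ => hT.len_pos t) hR0
    (by positivity) ?_ ?_
  · have e : (fun t x => heat d g (S t) f x +
        duh d g S (fun τ y => nonlinTrunc lam α a r 0) t x) = fun t x => heat d g (S t) f x := by
      have : nonlinTrunc lam α a r 0 = 0 := by
        rw [nonlinTrunc_eq lam α a (by simp), nonlin_zero lam hα]
      ext t x
      simp [this, duh, heat]
    rw [e]
    have hs : ∀ t, 1 < t → 0 < S t := fun t ht => by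
      have := hT.lt 1 t le_rfl ht
      rwa [hT.start] at this
    refine ⟨measurable_heat_init hT.cont hgc hf.integrable,
      fun t ht => continuous_heat hq hg hgc (hs t ht) hf.integrable, fun t ht => ?_⟩
    -- The initial datum acts as a source at τ = 1, where S = 0 and ℓ = 1.
    have := hT.fBound_heat hg le_rfl ht (by rw [hT.len_one]; exact hf)
    rw [hT.start, sub_zero] at this
    refine this.mono (hT.len_pos t).le ?_ ?_
    · rw [← mul_div_assoc, div_le_div_iff₀ (by positivity) two_pos]
      nlinarith
    · nlinarith
  · intro u v D N' hu hv hd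
    have hu' := hu.nonlinTrunc hT hq hα hlam hr hR
    have hv' := hv.nonlinTrunc hT hq hα hlam hr hR
    have hd' := hu.nonlinTrunc_sub hT hq hα hlam hr hR hv hd
    have e : (fun t x => (heat d g (S t) f x +
          duh d g S (fun τ y => nonlinTrunc lam α a r (u τ y)) t x) -
        (heat d g (S t) f x + duh d g S (fun τ y => nonlinTrunc lam α a r (v τ y)) t x)) =
        duh d g S (fun τ y => nonlinTrunc lam α a r (u τ y) - nonlinTrunc lam α a r (v τ y)) := by
      ext t x
      rw [add_sub_add_left_eq_sub, hT.duh_sub hq hg hgc hu' hv']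
    rw [e]
    have hD := (hd.fb 2 one_lt_two).nonneg_B (hT.len_pos 2).le
    have hN' := (hd.fb 2 one_lt_two).nonneg_N
    refine (Adm.duh hT hq hg hgc (by positivity) (by positivity) hd').mono
      (fun t _ => (hT.len_pos t).le) (fun t _ => ?_) (fun t _ => ?_)
    · have := mul_le_mul_of_nonneg_right hsmall hD
      linarith
    · have := mul_le_mul_of_nonneg_right hsmall hN'
      linarith

end Existence

/-! ### Asymptotics -/

theorem FBound.to_one {q : ℕ} {L Λ B N : ℝ} {u : ℝ → ℝ} (hu : FBound q L B N u) (h1 : 1 ≤ L)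
    (h2 : L ≤ Λ) : FBound q 1 (Λ * B) N u := by
  have hL : 0 ≤ L := zero_le_one.trans h1
  have hB := hu.nonneg_B hL
  refine ⟨hu.integrable, hu.l1, hu.contDiff, fun ω => ?_, fun ω => ?_⟩
  · refine (mul_le_mul_of_nonneg_right (wt_mono q zero_le_one h1 ω) (norm_nonneg _)).trans
      ((hu.bd ω).trans (le_mul_of_one_le_left hB (h1.trans h2)))
  · refine (mul_le_mul_of_nonneg_right (wt_mono q zero_le_one h1 ω) (norm_nonneg _)).trans
      ((hu.bd_deriv ω).trans ?_)
    rw [one_mul]; gcongr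

/-- The loss in passing from length scales in `[κ/2, 2κ]` to the length scale `1`. -/
noncomputable def rescaleC (q : ℕ) (κ : ℝ) : ℝ := (1 + ((κ / 2)⁻¹) ^ q) * (1 + 2 * κ)

theorem FBound.rescale {q : ℕ} {L κ B N : ℝ} {u : ℝ → ℝ} (hu : FBound q L B N u) (hκ : 0 < κ)
    (h1 : κ / 2 ≤ L) (h2 : L ≤ 2 * κ) : FBound q 1 (rescaleC q κ * B) N u := by
  have hL : 0 < L := (half_pos hκ).trans_le h1
  have hB := hu.nonneg_B hL.le
  have hw : ∀ ω, wt q 1 ω ≤ (1 + ((κ / 2)⁻¹) ^ q) * wt q L ω := by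
    intro ω
    have h3 : (1 * |ω|) ^ q ≤ ((κ / 2)⁻¹) ^ q * (L * |ω|) ^ q := by
      rw [← mul_pow, ← mul_assoc]
      gcongr
      rw [inv_mul_eq_div, le_div_iff₀ (by positivity)]
      linarith
    have h4 : 0 ≤ ((κ / 2)⁻¹) ^ q := by positivity
    have h5 : 0 ≤ (L * |ω|) ^ q := by positivity
    unfold wt
    nlinarith
  have hc : 0 ≤ 1 + ((κ / 2)⁻¹) ^ q := by positivity
  refine ⟨hu.integrable, hu.l1, hu.contDiff, fun ω => ?_, fun ω => ?_⟩
  · calc _ ≤ (1 + ((κ / 2)⁻¹) ^ q) * wt q L ω * ‖fourierT u ω‖ := by gcongr; exact hw ω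
      _ = (1 + ((κ / 2)⁻¹) ^ q) * (wt q L ω * ‖fourierT u ω‖) := by ring
      _ ≤ (1 + ((κ / 2)⁻¹) ^ q) * ((1 + 2 * κ) * B) := by
          have h3 : 1 ≤ 1 + 2 * κ := by linarith
          exact mul_le_mul_of_nonneg_left
            ((hu.bd ω).trans (le_mul_of_one_le_left hB h3)) hc
      _ = _ := by rw [rescaleC]; ring
  · calc _ ≤ (1 + ((κ / 2)⁻¹) ^ q) * wt q L ω * ‖deriv (fourierT u) ω‖ := by gcongr; exact hw ω
      _ = (1 + ((κ / 2)⁻¹) ^ q) * (wt q L ω * ‖deriv (fourierT u) ω‖) := by ring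
      _ ≤ (1 + ((κ / 2)⁻¹) ^ q) * ((1 + 2 * κ) * B) := by
          have h3 : L ≤ 1 + 2 * κ := by linarith
          refine mul_le_mul_of_nonneg_left ((hu.bd_deriv ω).trans ?_) hc
          gcongr
      _ = _ := by rw [rescaleC]; ring

theorem FBound.abs_integral_le {q : ℕ} {L B N : ℝ} {u : ℝ → ℝ} (hu : FBound q L B N u)
    (hL : 0 ≤ L) : |∫ x, u x| ≤ B := by
  have := hu.norm_le hL 0
  rwa [fourierT_zero_right, Complex.norm_real, Real.norm_eq_abs] at this

section Asymptotics

variable {q : ℕ} {d Cg : ℝ} {g : ℝ → ℝ} {k : ℕ} {S l : ℝ → ℝ} {σ₀ : ℝ}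

theorem tendsto_rpow_div_scale (hd : 0 < d) (hσ₀ : 0 < σ₀) (hl : Tendsto l atTop atTop)
    (hS : Tendsto (fun t => S t / l t ^ d) atTop (𝓝 σ₀)) (x : ℝ) :
    Tendsto (fun t => (S t + x) ^ (1 / d) / l t) atTop (𝓝 (σ₀ ^ (1 / d))) := by
  have hld : Tendsto (fun t => l t ^ d) atTop atTop := (tendsto_rpow_atTop hd).comp hl
  have h1 : Tendsto (fun t => S t / l t ^ d + x * (l t ^ d)⁻¹) atTop (𝓝 σ₀) := by
    simpa using hS.add ((tendsto_inv_atTop_zero.comp hld).const_mul x)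
  have h2 := h1.rpow_const (p := 1 / d) (Or.inl hσ₀.ne')
  refine h2.congr' ?_
  filter_upwards [hl.eventually_gt_atTop 0, h1.eventually (lt_mem_nhds hσ₀)] with t ht h3
  have e : S t / l t ^ d + x * (l t ^ d)⁻¹ = (S t + x) / l t ^ d := by ring
  have hp : 0 < l t ^ d := by positivity
  rw [e] at h3 ⊢
  -- The shift x may be negative, so positivity of the base is checked before splitting the power.
  have h4 : 0 < S t + x := by
    rcases div_pos_iff.1 h3 with h | h
    · exact h.1
    · exact absurd h.2 (not_lt.2 hp.le)
  rw [Real.div_rpow h4.le hp.le, ← Real.rpow_mul ht.le, mul_one_div_cancel hd.ne', Real.rpow_one]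

/-- The source is cut at a time T. Emissions before T, together with f, converge to multiples of the
profile uniformly; emissions after T, and their limits, are bounded crudely and are small because
ℓ^{-k} has a small tail. -/
theorem TimeData.eventually_fBound_sub (hT : TimeData d k S) (hq : 1 < q)
    (hg' : FBound (q + 1) 1 Cg Cg g) (hg : FBound q 1 Cg Cg g) (hgc : Continuous g)
    (hσ₀ : 0 < σ₀) (hl : Tendsto l atTop atTop)
    (hS : Tendsto (fun t => S t / l t ^ d) atTop (𝓝 σ₀))
    {f : ℝ → ℝ} {Bf Nf : ℝ} (hf : FBound q 1 Bf Nf f) {W : ℝ → ℝ → ℝ} {D N : ℝ} (hD : 0 ≤ D)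
    (hN : 0 ≤ N)
    (hW : Adm q (lenS d S) (fun τ => (lenS d S τ ^ k)⁻¹ * D) (fun τ => (lenS d S τ ^ k)⁻¹ * N) W) :
    ∃ E : ℝ, 0 ≤ E ∧ ∀ η > 0, ∀ᶠ t in atTop, ∃ N', FBound q 1 (E * η) N' fun x =>
      l t * (heat d g (S t) f (l t * x) + duh d g S W t (l t * x)) -
        ((∫ y, f y) + ∫ τ in Set.Ioi 1, ∫ y, W τ y) * gk d g σ₀ x := by
  have hd := hT.d_pos
  set κ := σ₀ ^ (1 / d) with hκ
  have hκ0 : 0 < κ := by positivity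
  have hCg := hg.nonneg_N
  have hH := heatC_nonneg (q := q) (d := d) hCg
  have hI := lenMass_nonneg hT
  have hK : 0 ≤ rescaleC q κ := by unfold rescaleC; positivity
  have hBf := hf.nonneg_B zero_le_one
  set lw : ℝ → ℝ := fun τ => (lenS d S τ ^ k)⁻¹ with hlw
  have hlw0 : ∀ τ, 0 ≤ lw τ := fun τ => inv_nonneg.2 (pow_nonneg (hT.len_pos τ).le _)
  set m : ℝ → ℝ := fun τ => ∫ y, W τ y with hm
  have hmm : Measurable m := hW.measurable.stronglyMeasurable.integral_prod_right.measurable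
  have hmb : ∀ τ, 1 < τ → |m τ| ≤ lw τ * D := fun τ hτ =>
    (hW.fb τ hτ).abs_integral_le (hT.len_pos τ).le
  have hmN : ∀ τ, 1 < τ → |m τ| ≤ lw τ * N := fun τ hτ =>
    abs_integral_le_integral_abs.trans (hW.fb τ hτ).l1
  have hlwD : IntegrableOn (fun τ => lw τ * D) (Set.Ioi 1) := hT.integrable.mul_const D
  have hmi : IntegrableOn m (Set.Ioi 1) := by
    refine hlwD.mono' hmm.aestronglyMeasurable ?_
    filter_upwards [ae_restrict_mem measurableSet_Ioi] with τ hτ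
    exact hmb τ hτ
  have hgκ : FBound q 1 (rescaleC q κ * Cg) Cg (gk d g σ₀) :=
    (hg.gk (d := d) hσ₀).rescale hκ0 (by linarith) (by linarith)
  set K₂ := rescaleC q κ * heatC q d Cg + rescaleC q κ * Cg with hK₂
  have hK₂0 : 0 ≤ K₂ := by positivity
  refine ⟨Bf + (D * lenMass d k S + K₂ * D) + D * (rescaleC q κ * Cg), by positivity,
    fun η hη => ?_⟩
  obtain ⟨T, hT1, hTη⟩ : ∃ T, 1 < T ∧ ∫ τ in Set.Ioi T, lw τ ≤ η := by
    have h1 := intervalIntegral_tendsto_integral_Ioi 1 hT.integrable tendsto_id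
    have h2 := h1.eventually (lt_mem_nhds (sub_lt_self (∫ τ in Set.Ioi 1, lw τ) hη))
    obtain ⟨T, h3, h4⟩ := (h2.and (eventually_gt_atTop 1)).exists
    refine ⟨T, h4, ?_⟩
    have h5 : ∫ τ in Set.Ioi 1, lw τ = (∫ τ in Set.Ioc 1 T, lw τ) + ∫ τ in Set.Ioi T, lw τ := by
      rw [← setIntegral_union (Set.disjoint_left.2 fun z hz hz' =>
        not_lt.2 hz.2 (Set.mem_Ioi.1 hz')) measurableSet_Ioi
        (hT.integrable.mono_set Set.Ioc_subset_Ioi_self)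
        (hT.integrable.mono_set (Set.Ioi_subset_Ioi h4.le)), Set.Ioc_union_Ioi_eq_Ioi h4.le]
    rw [id, intervalIntegral.integral_of_le h4.le] at h3
    linarith
  have hLT := hT.len_pos T
  -- Viewing a source at scale ℓ(τ) ≤ ℓ(T) as one at scale 1 costs ℓ(T) (`FBound.to_one`); the
  -- precision η/ℓ(T) compensates.
  obtain ⟨δ, hδ, hclose⟩ := exists_selfsimilar_close (d := d) hg' hσ₀
    (show 0 < η / lenS d S T by positivity)
  -- The shifts 0 and -S(T) enclose S(t) - S(τ) for all τ in [1, T]; the shift 1 controls ℓ(t)/l(t).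
  have lim0 := tendsto_rpow_div_scale hd hσ₀ hl hS 0
  have limT := tendsto_rpow_div_scale hd hσ₀ hl hS (-S T)
  have lim1 := tendsto_rpow_div_scale hd hσ₀ hl hS 1
  filter_upwards [eventually_gt_atTop T, hl.eventually_gt_atTop δ⁻¹,
    lim0.eventually (gt_mem_nhds (lt_add_of_pos_right κ hδ)),
    limT.eventually (lt_mem_nhds (sub_lt_self κ hδ)),
    lim1.eventually (Icc_mem_nhds (half_lt_self hκ0) (show κ < 2 * κ by linarith))]
    with t htT hlt e0 eT e1
  have hl0 : 0 < l t := (inv_pos.2 hδ).trans hlt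
  have ht1 : 1 < t := hT1.trans htT
  have hscale : lenS d S t / l t ∈ Set.Icc (κ / 2) (2 * κ) := by
    rw [lenS, add_comm]; exact e1
  have hnear : ∀ τ, 1 ≤ τ → τ ≤ T → |(S t - S τ) ^ (1 / d) / l t - κ| < δ := by
    intro τ h1 h2
    have hst : S T < S t := hT.lt T t hT1.le htT
    have hτT : S τ ≤ S T := by
      rcases h2.eq_or_lt with rfl | h
      · rfl
      · exact (hT.lt τ T h1 h).le
    have hτ0 := hT.nonneg τ
    rw [abs_lt]
    constructor
    · have : (S t + -S T) ^ (1 / d) / l t ≤ (S t - S τ) ^ (1 / d) / l t := by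
        gcongr
        · linarith
        · linarith
      linarith
    · have : (S t - S τ) ^ (1 / d) / l t ≤ (S t + 0) ^ (1 / d) / l t := by
        gcongr
        · linarith
        · linarith
      linarith
  have hlin : FBound q 1 (Bf * η) (2 * Cg * Nf)
      (fun x => l t * heat d g (S t) f (l t * x) - (∫ y, f y) * gk d g σ₀ x) := by
    have h0 := hnear 1 le_rfl hT1.le
    have hst := hT.lt 1 t le_rfl ht1
    rw [hT.start, sub_zero] at h0
    rw [hT.start] at hst
    refine (hclose _ _ hst hlt h0 Bf Nf f hf).mono zero_le_one ?_ le_rfl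
    rw [mul_comm Bf]
    gcongr
    exact div_le_self hη.le (hT.one_le_len T)
  -- The first summand is the convergence error for τ ≤ T; the second, for τ > T, adds the bounds of
  -- the rescaled emission and of its limit.
  set b : ℝ → ℝ := fun τ => η * (lw τ * D) + Set.indicator (Set.Ioi T) (fun τ => K₂ * (lw τ * D)) τ
    with hb
  have hslice : ∀ᵐ τ ∂(volume.restrict (Set.Ioo 1 t)), FBound q 1 (b τ)
      ((2 * Cg + (heatC q d Cg + Cg)) * (lw τ * N))
      (fun x => l t * heat d g (S t - S τ) (W τ) (l t * x) - m τ * gk d g σ₀ x) := by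
    filter_upwards [ae_restrict_mem measurableSet_Ioo] with τ hτ
    have hσ := sub_pos.2 (hT.lt τ t hτ.1.le hτ.2)
    have hlwN : 0 ≤ lw τ * N := mul_nonneg (hlw0 τ) hN
    have hlwD0 : 0 ≤ lw τ * D := mul_nonneg (hlw0 τ) hD
    rcases le_or_gt τ T with h | h
    · have hv := (hW.fb τ hτ.1).to_one (hT.one_le_len τ) (hT.len_le hτ.1.le h)
      refine (hclose _ _ hσ hlt (hnear τ hτ.1.le h) _ _ _ hv).mono zero_le_one ?_ ?_
      · rw [hb]
        simp only [Set.indicator, Set.mem_Ioi, not_lt.2 h, if_false, add_zero]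
        rw [← mul_assoc, div_mul_cancel₀ _ hLT.ne']
      · have : 0 ≤ (heatC q d Cg + Cg) * (lw τ * N) := by positivity
        rw [add_mul]
        linarith
    · have h1 := (hT.fBound_heat hg hτ.1.le hτ.2 (hW.fb τ hτ.1)).dilate hl0
      have h2 := h1.rescale hκ0 hscale.1 hscale.2
      have h3 := h2.sub (hgκ.const_mul (m τ)) zero_le_one
      refine h3.mono zero_le_one ?_ ?_
      · rw [hb]
        simp only [Set.indicator, Set.mem_Ioi, h, if_true]
        have h4 : |m τ| * (rescaleC q κ * Cg) ≤ lw τ * D * (rescaleC q κ * Cg) := by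
          gcongr; exact hmb τ hτ.1
        have h5 : 0 ≤ η * (lw τ * D) := by positivity
        rw [hK₂]
        simp only [hlw] at h4 h5 ⊢
        linarith
      · have h4 : |m τ| * Cg ≤ lw τ * N * Cg := by
          gcongr; exact hmN τ hτ.1
        have h5 : 0 ≤ 2 * Cg * (lw τ * N) := by positivity
        simp only [hlw] at h4 h5 ⊢
        linarith
  have hbi1 : IntegrableOn (fun τ => η * (lw τ * D)) (Set.Ioi 1) := hlwD.const_mul η
  have hbi2 : IntegrableOn (Set.indicator (Set.Ioi T) fun τ => K₂ * (lw τ * D)) (Set.Ioi 1) :=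
    IntegrableOn.indicator (hlwD.const_mul K₂) measurableSet_Ioi
  have hbi : IntegrableOn b (Set.Ioi 1) := hbi1.add hbi2
  have hb0 : ∀ τ, 0 ≤ b τ := fun τ => add_nonneg (by have := hlw0 τ; positivity)
    (Set.indicator_nonneg (fun τ _ => by have := hlw0 τ; positivity) τ)
  have hbint : ∫ τ in Set.Ioo 1 t, b τ ≤ (D * lenMass d k S + K₂ * D) * η := by
    calc _ ≤ ∫ τ in Set.Ioi 1, b τ := setIntegral_mono_set hbi (Eventually.of_forall hb0)
          Set.Ioo_subset_Ioi_self.eventuallyLE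
      _ = η * (lenMass d k S * D) + K₂ * ((∫ τ in Set.Ioi T, lw τ) * D) := by
          rw [hb, integral_add hbi1 hbi2, setIntegral_indicator measurableSet_Ioi,
            Set.Ioi_inter_Ioi, max_eq_right hT1.le, integral_const_mul, integral_const_mul,
            integral_mul_const, integral_mul_const, lenMass]
      _ ≤ η * (lenMass d k S * D) + K₂ * (η * D) := by gcongr
      _ = _ := by ring
  have hmeas : Measurable (Function.uncurry fun τ x =>
      l t * heat d g (S t - S τ) (W τ) (l t * x) - m τ * gk d g σ₀ x) := by
    have h1 := (measurable_slices (d := d) hT.cont hgc hW.measurable t).comp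
      (by fun_prop : Measurable fun z : ℝ × ℝ => (z.1, l t * z.2))
    have h2 : Measurable fun z : ℝ × ℝ => m z.1 * gk d g σ₀ z.2 :=
      (hmm.comp measurable_fst).mul ((continuous_gk d hgc σ₀).measurable.comp measurable_snd)
    exact (h1.const_mul (l t)).sub h2
  have hsum := (FBound.integral hmeas (hbi.mono_set Set.Ioo_subset_Ioi_self)
    (hT.integrable_weight t _ N) zero_le_one hslice).2
  -- Mass still to be emitted after t: A counts all times, the Duhamel integral only those before t.
  set Δ := (∫ τ in Set.Ioi 1, m τ) - ∫ τ in Set.Ioo 1 t, m τ with hΔ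
  have hΔb : |Δ| ≤ D * η := by
    have h1 : Δ = ∫ τ in Set.Ioi t, m τ := by
      have h2 : ∫ τ in Set.Ioi 1, m τ = (∫ τ in Set.Ioc 1 t, m τ) + ∫ τ in Set.Ioi t, m τ := by
        rw [← setIntegral_union (Set.disjoint_left.2 fun z hz hz' =>
          not_lt.2 hz.2 (Set.mem_Ioi.1 hz')) measurableSet_Ioi
          (hmi.mono_set Set.Ioc_subset_Ioi_self)
          (hmi.mono_set (Set.Ioi_subset_Ioi ht1.le)), Set.Ioc_union_Ioi_eq_Ioi ht1.le]
      rw [hΔ, h2, integral_Ioc_eq_integral_Ioo, add_sub_cancel_left]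
    rw [h1, ← Real.norm_eq_abs]
    calc _ ≤ ∫ τ in Set.Ioi t, lw τ * D := by
          refine norm_integral_le_of_norm_le (hlwD.mono_set (Set.Ioi_subset_Ioi ht1.le)) ?_
          filter_upwards [ae_restrict_mem measurableSet_Ioi] with τ hτ
          exact hmb τ (ht1.trans hτ)
      _ ≤ ∫ τ in Set.Ioi T, lw τ * D := by
          refine setIntegral_mono_set (hlwD.mono_set (Set.Ioi_subset_Ioi hT1.le))
            (Eventually.of_forall fun τ => mul_nonneg (hlw0 τ) hD)
            (Set.Ioi_subset_Ioi htT.le).eventuallyLE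
      _ ≤ _ := by rw [integral_mul_const, mul_comm]; gcongr
  have htotal := (hlin.add hsum zero_le_one).sub (hgκ.const_mul Δ) zero_le_one
  refine ⟨_, ((htotal.congr fun x => ?_).mono zero_le_one ?_ le_rfl)⟩
  · have i1 : IntegrableOn (fun τ => l t * heat d g (S t - S τ) (W τ) (l t * x)) (Set.Ioo 1 t) :=
      (hT.integrable_heat_time hq hg hgc hW t (l t * x)).const_mul _
    have i2 : IntegrableOn (fun τ => m τ * gk d g σ₀ x) (Set.Ioo 1 t) :=
      (hmi.mono_set Set.Ioo_subset_Ioi_self).mul_const _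
    rw [integral_sub i1 i2, integral_const_mul, integral_mul_const, hΔ, duh]
    ring
  · have h1 : |Δ| * (rescaleC q κ * Cg) ≤ D * η * (rescaleC q κ * Cg) := by gcongr
    linarith

end Asymptotics

/-! ### The norm of `B_q` -/

theorem FBound.bqNorm_le {q : ℕ} {L B N : ℝ} {u : ℝ → ℝ} (hu : FBound q L B N u) (hL : 1 ≤ L) :
    bqNorm q u ≤ ENNReal.ofReal ((1 + L) * B) := by
  refine iSup_le fun ω => ENNReal.ofReal_le_ofReal ?_
  have h1 := wt_mono q zero_le_one hL ω
  have e : 1 + |ω| ^ q = wt q 1 ω := by rw [wt, one_mul]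
  rw [e]
  calc _ ≤ wt q L ω * (‖fourierT u ω‖ + ‖deriv (fourierT u) ω‖) := by gcongr
    _ ≤ _ := by
      rw [mul_add]
      linarith [hu.bd ω, hu.bd_deriv ω]

theorem FBound.memBq {q : ℕ} {L B N : ℝ} {u : ℝ → ℝ} (hu : FBound q L B N u) (hL : 1 ≤ L) :
    MemBq q u :=
  ⟨hu.integrable, hu.contDiff, (hu.bqNorm_le hL).trans_lt ENNReal.ofReal_lt_top⟩

theorem MemBq.fBound {q : ℕ} {f : ℝ → ℝ} (hf : MemBq q f) {ε : ℝ} (hε : 0 ≤ ε)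
    (h : bqNorm q f ≤ ENNReal.ofReal ε) : FBound q 1 ε (∫ x, |f x|) f := by
  have key : ∀ ω, wt q 1 ω * (‖fourierT f ω‖ + ‖deriv (fourierT f) ω‖) ≤ ε := by
    intro ω
    have := (ENNReal.ofReal_le_ofReal_iff hε).1 ((le_iSup (fun ω : ℝ => ENNReal.ofReal
      ((1 + |ω| ^ q) * (‖fourierT f ω‖ + ‖deriv (fourierT f) ω‖))) ω).trans h)
    rwa [wt, one_mul]
  refine ⟨hf.integrable, le_rfl, hf.contDiff, fun ω => ?_, fun ω => ?_⟩
  · refine le_trans ?_ (key ω)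
    have := wt_pos q zero_le_one ω
    gcongr
    exact le_add_of_nonneg_right (norm_nonneg _)
  · rw [one_mul]
    refine le_trans ?_ (key ω)
    have := wt_pos q zero_le_one ω
    gcongr
    exact le_add_of_nonneg_left (norm_nonneg _)

theorem KernelG.fBound' {q M : ℕ} {d : ℝ} {G : ℝ → ℝ → ℝ} (hG : KernelG q M d G) :
    ∃ C, FBound (q + 1) 1 C C (fun x => G x 1) ∧ FBound q 1 C C (fun x => G x 1) := by
  obtain ⟨C, hC⟩ := hG.fBound
  have hC0 := hC.nonneg_N
  have hw : ∀ ω, wt q 1 ω ≤ 2 * wt (q + 1) 1 ω := by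
    intro ω
    unfold wt
    rw [one_mul]
    rcases le_total |ω| 1 with h | h
    · have := pow_le_one₀ (n := q) (abs_nonneg ω) h
      have : 0 ≤ |ω| ^ (q + 1) := by positivity
      linarith
    · have := pow_le_pow_right₀ h (Nat.le_succ q)
      have : 0 ≤ |ω| ^ (q + 1) := by positivity
      simp only [Nat.succ_eq_add_one] at *
      linarith
  refine ⟨2 * C, hC.mono zero_le_one (by linarith) (by linarith), hC.integrable,
    hC.l1.trans (by linarith), hC.contDiff, fun ω => ?_, fun ω => ?_⟩
  · calc _ ≤ 2 * wt (q + 1) 1 ω * ‖fourierT (fun x => G x 1) ω‖ := by gcongr; exact hw ω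
      _ ≤ _ := by linarith [hC.bd ω]
  · calc _ ≤ 2 * wt (q + 1) 1 ω * ‖deriv (fourierT (fun x => G x 1)) ω‖ := by gcongr; exact hw ω
      _ ≤ _ := by linarith [hC.bd_deriv ω]

theorem KernelG.eq_gk {q M : ℕ} {d : ℝ} {G : ℝ → ℝ → ℝ} (hG : KernelG q M d G) {σ : ℝ}
    (hσ : 0 < σ) (x : ℝ) : G x σ = gk d (fun x => G x 1) σ x :=
  hG.scaling x σ hσ

/-! ### Uniqueness -/

section Solution

variable {q M : ℕ} {d : ℝ} {G : ℝ → ℝ → ℝ} {p : ℝ} {c : ℝ → ℝ} {α : ℕ} {a : ℕ → ℝ} {lam : ℝ}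
  {f : ℝ → ℝ}

theorem IsSolution.integrable_prod {u : ℝ → ℝ → ℝ} (hu : IsSolution q G c lam α a f u) {t : ℝ}
    (ht : 1 < t) (x : ℝ) :
    Integrable (fun z : ℝ × ℝ => G (x - z.1) (timeS c t - timeS c z.2) * nonlin lam α a (u z.1 z.2))
      (volume.prod (volume.restrict (Set.Ioo 1 t))) := by
  have := hu.integrable x t ht
  rwa [IntegrableOn, Measure.volume_eq_prod, ← Measure.prod_restrict, Measure.restrict_univ] at this

/-- Induction on n: one use of the equation, with F Lipschitz on [-r, r] and the kernel of L¹ norm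
at most C, integrates the previous bound in time. Only sup norms of the solutions enter, so nothing
beyond `IsSolution` is asked of them. -/
theorem IsSolution.abs_sub_le (hG : KernelG q M d G) (hc : CoeffC p c)
    (hlam : |lam| ≤ 1) {u v : ℝ → ℝ → ℝ} (hu : IsSolution q G c lam α a f u)
    (hv : IsSolution q G c lam α a f v) {T : ℝ} {r : ℝ≥0} (hr : (r : ℝ≥0∞) < convRadius a)
    (hur : ∀ x t : ℝ, 1 < t → t ≤ T → |u x t| ≤ r) (hvr : ∀ x t : ℝ, 1 < t → t ≤ T → |v x t| ≤ r)
    {C : ℝ} (hg : FBound q 1 C C (fun x => G x 1)) (n : ℕ) :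
    ∀ t, 1 < t → t ≤ T → ∀ x,
      |v x t - u x t| ≤ 2 * r * ((C * lipC α a r * (t - 1)) ^ n / n.factorial) := by
  have hC := hg.nonneg_N
  have hlip := lipC_nonneg α a r
  induction n with
  | zero =>
    intro t h1 h2 x
    have := abs_sub (v x t) (u x t)
    simp only [pow_zero, Nat.factorial_zero, Nat.cast_one, div_one, mul_one]
    linarith [hur x t h1 h2, hvr x t h1 h2]
  | succ n ih =>
    intro t h1 h2 x
    have iu := hu.integrable_prod h1 x
    have iv := hv.integrable_prod h1 x
    rw [hv.equation x t h1, hu.equation x t h1, add_sub_add_left_eq_sub,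
      intervalIntegral.integral_of_le h1.le, intervalIntegral.integral_of_le h1.le,
      integral_Ioc_eq_integral_Ioo, integral_Ioc_eq_integral_Ioo,
      ← integral_sub iv.integral_prod_right iu.integral_prod_right]
    set b : ℝ → ℝ := fun τ =>
      C * lipC α a r * (2 * r * ((C * lipC α a r * (τ - 1)) ^ n / n.factorial)) with hb
    have hbc : Continuous b := by fun_prop
    have hbi : IntegrableOn b (Set.Ioo 1 t) :=
      (hbc.integrableOn_Icc (a := 1) (b := t)).mono_set Set.Ioo_subset_Icc_self
    have hle : ∀ᵐ τ ∂(volume.restrict (Set.Ioo 1 t)),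
        ‖(∫ y, G (x - y) (timeS c t - timeS c τ) * nonlin lam α a (v y τ)) -
          ∫ y, G (x - y) (timeS c t - timeS c τ) * nonlin lam α a (u y τ)‖ ≤ b τ := by
      -- Absolute convergence of the double integral gives integrable slices for almost every τ,
      -- which is enough here.
      filter_upwards [ae_restrict_mem measurableSet_Ioo, iv.prod_left_ae, iu.prod_left_ae]
        with τ hτ h3 h4
      have hσ : 0 < timeS c t - timeS c τ := sub_pos.2 (hc.timeS_lt hτ.1.le hτ.2)
      have hk := hg.gk (d := d) hσ
      have hGi : Integrable fun y => |G (x - y) (timeS c t - timeS c τ)| := by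
        refine (hk.integrable.comp_sub_left x).abs.congr (Eventually.of_forall fun y => ?_)
        simp only [hG.eq_gk hσ]
      have hGl : ∫ y, |G (x - y) (timeS c t - timeS c τ)| ≤ C := by
        have := integral_sub_left_eq_self
          (fun y => |gk d (fun x => G x 1) (timeS c t - timeS c τ) y|) volume x
        simp only [hG.eq_gk hσ]
        rw [this]
        exact hk.l1
      have hτT := hτ.2.le.trans h2
      rw [← integral_sub h3 h4]
      set E := 2 * r * ((C * lipC α a r * (τ - 1)) ^ n / n.factorial) with hE
      have hE0 : 0 ≤ E := (abs_nonneg _).trans (ih τ hτ.1 hτT x)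
      calc _ ≤ ∫ y, |G (x - y) (timeS c t - timeS c τ)| * (lipC α a r * E) := by
            refine norm_integral_le_of_norm_le (hGi.mul_const _) (Eventually.of_forall fun y => ?_)
            rw [← mul_sub, norm_mul, Real.norm_eq_abs, Real.norm_eq_abs]
            refine mul_le_mul_of_nonneg_left ?_ (abs_nonneg _)
            refine (abs_nonlin_sub_le hlam α hr (hvr y τ hτ.1 hτT) (hur y τ hτ.1 hτT)).trans ?_
            exact mul_le_mul_of_nonneg_left (ih τ hτ.1 hτT y) hlip
        _ ≤ C * (lipC α a r * E) := by
            rw [integral_mul_const]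
            gcongr
        _ = b τ := (mul_assoc _ _ _).symm
    refine (norm_integral_le_of_norm_le hbi hle).trans (le_of_eq ?_)
    rw [← integral_Ioc_eq_integral_Ioo, ← intervalIntegral.integral_of_le h1.le, hb]
    have e : (fun τ : ℝ => C * lipC α a r * (2 * r * ((C * lipC α a r * (τ - 1)) ^ n / n.factorial)))
        = fun τ => (2 * r * (C * lipC α a r) ^ (n + 1) / n.factorial) * (τ - 1) ^ n := by
      ext τ; rw [mul_pow]; ring
    rw [e]
    generalize C * lipC α a r = K
    rw [intervalIntegral.integral_const_mul,
      intervalIntegral.integral_comp_sub_right (fun τ => τ ^ n), integral_pow, sub_self,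
      zero_pow (Nat.succ_ne_zero n), sub_zero, Nat.factorial_succ, mul_pow]
    push_cast
    field_simp

theorem IsSolution.unique (hG : KernelG q M d G) (hc : CoeffC p c)
    (hlam : |lam| ≤ 1) {u v : ℝ → ℝ → ℝ} (hu : IsSolution q G c lam α a f u)
    (hv : IsSolution q G c lam α a f v) (x t : ℝ) (ht : 1 < t) : v x t = u x t := by
  obtain ⟨C, -, hg⟩ := hG.fBound'
  obtain ⟨r₁, h1, h1'⟩ := hu.inDisc t
  obtain ⟨r₂, h2, h2'⟩ := hv.inDisc t
  have hr : ((max r₁ r₂ : ℝ≥0) : ℝ≥0∞) < convRadius a := by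
    rcases max_cases r₁ r₂ with ⟨e, -⟩ | ⟨e, -⟩ <;> rw [e] <;> assumption
  have key := fun n => IsSolution.abs_sub_le hG hc hlam hu hv hr
    (fun x s hs hs' => (h1' x s hs hs').trans (by exact_mod_cast le_max_left _ _))
    (fun x s hs hs' => (h2' x s hs hs').trans (by exact_mod_cast le_max_right _ _)) hg n
    t ht le_rfl x
  have hlim := (FloorSemiring.tendsto_pow_div_factorial_atTop
    (C * lipC α a (max r₁ r₂ : ℝ≥0) * (t - 1))).const_mul (2 * ((max r₁ r₂ : ℝ≥0) : ℝ))
  rw [mul_zero] at hlim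
  exact sub_eq_zero.1 (abs_eq_zero.1 (le_antisymm (ge_of_tendsto' hlim key) (abs_nonneg _)))

/-! ### The mild solution solves the integral equation -/

theorem duh_eq_intervalIntegral (hG : KernelG q M d G) (hc : CoeffC p c) {w : ℝ → ℝ → ℝ}
    {r : ℝ≥0} (hw : ∀ τ, 1 < τ → ∀ y, |w τ y| ≤ r) {t : ℝ} (ht : 1 < t) (x : ℝ) :
    duh d (fun x => G x 1) (fun t => timeS c (max t 1))
      (fun τ y => nonlinTrunc lam α a r (w τ y)) t x =
    ∫ τ in (1 : ℝ)..t, ∫ y : ℝ, G (x - y) (timeS c t - timeS c τ) * nonlin lam α a (w τ y) := by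
  rw [intervalIntegral.integral_of_le ht.le, integral_Ioc_eq_integral_Ioo, duh]
  refine setIntegral_congr_fun measurableSet_Ioo fun τ hτ => ?_
  have hσ : 0 < timeS c t - timeS c τ := sub_pos.2 (hc.timeS_lt hτ.1.le hτ.2)
  simp only [heat, max_eq_left ht.le, max_eq_left hτ.1.le]
  congr 1; ext y
  rw [hG.eq_gk hσ, nonlinTrunc_eq lam α a (hw τ hτ.1 y)]

theorem isSolution_of_mild (hG : KernelG q M d G) (hc : CoeffC p c)
    (hT : TimeData d (α - 1) fun t => timeS c (max t 1)) (hα : 1 < α) (hlam : |lam| ≤ 1)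
    {r : ℝ≥0} (hr : (r : ℝ≥0∞) < convRadius a) {R N : ℝ} (hR : algK q * R ≤ r)
    {w : ℝ → ℝ → ℝ}
    (hw : Adm q (lenS d fun t => timeS c (max t 1)) (fun _ => R) (fun _ => N) w)
    (heq : ∀ t, 1 < t → ∀ x, w t x = heat d (fun x => G x 1) (timeS c (max t 1)) f x +
      duh d (fun x => G x 1) (fun t => timeS c (max t 1))
        (fun τ y => nonlinTrunc lam α a r (w τ y)) t x) :
    IsSolution q G c lam α a f (fun x t => w t x) := by
  obtain ⟨C, -, hg⟩ := hG.fBound'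
  have hq := hG.one_lt_q
  have hgc : Continuous fun x => G x 1 := hG.smooth.continuous
  have hwr : ∀ τ, 1 < τ → ∀ y, |w τ y| ≤ r := fun τ hτ y => hw.abs_le hT hq hR hτ y
  have hR0 : 0 ≤ R := (hw.fb 2 one_lt_two).nonneg_B (hT.len_pos 2).le
  refine ⟨fun t ht => (hw.fb t ht).memBq (hT.one_le_len t), fun T => ?_,
    fun T => ⟨r, hr, fun x t ht _ => hwr t ht x⟩, fun x t ht => ?_, fun x t ht => ?_⟩
  · refine ⟨((1 + lenS d (fun t => timeS c (max t 1)) T) * R).toNNReal, fun t h1 h2 => ?_⟩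
    refine ((hw.fb t h1).bqNorm_le (hT.one_le_len t)).trans ?_
    refine ENNReal.ofReal_le_ofReal ?_
    have := hT.len_le h1.le h2
    gcongr
  · have h1 := hT.integrable_heat_space_time hq hg hgc
      (mul_nonneg (lipC_nonneg α a r) hR0)
      (hw.nonlinTrunc hT hq hα hlam hr hR) t x
    refine h1.congr_fun (fun z hz => ?_) (MeasurableSet.univ.prod measurableSet_Ioo)
    have hz2 : z.2 ∈ Set.Ioo 1 t := hz.2
    have hσ : 0 < timeS c t - timeS c z.2 := sub_pos.2 (hc.timeS_lt hz2.1.le hz2.2)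
    simp only [max_eq_left ht.le, max_eq_left hz2.1.le]
    rw [hG.eq_gk hσ, nonlinTrunc_eq lam α a (hwr z.2 hz2.1 z.1)]
  · rw [heq t ht x, duh_eq_intervalIntegral hG hc hwr ht x, max_eq_left ht.le]
    congr 1
    have hσ : 0 < timeS c t := by
      have := hc.timeS_lt le_rfl ht
      simpa [timeS] using this
    rw [heat]
    congr 1; ext y
    rw [hG.eq_gk hσ]

theorem tendsto_bqNorm_of_mild (hG : KernelG q M d G) (hc : CoeffC p c)
    (hT : TimeData d (α - 1) fun t => timeS c (max t 1)) (hα : 1 < α) (hlam : |lam| ≤ 1)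
    {r : ℝ≥0} (hr : (r : ℝ≥0∞) < convRadius a) {R N : ℝ} (hR : algK q * R ≤ r)
    {Bf Nf : ℝ} (hf : FBound q 1 Bf Nf f) {w : ℝ → ℝ → ℝ}
    (hw : Adm q (lenS d fun t => timeS c (max t 1)) (fun _ => R) (fun _ => N) w)
    (heq : ∀ t, 1 < t → ∀ x, w t x = heat d (fun x => G x 1) (timeS c (max t 1)) f x +
      duh d (fun x => G x 1) (fun t => timeS c (max t 1))
        (fun τ y => nonlinTrunc lam α a r (w τ y)) t x) :
    ∃ A : ℝ, Tendsto (fun t : ℝ => bqNorm q (fun x =>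
      t ^ ((p + 1) / d) * w t (t ^ ((p + 1) / d) * x) - A * G x (1 / (p + 1)))) atTop (𝓝 0) := by
  obtain ⟨C, hg', hg⟩ := hG.fBound'
  have hq := hG.one_lt_q
  have hd := hG.d_pos
  have hgc : Continuous fun x => G x 1 := hG.smooth.continuous
  have hp1 : 0 < p + 1 := by linarith [hc.p_pos]
  have hR0 : 0 ≤ R := (hw.fb 2 one_lt_two).nonneg_B (hT.len_pos 2).le
  have hN0 : 0 ≤ N := (hw.fb 2 one_lt_two).nonneg_N
  have hlip := lipC_nonneg α a r
  have hlim : Tendsto (fun t => timeS c (max t 1) / (t ^ ((p + 1) / d)) ^ d) atTop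
      (𝓝 (1 / (p + 1))) := by
    refine hc.tendsto_timeS_div.congr' ?_
    filter_upwards [eventually_ge_atTop 1] with t ht
    rw [max_eq_left ht, ← Real.rpow_mul (by linarith), div_mul_cancel₀ _ hd.ne']
  obtain ⟨E, hE, hev⟩ := hT.eventually_fBound_sub hq hg' hg hgc (show 0 < 1 / (p + 1) by positivity)
    (tendsto_rpow_atTop (show 0 < (p + 1) / d by positivity)) hlim hf
    (mul_nonneg hlip hR0) (mul_nonneg hlip hN0) (hw.nonlinTrunc hT hq hα hlam hr hR)
  set A := (∫ y, f y) + ∫ τ in Set.Ioi 1, ∫ y, nonlinTrunc lam α a r (w τ y) with hA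
  refine ⟨A, ENNReal.tendsto_nhds_zero.2 fun ε hε => ?_⟩
  obtain ⟨ε', hε'0, hε'⟩ : ∃ ε' : ℝ, 0 < ε' ∧ ENNReal.ofReal ε' ≤ ε := by
    obtain ⟨e, h1, h2⟩ := ENNReal.lt_iff_exists_nnreal_btwn.1 hε
    refine ⟨e, by exact_mod_cast h1, ?_⟩
    rw [ENNReal.ofReal_coe_nnreal]; exact h2.le
  -- At scale 1, `FBound.bqNorm_le` costs a factor 2, so this η yields norm at most ε' E/(E + 1).
  filter_upwards [hev (ε' / (2 * (E + 1))) (by positivity), eventually_gt_atTop 1] with t h1 ht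
  obtain ⟨N', h2⟩ := h1
  have h3 := (h2.congr (v := fun x => t ^ ((p + 1) / d) * w t (t ^ ((p + 1) / d) * x) -
    A * G x (1 / (p + 1))) fun x => by
      rw [heq t ht, hG.eq_gk (show 0 < 1 / (p + 1) by positivity)]).bqNorm_le le_rfl
  refine h3.trans (le_trans (ENNReal.ofReal_le_ofReal ?_) hε')
  have : (1 + 1) * (E * (ε' / (2 * (E + 1)))) = ε' * (E / (E + 1)) := by field_simp; ring
  rw [this]
  refine mul_le_of_le_one_right hε'0.le ?_
  rw [div_le_one (by positivity)]; linarith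

end Solution

end RGIntegral

/-! ### Proof of the theorem -/

theorem theorem1 (q M : ℕ) (d : ℝ) (G : ℝ → ℝ → ℝ) (hG : RGIntegral.KernelG q M d G)
    (p : ℝ) (c : ℝ → ℝ) (hc : RGIntegral.CoeffC p c)
    (α : ℕ) (a : ℕ → ℝ) (hα : (p + 1 + d) / (p + 1) < (α : ℝ))
    (ha : 0 < RGIntegral.convRadius a) :
    ∃ ε : ℝ, 0 < ε ∧
      ∀ lam ∈ Set.Icc (-1 : ℝ) 1, ∀ f : ℝ → ℝ, RGIntegral.MemBq q f →
        RGIntegral.bqNorm q f < ENNReal.ofReal ε →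
        ∃ u : ℝ → ℝ → ℝ,
          RGIntegral.IsSolution q G c lam α a f u ∧
          (∀ v : ℝ → ℝ → ℝ, RGIntegral.IsSolution q G c lam α a f v →
            ∀ x t : ℝ, 1 < t → v x t = u x t) ∧
          ∃ A : ℝ,
            Tendsto
              (fun t : ℝ => RGIntegral.bqNorm q
                (fun x => t ^ ((p + 1) / d) * u (t ^ ((p + 1) / d) * x) t
                  - A * G x (1 / (p + 1))))
              atTop (𝓝 0) := by
  have hp1 : 0 < p + 1 := by linarith [hc.p_pos]
  have hα1 : 1 < α := by
    have : (1 : ℝ) < α := by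
      refine lt_of_le_of_lt ?_ hα
      rw [le_div_iff₀ hp1]; linarith [hG.d_pos]
    exact_mod_cast this
  have hT := hc.timeData hG.d_pos hα
  obtain ⟨C, -, hg⟩ := hG.fBound'
  have hH := RGIntegral.heatC_nonneg (q := q) (d := d) hg.nonneg_N
  obtain ⟨r, R, hR0, hr, hR, hsmall⟩ := RGIntegral.exists_small_radius q hα1 ha
    (mul_nonneg hH (RGIntegral.lenMass_nonneg hT))
  -- The threshold is fixed before λ and f; it makes the linear evolution at most R/2. The radius r
  -- and R depend on the kernel, c, α and the coefficients only.
  refine ⟨R / (2 * (RGIntegral.heatC q d C + 1)), by positivity, fun lam hlam f hf hfε => ?_⟩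
  have hlam' : |lam| ≤ 1 := abs_le.2 hlam
  have hfB := hf.fBound (by positivity) hfε.le
  obtain ⟨w, hw, heq⟩ := RGIntegral.exists_mild_solution hT hG.one_lt_q hα1 hg
    hG.smooth.continuous hlam' hr hR hsmall hfB
  have hsol := RGIntegral.isSolution_of_mild hG hc hT hα1 hlam' hr hR hw heq
  exact ⟨fun x t => w t x, hsol, fun v hv x t ht => hsol.unique hG hc hlam' hv x t ht,
    RGIntegral.tendsto_bqNorm_of_mild hG hc hT hα1 hlam' hr hR hfB hw heq⟩
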